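/- Let $\varepsilon>0$, $\mu>0$, and consider on $\mathbb R$ the equation $$\zeta_t+\zeta_x+\tfrac32\varepsilon\zeta\zeta_x-\tfrac38\varepsilon^2\zeta^2\zeta_x+\tfrac3{16}\varepsilon^3\zeta^3\zeta_x+\tfrac{\mu}{12}(\zeta_{xxx}-\zeta_{xxt})=-\tfrac{7}{24}\varepsilon\mu\,(\zeta\zeta_{xxx}+2\zeta_x\zeta_{xx}).\qquad (*)$$ A solution on $[0,T)$ with initial profile $\zeta_0\in H^3(\mathbb R)$ is a function $\zeta\in C([0,T);H^3(\mathbb R))\cap C^1([0,T);H^2(\mathbb R))$ with $\zeta(0,\cdot)=\zeta_0$ that satisfies $(*)$ in $L^2(\mathbb R)$ for every $t\in[0,T)$; for each $t$, $\zeta(t,\cdot)$ is identified with its continuous representative. It is maximal, with maximal existence time $T$, if no solution on an interval $[0,T')$ with $T'>T$ extends it. Let $\zeta_0\in H^3(\mathbb R)$, and let $\zeta$ be a maximal solution of $(*)$ with initial profile $\zeta_0$ whose maximal existence time $T>0$ is finite. Then $$\sup_{t\in[0,T),\,x\in\mathbb R}|\zeta(t,x)|<\infty ,$$ for every $t\in[0,T)$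 the function $\zeta(t,\cdot)$ is differentiable with $\sup_{x\in\mathbb R}\zeta_x(t,x)<\infty$, and $$\sup_{x\in\mathbb R}\zeta_x(t,x)\uparrow+\infty\quad\text{as } t\uparrow T,$$ that is, $\lim_{t\uparrow T}\sup_{x}\zeta_x(t,x)=+\infty$ and there is $t_0\in[0,T)$ such that $t\mapsto\sup_{x}\zeta_x(t,x)$ is strictly increasing on $[t_0,T)$. -/

import Mathlib

open MeasureTheory Set Filter Topology
open scoped ENNReal ContDiff

/-- `v` is the weak (distributional) derivative of `u`, for `u, v` in `L²(ℝ)`: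
`∫ u φ' = - ∫ v φ` for every smooth compactly supported real function `φ`. -/
def IsWeakDeriv (u v : Lp ℝ 2 (volume : Measure ℝ)) : Prop :=
  ∀ φ : ℝ → ℝ, ContDiff ℝ ∞ φ → HasCompactSupport φ →
    ∫ x, u x * deriv φ x = - ∫ x, v x * φ x

theorem integrable_lp_mul_test (u : Lp ℝ 2 (volume : Measure ℝ)) {φ : ℝ → ℝ}
    (hφ : Continuous φ) (hc : HasCompactSupport φ) :
    Integrable (fun x => u x * φ x) := by
  have h : MemLp φ 2 (volume : Measure ℝ) := hφ.memLp_of_hasCompactSupport hc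
  exact MemLp.integrable_mul (Lp.memLp u) h

theorem IsWeakDeriv.zero : IsWeakDeriv 0 0 := by
  intro φ _ _
  have h : ((0 : Lp ℝ 2 (volume : Measure ℝ)) : ℝ → ℝ) =ᵐ[volume] 0 := Lp.coeFn_zero _ _ _
  have h1 : ∫ x, (0 : Lp ℝ 2 (volume : Measure ℝ)) x * deriv φ x = 0 :=
    integral_eq_zero_of_ae (h.mono fun x _ => by simp)
  have h2 : ∫ x, (0 : Lp ℝ 2 (volume : Measure ℝ)) x * φ x = 0 :=
    integral_eq_zero_of_ae (h.mono fun x _ => by simp)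
  rw [h1, h2, neg_zero]

theorem IsWeakDeriv.add {u v u' v' : Lp ℝ 2 (volume : Measure ℝ)}
    (h : IsWeakDeriv u v) (h' : IsWeakDeriv u' v') : IsWeakDeriv (u + u') (v + v') := by
  have key : ∀ (a b : Lp ℝ 2 (volume : Measure ℝ)) (ψ : ℝ → ℝ), Continuous ψ →
      HasCompactSupport ψ →
      ∫ x, (a + b : Lp ℝ 2 (volume : Measure ℝ)) x * ψ x
        = (∫ x, a x * ψ x) + ∫ x, b x * ψ x := by
    intro a b ψ hψ hc
    rw [← integral_add (integrable_lp_mul_test a hψ hc) (integrable_lp_mul_test b hψ hc)]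
    refine integral_congr_ae ((Lp.coeFn_add a b).mono fun x hx => ?_)
    simp only [hx, Pi.add_apply, add_mul]
  intro φ hφ hc
  rw [key u u' _ (hφ.continuous_deriv (by simp)) hc.deriv, key v v' _ hφ.continuous hc,
    h φ hφ hc, h' φ hφ hc]
  ring

theorem IsWeakDeriv.smul (c : ℝ) {u v : Lp ℝ 2 (volume : Measure ℝ)}
    (h : IsWeakDeriv u v) : IsWeakDeriv (c • u) (c • v) := by
  have key : ∀ (a : Lp ℝ 2 (volume : Measure ℝ)) (ψ : ℝ → ℝ),
      ∫ x, (c • a : Lp ℝ 2 (volume : Measure ℝ)) x * ψ x = c * ∫ x, a x * ψ x := by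
    intro a ψ
    rw [← integral_const_mul]
    refine integral_congr_ae ((Lp.coeFn_smul c a).mono fun x hx => ?_)
    simp only [hx, Pi.smul_apply, smul_eq_mul, mul_assoc]
  intro φ hφ hc
  rw [key, key, h φ hφ hc]
  ring

/-- The Sobolev space `Hᵏ(ℝ)` of real functions, as the tuples `(u, u', …, u⁽ᵏ⁾)` of `L²` functions
in which each entry is the weak derivative of the one before (so the tuple is determined by `u`),
inside the Hilbert sum of `k + 1` copies of `L²(ℝ)`.  The inherited norm is
`‖u‖² = ∑_{i ≤ k} ‖u⁽ⁱ⁾‖²_{L²}`. -/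
def sobolevSubmodule (k : ℕ) :
    Submodule ℝ (PiLp 2 (fun _ : Fin (k + 1) => Lp ℝ 2 (volume : Measure ℝ))) where
  carrier := {u | ∀ i : Fin k, IsWeakDeriv (u i.castSucc) (u i.succ)}
  zero_mem' := fun _ => IsWeakDeriv.zero
  add_mem' := fun hu hv i => (hu i).add (hv i)
  smul_mem' := fun c _ hu i => (hu i).smul c

/-- The Sobolev space `Hᵏ(ℝ)` with its Hilbert norm. -/
abbrev SobolevH (k : ℕ) : Type := sobolevSubmodule k

/-- The `i`-th weak derivative `∂ₓⁱ u ∈ L²(ℝ)` of `u ∈ Hᵏ(ℝ)`, for `i ≤ k`. -/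
def SobolevH.d {k : ℕ} (u : SobolevH k) (i : Fin (k + 1)) : Lp ℝ 2 (volume : Measure ℝ) :=
  u.1 i

/-- The inclusion `Hᵏ⁺¹(ℝ) ⊂ Hᵏ(ℝ)`. -/
def SobolevH.incl {k : ℕ} (u : SobolevH (k + 1)) : SobolevH k :=
  ⟨WithLp.toLp 2 (fun i : Fin (k + 1) => u.1 i.castSucc), fun i => u.2 i.castSucc⟩

/-- `f` is the continuous representative of `u ∈ Hᵏ(ℝ)`. -/
def SobolevH.IsRep {k : ℕ} (u : SobolevH k) (f : ℝ → ℝ) : Prop :=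
  Continuous f ∧ ⇑(u.d 0) =ᵐ[volume] f

/-- For `u ∈ H³(ℝ)` and `w ∈ H²(ℝ)` in the role of `ζ_t`, the identity in `L²(ℝ)`
`ζ_t + ζ_x + (3/2)ε ζζ_x - (3/8)ε²ζ²ζ_x + (3/16)ε³ζ³ζ_x + (μ/12)(ζ_xxx - ζ_xxt)
  = -(7/24)εμ(ζζ_xxx + 2ζ_xζ_xx)`. -/
def SurfaceEq (ε μ : ℝ) (u : SobolevH 3) (w : SobolevH 2) : Prop :=
  ∀ᵐ x : ℝ,
    w.d 0 x + u.d 1 x + 3 / 2 * ε * u.d 0 x * u.d 1 x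
      - 3 / 8 * ε ^ 2 * (u.d 0 x) ^ 2 * u.d 1 x
      + 3 / 16 * ε ^ 3 * (u.d 0 x) ^ 3 * u.d 1 x
      + μ / 12 * (u.d 3 x - w.d 2 x)
    = -(7 / 24) * ε * μ * (u.d 0 x * u.d 3 x + 2 * u.d 1 x * u.d 2 x)

/-- `ζ` is a solution of the surface equation on `[0,T)` with initial profile `ζ₀`, in the class
`C([0,T); H³(ℝ)) ∩ C¹([0,T); H²(ℝ))`.  Here `ζ t` is the continuous representative of the profile
`U t ∈ H³(ℝ)`, and the time derivative is taken in `H²(ℝ)` (one-sided at `t = 0`). -/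
def IsSurfaceSolution (ε μ : ℝ) (ζ₀ : SobolevH 3) (T : ℝ) (ζ : ℝ → ℝ → ℝ) : Prop :=
  ∃ U : ℝ → SobolevH 3,
    (∀ t ∈ Ico 0 T, (U t).IsRep (ζ t)) ∧
    ContinuousOn U (Ico 0 T) ∧
    ContDiffOn ℝ 1 (fun t => (U t).incl) (Ico 0 T) ∧
    U 0 = ζ₀ ∧
    ∀ t ∈ Ico 0 T, SurfaceEq ε μ (U t) (derivWithin (fun s => (U s).incl) (Ico 0 T) t)

/-- `ζ` is a maximal solution with finite existence time `T > 0`: it solves the problem on `[0,T)`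
and no solution on a longer interval `[0,T')` extends it. -/
def IsMaximalSurfaceSolution (ε μ : ℝ) (ζ₀ : SobolevH 3) (T : ℝ) (ζ : ℝ → ℝ → ℝ) : Prop :=
  0 < T ∧ IsSurfaceSolution ε μ ζ₀ T ζ ∧
    ∀ T' > T, ∀ ζ' : ℝ → ℝ → ℝ, IsSurfaceSolution ε μ ζ₀ T' ζ' →
      ¬ ∀ t ∈ Ico 0 T, ζ' t = ζ t

/-! Put κ = μ/12 and a = 7ε/2. Inverting 1 - κ∂² turns the equation into the nonlocal transport form
ζ_t = (1 + aζ)ζ_x - ∂ₓ(1 - κ∂²)⁻¹G, where G = g(ζ) - (aκ/2)ζ_x² and g is a quartic polynomial with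
g(0) = 0. Along the characteristics y_t = -(1 + aζ(t, y)) the elevation z = ζ∘y and the slope v =
ζ_x∘y satisfy v_t = (a/2)v² + κ⁻¹(g(z) - R), where R is the pressure (1 - κ∂²)⁻¹G read along the
flow.

The energy ∫ ζ² + κζ_x² is conserved (`LagrangianSolution.energy_eq`). It bounds ζ uniformly, and it
bounds R too (`abs_R_le`). So v solves a Riccati equation with bounded forcing and positive
quadratic coefficient: it cannot escape to -∞ in finite time, and above a threshold it grows at a
definite rate (`LagrangianSolution.exists_threshold`).

For the continuation criterion, the displacement, the Jacobian q = y_ξ minus one, and ζ, ζ_x, ζ_xx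
along the flow form a solution of an ODE with a C¹ field on an open subset of (H¹)⁵; no derivative
is lost. If the slope is bounded above on a finite interval, it is bounded, q is bounded away from 0
and ∞, and the field grows at most linearly along the solution. The solution then converges inside
the domain (`LagrangianSolution.exists_tendsto`) and can be continued.

The two descriptions are matched by composing with the inverse flow, which gives a solution in C(H³)
∩ C¹(H²) (`LagrangianSolution.exists_eulerian`), and by uniqueness of such solutions through an H¹
energy estimate for differences (`EulerSolution.eqOn`). Hence the Lagrangian solution lives on all
of [0,T), and maximality forces the slope to be unbounded above there. The threshold property then
gives both the limit +∞ and the final strict monotonicity of the supremum, which is the same in both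
coordinates because the flow is onto. -/

/-! ### Absolutely continuous primitives on the line -/

/-- `f` is a primitive of the locally integrable function `g`. -/
def IsPrimitive (f g : ℝ → ℝ) : Prop :=
  LocallyIntegrable g volume ∧ ∀ a b, f b - f a = ∫ x in a..b, g x

namespace IsPrimitive

variable {f f' g g' : ℝ → ℝ}

theorem intervalIntegrable (h : IsPrimitive f f') (a b : ℝ) : IntervalIntegrable f' volume a b :=
  intervalIntegrable_iff.mpr
    ((h.1.integrableOn_isCompact isCompact_uIcc).mono_set uIoc_subset_uIcc)

theorem congr_right (h : IsPrimitive f f') (hg : f' =ᵐ[volume] g) : IsPrimitive f g :=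
  ⟨h.1.congr hg, fun a b => by
    rw [h.2 a b]
    exact intervalIntegral.integral_congr_ae (hg.mono fun x hx _ => hx)⟩

theorem eq_add (h : IsPrimitive f f') (a : ℝ) : f = fun x => f a + ∫ t in a..x, f' t := by
  funext x; linarith [h.2 a x]

theorem continuous (h : IsPrimitive f f') : Continuous f := by
  rw [h.eq_add 0]
  exact continuous_const.add (intervalIntegral.continuous_primitive (fun a b => h.intervalIntegrable a b) 0)

theorem absolutelyContinuousOnInterval (h : IsPrimitive f f') (a b : ℝ) :
    AbsolutelyContinuousOnInterval f a b := by
  rw [h.eq_add a]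
  have h1 : AbsolutelyContinuousOnInterval (fun _ : ℝ => f a) a b := by
    apply ContDiffOn.absolutelyContinuousOnInterval
    exact contDiffOn_const
  exact h1.add ((h.intervalIntegrable a b).absolutelyContinuousOnInterval_intervalIntegral (by simp))

theorem ae_hasDerivAt (h : IsPrimitive f f') : ∀ᵐ x, HasDerivAt f (f' x) x := by
  filter_upwards [LocallyIntegrable.ae_hasDerivAt_integral h.1] with x hx
  rw [h.eq_add 0]
  exact (hx 0).const_add _

theorem hasDerivAt_of_continuous (h : IsPrimitive f f') (hc : Continuous f') (x : ℝ) :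
    HasDerivAt f (f' x) x := by
  rw [h.eq_add 0]
  exact (intervalIntegral.integral_hasDerivAt_right (h.intervalIntegrable 0 x)
    (hc.stronglyMeasurableAtFilter _ _) hc.continuousAt).const_add _

theorem of_hasDerivAt (h : ∀ x, HasDerivAt f (f' x) x) (hc : Continuous f') : IsPrimitive f f' :=
  ⟨hc.locallyIntegrable, fun a b =>
    (intervalIntegral.integral_eq_sub_of_hasDerivAt (fun x _ => h x) (hc.intervalIntegrable a b)).symm⟩

/-- A primitive of a locally integrable function is absolutely continuous, so integration by parts
holds although the derivatives exist only almost everywhere. -/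
theorem mul (hf : IsPrimitive f f') (hg : IsPrimitive g g') :
    IsPrimitive (fun x => f x * g x) (fun x => f' x * g x + f x * g' x) := by
  constructor
  · exact (hf.1.mul_continuous hg.continuous).add (hg.1.continuous_mul hf.continuous)
  · intro a b
    rw [← AbsolutelyContinuousOnInterval.integral_deriv_mul_eq_sub
      (hf.absolutelyContinuousOnInterval a b) (hg.absolutelyContinuousOnInterval a b)]
    refine intervalIntegral.integral_congr_ae ?_
    filter_upwards [hf.ae_hasDerivAt, hg.ae_hasDerivAt] with x hx hx' _
    rw [hx.deriv, hx'.deriv]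

/-- Integrability of the derivative produces a limit at infinity, and integrability of the function
itself forces this limit to vanish. -/
theorem tendsto_atTop (h : IsPrimitive f f') (hi : Integrable f) (hi' : Integrable f') :
    Tendsto f atTop (𝓝 0) := by
  have h1 : Tendsto f atTop (𝓝 (f 0 + ∫ t in Ioi 0, f' t)) := by
    rw [h.eq_add 0]
    simp only [intervalIntegral.integral_same, add_zero]
    exact tendsto_const_nhds.add
      (intervalIntegral_tendsto_integral_Ioi 0 hi'.integrableOn tendsto_id)
  have h2 := IntegrableAtFilter.eq_zero_of_tendsto (l := atTop) (μ := volume) ⟨univ, univ_mem, hi.integrableOn⟩ (by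
    intro s hs
    obtain ⟨b, hb⟩ := mem_atTop_sets.1 hs
    apply eq_top_mono (measure_mono (show Ici b ⊆ s from hb)) (by simp)) h1
  rwa [h2] at h1

theorem tendsto_atBot (h : IsPrimitive f f') (hi : Integrable f) (hi' : Integrable f') :
    Tendsto f atBot (𝓝 0) := by
  have h1 : Tendsto f atBot (𝓝 (f 0 - ∫ t in Iic 0, f' t)) := by
    have : f = fun x => f 0 - ∫ t in x..0, f' t := by
      funext x; linarith [h.2 x 0]
    rw [this]
    simp only [intervalIntegral.integral_same, sub_zero]
    exact tendsto_const_nhds.sub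
      (intervalIntegral_tendsto_integral_Iic 0 hi'.integrableOn tendsto_id)
  have h2 := IntegrableAtFilter.eq_zero_of_tendsto (l := atBot) (μ := volume) ⟨univ, univ_mem, hi.integrableOn⟩ (by
    intro s hs
    obtain ⟨b, hb⟩ := mem_atBot_sets.1 hs
    apply eq_top_mono (measure_mono (show Iic b ⊆ s from hb)) (by simp)) h1
  rwa [h2] at h1

theorem integral_eq_zero (h : IsPrimitive f f') (hi : Integrable f) (hi' : Integrable f') :
    ∫ x, f' x = 0 := by
  have h1 := intervalIntegral_tendsto_integral hi' tendsto_neg_atTop_atBot tendsto_id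
  have h2 : Tendsto (fun b => f b - f (-b)) atTop (𝓝 (0 - 0)) :=
    (h.tendsto_atTop hi hi').sub ((h.tendsto_atBot hi hi').comp tendsto_neg_atTop_atBot)
  refine tendsto_nhds_unique h1 ?_
  simpa [h.2] using h2

/-- The value is at most half of the total variation. -/
theorem abs_le_integral (h : IsPrimitive f f') (hi : Integrable f) (hi' : Integrable f') (x : ℝ) :
    |f x| ≤ ∫ t, |f' t| := by
  have h1 : Tendsto (fun b => |f x - f b|) atBot (𝓝 |f x - 0|) :=
    (tendsto_const_nhds.sub (h.tendsto_atBot hi hi')).abs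
  rw [sub_zero] at h1
  refine le_of_tendsto h1 ?_
  filter_upwards [eventually_le_atBot x] with b hb
  rw [h.2 b x]
  refine (intervalIntegral.abs_integral_le_integral_abs hb).trans ?_
  rw [intervalIntegral.integral_of_le hb]
  exact setIntegral_le_integral hi'.abs (ae_of_all _ fun t => abs_nonneg _)

end IsPrimitive

/-! ### Weak derivatives, primitives, and completeness of the Sobolev spaces -/

/-- Real `L²(ℝ)`. -/
abbrev L2R : Type := Lp ℝ 2 (volume : Measure ℝ)

theorem IsPrimitive.integral_mul_deriv {f f' φ φ' : ℝ → ℝ} (h : IsPrimitive f f')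
    (hφ : ∀ x, HasDerivAt φ (φ' x) x) (hφ' : Continuous φ') (hc : HasCompactSupport φ) :
    ∫ x, f x * φ' x = - ∫ x, f' x * φ x := by
  have hp := IsPrimitive.of_hasDerivAt hφ hφ'
  have hd : φ' = deriv φ := funext fun x => (hφ x).deriv.symm
  have hc' : HasCompactSupport φ' := hd ▸ hc.deriv
  have i1 : Integrable (fun x => f x * φ' x) :=
    (h.continuous.mul hφ').integrable_of_hasCompactSupport hc'.mul_left
  have i2 : Integrable (fun x => f' x * φ x) := by
    have := h.1.integrable_smul_left_of_hasCompactSupport hp.continuous hc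
    simpa [mul_comm] using this
  have i3 : Integrable (fun x => f x * φ x) :=
    (h.continuous.mul hp.continuous).integrable_of_hasCompactSupport hc.mul_left
  have := (h.mul hp).integral_eq_zero i3 (i2.add i1)
  rw [integral_add i2 i1] at this
  linarith

theorem Lp_locallyIntegrable (u : L2R) : LocallyIntegrable u volume :=
  (Lp.memLp u).locallyIntegrable (by norm_num)

theorem isWeakDeriv_of_isPrimitive {u v : L2R} {f : ℝ → ℝ} (hu : u =ᵐ[volume] f)
    (h : IsPrimitive f v) : IsWeakDeriv u v := by
  intro φ hφ hc
  rw [← h.integral_mul_deriv (fun x => (hφ.differentiable (by simp) x).hasDerivAt)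
    (hφ.continuous_deriv (by simp)) hc]
  exact integral_congr_ae (hu.mono fun x hx => by simp only [hx])

/-- The integral from the left of the support vanishes again on the right of it exactly because the
total mass is zero. -/
theorem exists_test_primitive {ψ : ℝ → ℝ} (hψ : ContDiff ℝ ∞ ψ) (hc : HasCompactSupport ψ)
    (h0 : ∫ x, ψ x = 0) :
    ∃ φ : ℝ → ℝ, ContDiff ℝ ∞ φ ∧ HasCompactSupport φ ∧ deriv φ = ψ := by
  obtain ⟨r, hr⟩ := hc.isCompact.isBounded.subset_closedBall 0
  obtain ⟨R, hrR⟩ := exists_gt r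
  have hz : ∀ x, x ∉ Ioo (-R) R → ψ x = 0 := fun x hx => by
    by_contra hne
    have := hr (subset_tsupport _ hne)
    rw [Real.closedBall_eq_Icc, zero_sub, zero_add] at this
    exact hx ⟨by linarith [this.1], by linarith [this.2]⟩
  have hd : ∀ x, HasDerivAt (fun x => ∫ t in (-R)..x, ψ t) (ψ x) x := fun x =>
    intervalIntegral.integral_hasDerivAt_right (hψ.continuous.intervalIntegrable _ _)
      (hψ.continuous.stronglyMeasurableAtFilter _ _) hψ.continuous.continuousAt
  have hde : deriv (fun x => ∫ t in (-R)..x, ψ t) = ψ := funext fun x => (hd x).deriv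
  refine ⟨fun x => ∫ t in (-R)..x, ψ t, ?_, ?_, hde⟩
  · rw [contDiff_infty_iff_deriv, hde]
    exact ⟨fun x => (hd x).differentiableAt, hψ⟩
  · refine HasCompactSupport.of_support_subset_isCompact (isCompact_Icc (a := -R) (b := R)) ?_
    intro x hx
    by_contra hxn
    apply hx
    simp only [mem_Icc, not_and_or, not_le] at hxn
    rcases hxn with hxn | hxn
    · refine intervalIntegral.integral_zero_ae (ae_of_all _ fun t ht => hz t fun h' => ?_)
      rw [uIoc_of_ge hxn.le] at ht
      linarith [h'.1, ht.2]
    · rw [← h0]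
      refine intervalIntegral.integral_eq_integral_of_support_subset fun t ht => ?_
      have := not_not.1 (mt (hz t) ht)
      exact ⟨this.1, by linarith [this.2]⟩

/-- The du Bois-Reymond argument: with w the integral of v, the function u - w annihilates all
derivatives of test functions, that is, all test functions of mean zero, so it is a constant. The
constant is its pairing with a bump of mass one. -/
theorem IsWeakDeriv.exists_primitive {u v : L2R} (h : IsWeakDeriv u v) :
    ∃ f, IsPrimitive f v ∧ u =ᵐ[volume] f := by
  have hv := Lp_locallyIntegrable v
  have hw : IsPrimitive (fun x => ∫ t in (0:ℝ)..x, v t) v := by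
    refine ⟨hv, fun a b => ?_⟩
    have hI : ∀ a b, IntervalIntegrable v volume a b := fun a b => intervalIntegrable_iff.mpr
      ((hv.integrableOn_isCompact isCompact_uIcc).mono_set uIoc_subset_uIcc)
    exact intervalIntegral.integral_interval_sub_left (hI _ _) (hI _ _)
  set w := fun x => ∫ t in (0:ℝ)..x, v t with hwdef
  have hl : LocallyIntegrable (fun x => u x - w x) volume :=
    (Lp_locallyIntegrable u).sub hw.continuous.locallyIntegrable
  have hint : ∀ φ : ℝ → ℝ, Continuous φ → HasCompactSupport φ →
      Integrable (fun x => (u x - w x) * φ x) := fun φ hφ hc => by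
    simpa [mul_comm] using hl.integrable_smul_left_of_hasCompactSupport hφ hc
  have key : ∀ φ : ℝ → ℝ, ContDiff ℝ ∞ φ → HasCompactSupport φ →
      ∫ x, (u x - w x) * deriv φ x = 0 := by
    intro φ hφ hc
    have h1 := h φ hφ hc
    have h2 := hw.integral_mul_deriv (fun x => (hφ.differentiable (by simp) x).hasDerivAt)
      (hφ.continuous_deriv (by simp)) hc
    have i1 := integrable_lp_mul_test u (hφ.continuous_deriv (by simp)) hc.deriv
    have i2 : Integrable (fun x => w x * deriv φ x) :=
      (hw.continuous.mul (hφ.continuous_deriv (by simp))).integrable_of_hasCompactSupport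
        hc.deriv.mul_left
    simp only [sub_mul]
    rw [integral_sub i1 i2, h1, h2, sub_self]
  let η : ContDiffBump (0:ℝ) := ⟨1, 2, by norm_num, by norm_num⟩
  set e := η.normed volume with he
  have e1 : ContDiff ℝ ∞ e := η.contDiff_normed
  have e2 : HasCompactSupport e := η.hasCompactSupport_normed
  have e3 : ∫ x, e x = 1 := η.integral_normed
  set c := ∫ x, (u x - w x) * e x with hcdef
  refine ⟨fun x => w x + c, ⟨hv, fun a b => by rw [← hw.2 a b]; ring⟩, ?_⟩
  have hl2 : LocallyIntegrable (fun x => u x - w x - c) volume :=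
    hl.sub continuous_const.locallyIntegrable
  have := ae_eq_zero_of_integral_contDiff_smul_eq_zero hl2 (fun ψ hψ hc => by
    have iψ : Integrable ψ := hψ.continuous.integrable_of_hasCompactSupport hc
    have ie : Integrable e := e1.continuous.integrable_of_hasCompactSupport e2
    -- Subtracting the multiple of the bump with the same mass makes an arbitrary test function the
    -- derivative of another one.
    obtain ⟨φ, f1, f2, f3⟩ := exists_test_primitive (ψ := fun x => ψ x - (∫ x, ψ x) * e x)
      (hψ.sub (contDiff_const.mul e1)) (hc.sub (e2.mul_left (f := fun _ => ∫ x, ψ x))) (by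
        rw [integral_sub iψ (ie.const_mul _), integral_const_mul, e3]; ring)
    have h3 := key φ f1 f2
    rw [f3] at h3
    have a1 := hint ψ hψ.continuous hc
    have a2 := hint e e1.continuous e2
    have : (fun x => (u x - w x) * (ψ x - (∫ x, ψ x) * e x))
        = fun x => (u x - w x) * ψ x - (∫ x, ψ x) * ((u x - w x) * e x) := by
      funext x; ring
    rw [this, integral_sub a1 (a2.const_mul _), integral_const_mul, ← hcdef] at h3
    have : (fun x => ψ x • (u x - w x - c)) = fun x => (u x - w x) * ψ x - c * ψ x := by
      funext x; simp only [smul_eq_mul]; ring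
    rw [this, integral_sub a1 (iψ.const_mul _), integral_const_mul]
    linarith)
  exact this.mono fun x hx => by simp only at hx ⊢; linarith

/-- Each weak derivative condition is an equality of L²-continuous pairings. Closedness gives
completeness, on which the ODE theory rests. -/
theorem sobolevSubmodule_isClosed (k : ℕ) :
    IsClosed (sobolevSubmodule k : Set (PiLp 2 (fun _ : Fin (k + 1) => L2R))) := by
  have hpair : ∀ φ : ℝ → ℝ, ContDiff ℝ ∞ φ → HasCompactSupport φ →
      Continuous (fun u : L2R => ∫ x, u x * φ x) := by
    intro φ hφ hc
    have hm : MemLp φ 2 volume := hφ.continuous.memLp_of_hasCompactSupport hc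
    have : (fun u : L2R => ∫ x, u x * φ x) = fun u : L2R => inner ℝ (hm.toLp φ) u := by
      funext u
      rw [L2.inner_def]
      refine integral_congr_ae (hm.coeFn_toLp.mono fun x hx => ?_)
      simp [hx]
    rw [this]
    exact continuous_const.inner continuous_id
  have : (sobolevSubmodule k : Set (PiLp 2 (fun _ : Fin (k + 1) => L2R))) =
      ⋂ i : Fin k, ⋂ φ : ℝ → ℝ, ⋂ (_ : ContDiff ℝ ∞ φ), ⋂ (_ : HasCompactSupport φ),
        {u | ∫ x, u i.castSucc x * deriv φ x = - ∫ x, u i.succ x * φ x} := by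
    ext u
    simp only [mem_iInter, mem_ofPred_eq]
    rfl
  rw [this]
  refine isClosed_iInter fun i => isClosed_iInter fun φ => isClosed_iInter fun hφ =>
    isClosed_iInter fun hc => isClosed_eq ?_ ?_
  · exact (hpair _ (contDiff_infty_iff_deriv.1 hφ).2 hc.deriv).comp (PiLp.continuous_apply 2 _ _)
  · exact ((hpair _ hφ hc).comp (PiLp.continuous_apply 2 _ _)).neg

instance (k : ℕ) : CompleteSpace (SobolevH k) :=
  (sobolevSubmodule_isClosed k).completeSpace_coe

/-! ### The Banach space H¹(ℝ): point evaluation and products -/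

/-- The Sobolev space `H¹(ℝ)`. -/
def H1R : Type := SobolevH 1

noncomputable instance : NormedAddCommGroup H1R := inferInstanceAs (NormedAddCommGroup (SobolevH 1))

noncomputable instance : NormedSpace ℝ H1R := inferInstanceAs (NormedSpace ℝ (SobolevH 1))

instance : CompleteSpace H1R := inferInstanceAs (CompleteSpace (SobolevH 1))

namespace H1R

/-- The inclusion `H¹ ⊂ L²`. -/
noncomputable def J : H1R →L[ℝ] L2R :=
  ((PiLp.proj 2 (fun _ : Fin 2 => L2R) 0).comp (sobolevSubmodule 1).subtypeL : SobolevH 1 →L[ℝ] L2R)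

/-- The derivative `H¹ → L²`. -/
noncomputable def D : H1R →L[ℝ] L2R :=
  ((PiLp.proj 2 (fun _ : Fin 2 => L2R) 1).comp (sobolevSubmodule 1).subtypeL : SobolevH 1 →L[ℝ] L2R)

theorem isWeakDeriv (u : H1R) : IsWeakDeriv (J u) (D u) :=
  Subtype.property (p := fun u => u ∈ sobolevSubmodule 1) u 0

theorem norm_sq (u : H1R) : ‖u‖ ^ 2 = ‖J u‖ ^ 2 + ‖D u‖ ^ 2 := by
  have : ‖u‖ = ‖Subtype.val (p := fun u => u ∈ sobolevSubmodule 1) u‖ := rfl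
  rw [this, PiLp.norm_sq_eq_of_L2, Fin.sum_univ_two]
  rfl

theorem norm_J_le (u : H1R) : ‖J u‖ ≤ ‖u‖ :=
  abs_le_of_sq_le_sq' (by nlinarith [norm_sq u, sq_nonneg ‖D u‖]) (norm_nonneg _) |>.2

theorem norm_D_le (u : H1R) : ‖D u‖ ≤ ‖u‖ :=
  abs_le_of_sq_le_sq' (by nlinarith [norm_sq u, sq_nonneg ‖J u‖]) (norm_nonneg _) |>.2

theorem norm_le (u : H1R) : ‖u‖ ≤ ‖J u‖ + ‖D u‖ :=
  abs_le_of_sq_le_sq' (by nlinarith [norm_sq u, mul_nonneg (norm_nonneg (J u)) (norm_nonneg (D u))])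
    (by positivity) |>.2

/-- The continuous representative. -/
noncomputable def rep (u : H1R) : ℝ → ℝ := (isWeakDeriv u).exists_primitive.choose

theorem isPrimitive (u : H1R) : IsPrimitive (rep u) (D u) :=
  (isWeakDeriv u).exists_primitive.choose_spec.1

theorem J_ae (u : H1R) : J u =ᵐ[volume] rep u :=
  (isWeakDeriv u).exists_primitive.choose_spec.2

@[fun_prop]
theorem continuous_rep (u : H1R) : Continuous (rep u) := (isPrimitive u).continuous

theorem rep_eq_of_ae {u : H1R} {f : ℝ → ℝ} (hf : Continuous f) (h : J u =ᵐ[volume] f) :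
    rep u = f :=
  (continuous_rep u).ae_eq_iff_eq volume hf |>.1 ((J_ae u).symm.trans h)

theorem J_injective : Function.Injective J := by
  intro u v h
  have h1 : rep u = rep v := rep_eq_of_ae (continuous_rep v) (h ▸ J_ae v)
  have h2 : D u = D v := by
    apply Lp.ext
    have hv := (isPrimitive v).ae_hasDerivAt
    rw [← h1] at hv
    filter_upwards [(isPrimitive u).ae_hasDerivAt, hv] with x a b
    exact a.unique b
  apply Subtype.ext
  ext i : 1
  fin_cases i
  exacts [h, h2]

theorem ext_rep {u v : H1R} (h : ∀ x, rep u x = rep v x) : u = v := by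
  apply J_injective
  apply Lp.ext
  filter_upwards [J_ae u, J_ae v] with x a b
  rw [a, b, h]

@[simp] theorem rep_add (u v : H1R) (x : ℝ) : rep (u + v) x = rep u x + rep v x := by
  refine congrFun (rep_eq_of_ae (f := fun x => rep u x + rep v x) (by fun_prop) ?_) x
  rw [map_add]
  filter_upwards [Lp.coeFn_add (J u) (J v), J_ae u, J_ae v] with x a b c
  rw [a, Pi.add_apply, b, c]

@[simp] theorem rep_smul (r : ℝ) (u : H1R) (x : ℝ) : rep (r • u) x = r * rep u x := by
  refine congrFun (rep_eq_of_ae (f := fun x => r * rep u x) (by fun_prop) ?_) x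
  rw [map_smul]
  filter_upwards [Lp.coeFn_smul r (J u), J_ae u] with x a b
  rw [a, Pi.smul_apply, b, smul_eq_mul]

@[simp] theorem rep_zero (x : ℝ) : rep 0 x = 0 := by
  simpa using rep_smul 0 0 x

@[simp] theorem rep_neg (u : H1R) (x : ℝ) : rep (-u) x = - rep u x := by
  simpa using rep_smul (-1) u x

@[simp] theorem rep_sub (u v : H1R) (x : ℝ) : rep (u - v) x = rep u x - rep v x := by
  rw [sub_eq_add_neg, rep_add, rep_neg, sub_eq_add_neg]

theorem memLp_rep (u : H1R) : MemLp (rep u) 2 volume :=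
  (memLp_congr_ae (J_ae u)).1 (Lp.memLp _)

theorem integrable_sq (u : L2R) : Integrable (fun x => u x ^ 2) :=
  (Lp.memLp u).integrable_sq

theorem integral_sq (u : L2R) : ∫ x, u x ^ 2 = ‖u‖ ^ 2 := by
  rw [← real_inner_self_eq_norm_sq, L2.inner_def]
  exact integral_congr_ae (ae_of_all _ fun x => by simp [sq])

theorem inner_eq (u v : L2R) : inner ℝ u v = ∫ x, u x * v x := by
  rw [L2.inner_def]
  exact integral_congr_ae (ae_of_all _ fun x => by simp [mul_comm])

theorem integrable_mul (u v : L2R) : Integrable (fun x => u x * v x) :=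
  (Lp.memLp u).integrable_mul (Lp.memLp v)

/-- An element of `H¹` from a square-integrable primitive of a square-integrable function. -/
noncomputable def mk (f f' : ℝ → ℝ) (h : IsPrimitive f f') (hf : MemLp f 2 volume)
    (hf' : MemLp f' 2 volume) : H1R :=
  Subtype.mk (p := fun u => u ∈ sobolevSubmodule 1) (WithLp.toLp 2 ![hf.toLp f, hf'.toLp f']) (fun i => by
    fin_cases i
    exact isWeakDeriv_of_isPrimitive hf.coeFn_toLp (h.congr_right hf'.coeFn_toLp.symm))

section mk
variable {f f' : ℝ → ℝ} (h : IsPrimitive f f') (hf : MemLp f 2 volume) (hf' : MemLp f' 2 volume)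

theorem J_mk : J (mk f f' h hf hf') = hf.toLp f := rfl

theorem D_mk : D (mk f f' h hf hf') = hf'.toLp f' := rfl

theorem rep_mk : rep (mk f f' h hf hf') = f :=
  rep_eq_of_ae h.continuous hf.coeFn_toLp

end mk

theorem integrable_rep_mul (u v : H1R) : Integrable (fun x => rep u x * rep v x) :=
  (memLp_rep u).integrable_mul (memLp_rep v)

theorem integrable_D_mul (u v : H1R) : Integrable (fun x => D u x * rep v x) :=
  (Lp.memLp (D u)).integrable_mul (memLp_rep v)

theorem integrable_mul_D (u v : H1R) : Integrable (fun x => rep u x * D v x) :=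
  (memLp_rep u).integrable_mul (Lp.memLp (D v))

theorem isPrimitive_mul (u v : H1R) :
    IsPrimitive (fun x => rep u x * rep v x) (fun x => D u x * rep v x + rep u x * D v x) :=
  (isPrimitive u).mul (isPrimitive v)

theorem inner_D_J (u v : H1R) : inner ℝ (D u) (J v) = - inner ℝ (J u) (D v) := by
  have := (isPrimitive_mul u v).integral_eq_zero (integrable_rep_mul u v)
    ((integrable_D_mul u v).add (integrable_mul_D u v))
  rw [integral_add (integrable_D_mul u v) (integrable_mul_D u v)] at this
  rw [inner_eq, inner_eq,
    integral_congr_ae (g := fun x => D u x * rep v x) ((J_ae v).mono fun x hx => by simp only [hx]),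
    integral_congr_ae (f := fun x => J u x * D v x) (g := fun x => rep u x * D v x)
      ((J_ae u).mono fun x hx => by simp only [hx])]
  linarith

theorem sq_rep_le (u : H1R) (x : ℝ) : rep u x ^ 2 ≤ ∫ t, |2 * rep u t * D u t| := by
  have := (isPrimitive_mul u u).abs_le_integral (integrable_rep_mul u u)
    ((integrable_D_mul u u).add (integrable_mul_D u u)) x
  calc rep u x ^ 2 ≤ |rep u x * rep u x| := by rw [← sq]; exact le_abs_self _
    _ ≤ _ := this
    _ = _ := by congr 1; ext t; congr 1; ring

theorem abs_rep_le (u : H1R) (x : ℝ) : |rep u x| ≤ ‖u‖ := by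
  refine abs_le_of_sq_le_sq ?_ (norm_nonneg _)
  have h1 : Integrable (fun t => rep u t ^ 2) := (memLp_rep u).integrable_sq
  have h2 : Integrable (fun t => D u t ^ 2) := (Lp.memLp (D u)).integrable_sq
  calc rep u x ^ 2 ≤ ∫ t, |2 * rep u t * D u t| := sq_rep_le u x
    _ ≤ ∫ t, (rep u t ^ 2 + D u t ^ 2) := by
        refine integral_mono_of_nonneg (ae_of_all _ fun t => abs_nonneg _) (h1.add h2)
          (ae_of_all _ fun t => ?_)
        rw [abs_le]
        constructor <;> nlinarith [sq_nonneg (rep u t + D u t), sq_nonneg (rep u t - D u t)]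
    _ = ‖u‖ ^ 2 := by
        rw [integral_add h1 h2, norm_sq, integral_sq, ← integral_sq (J u)]
        congr 1
        exact integral_congr_ae ((J_ae u).mono fun x hx => by simp only [hx])

/-- Evaluation at a point. -/
noncomputable def evalL (x : ℝ) : H1R →L[ℝ] ℝ :=
  LinearMap.mkContinuous
    { toFun := fun u => rep u x, map_add' := fun u v => rep_add u v x,
      map_smul' := fun r u => by simp } 1 (fun u => by simpa using abs_rep_le u x)

@[simp] theorem evalL_apply (x : ℝ) (u : H1R) : evalL x u = rep u x := rfl

theorem norm_le_of_ae {f g : L2R} {S : ℝ} (h : ∀ᵐ x, |f x| ≤ S * |g x|) : ‖f‖ ≤ S * ‖g‖ :=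
  Lp.norm_le_mul_norm_of_ae_le_mul h

theorem memLp_rep_mul (u : H1R) (f : L2R) : MemLp (fun x => rep u x * f x) 2 volume := by
  refine MemLp.of_le_mul (c := ‖u‖) (Lp.memLp f) ?_ (ae_of_all _ fun x => ?_)
  · exact (continuous_rep u).aestronglyMeasurable.mul (Lp.aestronglyMeasurable f)
  · rw [norm_mul]
    exact mul_le_mul_of_nonneg_right (abs_rep_le u x) (norm_nonneg _)

/-- Multiplication `H¹ × L² → L²`. -/
noncomputable def mulL : H1R →L[ℝ] L2R →L[ℝ] L2R :=
  LinearMap.mkContinuous₂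
    (LinearMap.mk₂ ℝ (fun u f => (memLp_rep_mul u f).toLp _)
      (fun u v f => by
        rw [← MemLp.toLp_add]
        exact MemLp.toLp_congr _ _ (ae_of_all _ fun x => by simp [add_mul]))
      (fun r u f => by
        rw [← MemLp.toLp_const_smul]
        exact MemLp.toLp_congr _ _ (ae_of_all _ fun x => by simp [mul_assoc]))
      (fun u f g => by
        rw [← MemLp.toLp_add]
        exact MemLp.toLp_congr _ _ ((Lp.coeFn_add f g).mono fun x hx => by
          change rep u x * (f + g : L2R) x = rep u x * f x + rep u x * g x
          rw [hx, Pi.add_apply, mul_add]))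
      (fun r u f => by
        rw [← MemLp.toLp_const_smul]
        exact MemLp.toLp_congr _ _ ((Lp.coeFn_smul r f).mono fun x hx => by
          simp [hx]; ring)))
    1 (fun u f => by
      rw [one_mul]
      refine norm_le_of_ae ?_
      refine (memLp_rep_mul u f).coeFn_toLp.mono fun x hx => ?_
      simp only [LinearMap.mk₂_apply, hx, abs_mul]
      exact mul_le_mul_of_nonneg_right (abs_rep_le u x) (abs_nonneg _))

theorem mulL_ae (u : H1R) (f : L2R) : mulL u f =ᵐ[volume] fun x => rep u x * f x :=
  (memLp_rep_mul u f).coeFn_toLp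

theorem norm_mulL_le {u : H1R} {S : ℝ} (hS : ∀ x, |rep u x| ≤ S) (f : L2R) :
    ‖mulL u f‖ ≤ S * ‖f‖ := by
  refine norm_le_of_ae ((mulL_ae u f).mono fun x hx => ?_)
  rw [hx, abs_mul]
  exact mul_le_mul_of_nonneg_right (hS x) (abs_nonneg _)

theorem memLp_mul (u v : H1R) : MemLp (fun x => rep u x * rep v x) 2 volume :=
  (memLp_congr_ae ((J_ae v).mono fun x hx => by simp only [hx])).1 (memLp_rep_mul u (J v))

theorem memLp_D_mul (u v : H1R) :
    MemLp (fun x => D u x * rep v x + rep u x * D v x) 2 volume :=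
  (by simpa only [mul_comm] using memLp_rep_mul v (D u) :
    MemLp (fun x => D u x * rep v x) 2 volume).add (memLp_rep_mul u (D v))

/-- The product of two elements of `H¹`. -/
noncomputable def mulFun (u v : H1R) : H1R :=
  mk _ _ (isPrimitive_mul u v) (memLp_mul u v) (memLp_D_mul u v)

theorem J_mulFun (u v : H1R) : J (mulFun u v) = mulL u (J v) := by
  apply Lp.ext
  filter_upwards [(memLp_mul u v).coeFn_toLp, mulL_ae u (J v), J_ae v] with x a b c
  rw [mulFun, J_mk, a, b, c]

theorem D_mulFun (u v : H1R) : D (mulFun u v) = mulL v (D u) + mulL u (D v) := by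
  apply Lp.ext
  filter_upwards [(memLp_D_mul u v).coeFn_toLp, mulL_ae u (D v), mulL_ae v (D u),
    Lp.coeFn_add (mulL v (D u)) (mulL u (D v))] with x a b c d
  rw [mulFun, D_mk, a, d, Pi.add_apply, b, c, mul_comm (D u x)]

theorem rep_mulFun (u v : H1R) (x : ℝ) : rep (mulFun u v) x = rep u x * rep v x :=
  congrFun (rep_mk _ _ _) x

/-- Each H¹ norm is multiplied only by a sup norm of the other factor. This is what later makes a
polynomial vector field grow linearly once sup norms are under control. -/
theorem norm_mulFun_le {u v : H1R} {S S' : ℝ} (hS : ∀ x, |rep u x| ≤ S)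
    (hS' : ∀ x, |rep v x| ≤ S') : ‖mulFun u v‖ ≤ 2 * S * ‖v‖ + S' * ‖u‖ := by
  have hS0 : 0 ≤ S := (abs_nonneg _).trans (hS 0)
  have hS0' : 0 ≤ S' := (abs_nonneg _).trans (hS' 0)
  refine (norm_le _).trans ?_
  rw [J_mulFun, D_mulFun]
  have h1 := norm_mulL_le hS (J v)
  have h2 := norm_mulL_le hS (D v)
  have h3 := norm_mulL_le hS' (D u)
  have h4 := norm_add_le (mulL v (D u)) (mulL u (D v))
  have h5 := mul_le_mul_of_nonneg_left (norm_J_le v) hS0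
  have h6 := mul_le_mul_of_nonneg_left (norm_D_le v) hS0
  have h7 := mul_le_mul_of_nonneg_left (norm_D_le u) hS0'
  linarith

/-- Multiplication `H¹ × H¹ → H¹`. -/
noncomputable def mul : H1R →L[ℝ] H1R →L[ℝ] H1R :=
  LinearMap.mkContinuous₂
    (LinearMap.mk₂ ℝ mulFun
      (fun u v w => ext_rep fun x => by simp only [rep_mulFun, rep_add]; ring)
      (fun r u w => ext_rep fun x => by simp only [rep_mulFun, rep_smul]; ring)
      (fun u v w => ext_rep fun x => by simp only [rep_mulFun, rep_add]; ring)
      (fun r u w => ext_rep fun x => by simp only [rep_mulFun, rep_smul]; ring))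
    3 (fun u v => by
      have := norm_mulFun_le (abs_rep_le u) (abs_rep_le v)
      simp only [LinearMap.mk₂_apply]
      linarith)

@[simp] theorem rep_mul (u v : H1R) (x : ℝ) : rep (mul u v) x = rep u x * rep v x :=
  rep_mulFun u v x

theorem J_mul (u v : H1R) : J (mul u v) = mulL u (J v) := J_mulFun u v

theorem D_mul (u v : H1R) : D (mul u v) = mulL v (D u) + mulL u (D v) := D_mulFun u v

theorem norm_mul_le {u v : H1R} {S S' : ℝ} (hS : ∀ x, |rep u x| ≤ S)
    (hS' : ∀ x, |rep v x| ≤ S') : ‖mul u v‖ ≤ 2 * S * ‖v‖ + S' * ‖u‖ := norm_mulFun_le hS hS'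

theorem mulL_mulL (u v : H1R) (f : L2R) : mulL u (mulL v f) = mulL (mul u v) f := by
  apply Lp.ext
  filter_upwards [mulL_ae u (mulL v f), mulL_ae v f, mulL_ae (mul u v) f] with x a b c
  rw [a, b, c, rep_mul, mul_assoc]

theorem inner_mulL (u : H1R) (f g : L2R) : inner ℝ (mulL u f) g = inner ℝ f (mulL u g) := by
  rw [inner_eq, inner_eq]
  refine integral_congr_ae ?_
  filter_upwards [mulL_ae u f, mulL_ae u g] with x a b
  rw [a, b]; ring

/-- An element of `H¹` from a weak derivative. -/
noncomputable def ofWeak {u v : L2R} (h : IsWeakDeriv u v) : H1R :=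
  Subtype.mk (p := fun u => u ∈ sobolevSubmodule 1) (WithLp.toLp 2 ![u, v])
    (fun i => by fin_cases i; exact h)

theorem J_ofWeak {u v : L2R} (h : IsWeakDeriv u v) : J (ofWeak h) = u := rfl

theorem D_ofWeak {u v : L2R} (h : IsWeakDeriv u v) : D (ofWeak h) = v := rfl

theorem mul_swap (u v : H1R) : mul u v = mul v u := ext_rep fun x => by simp; ring

theorem D_mul_of_D_eq {u v u' v' : H1R} (hu : D u = J u') (hv : D v = J v') :
    D (mul u v) = J (mul u' v + mul u v') := by
  rw [D_mul, hu, hv, map_add, ← J_mul, ← J_mul, mul_swap v u']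

attribute [irreducible] J D rep evalL mulL mulFun mul mk ofWeak

end H1R

/-! ### Autonomous ODEs in a Banach space: uniqueness, continuation, gluing -/

section ODE

variable {E : Type*} [NormedAddCommGroup E] [NormedSpace ℝ E]

/-- `X` solves `X' = f X` on `(-δ, τ)` for some `δ > 0`, stays in `Ω` and starts at `x₀`. -/
def IsODESolution (f : E → E) (Ω : Set E) (x₀ : E) (τ : ℝ) (X : ℝ → E) : Prop :=
  X 0 = x₀ ∧ ∃ δ > 0, ∀ t ∈ Ioo (-δ) τ, HasDerivAt X (f (X t)) t ∧ X t ∈ Ω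

variable {f : E → E} {Ω : Set E} {x₀ : E}

theorem ODE_eqOn_of_contDiffAt (hf : ∀ x ∈ Ω, ContDiffAt ℝ 1 f x) {a b t₀ : ℝ}
    (ht₀ : t₀ ∈ Ioo a b) {X Z : ℝ → E}
    (hX : ∀ t ∈ Ioo a b, HasDerivAt X (f (X t)) t ∧ X t ∈ Ω)
    (hZ : ∀ t ∈ Ioo a b, HasDerivAt Z (f (Z t)) t ∧ Z t ∈ Ω) (h : X t₀ = Z t₀) :
    EqOn X Z (Ioo a b) := by
  set s := {t | X t = Z t} ∩ Ioo a b with hs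
  suffices hsub : Ioo a b ⊆ s from fun t ht => mem_ofPred.1 ((subset_def ▸ hsub) t ht).1
  refine isPreconnected_Ioo.subset_of_closure_inter_subset (s := Ioo a b) (u := s) ?_
    ⟨t₀, ⟨ht₀, ⟨h, ht₀⟩⟩⟩ ?_
  · rw [isOpen_iff_mem_nhds]
    rintro t ⟨hte, ht⟩
    obtain ⟨K, U, hU, hK⟩ := (hf _ (hX t ht).2).exists_lipschitzOnWith
    have e1 : ∀ᶠ r in 𝓝 t, r ∈ Ioo a b := isOpen_Ioo.mem_nhds ht
    have e2 : ∀ᶠ r in 𝓝 t, X r ∈ U := (hX t ht).1.continuousAt.eventually hU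
    have e3 : ∀ᶠ r in 𝓝 t, Z r ∈ U := (hZ t ht).1.continuousAt.eventually
      (by rwa [← show X t = Z t from hte])
    have := ODE_solution_unique_of_eventually (v := fun _ => f) (s := fun _ => U) (K := K)
      (t₀ := t) (f := X) (g := Z) (Eventually.of_forall fun _ => hK)
      (by filter_upwards [e1, e2] with r h1 h2 using ⟨(hX r h1).1, h2⟩)
      (by filter_upwards [e1, e3] with r h1 h2 using ⟨(hZ r h1).1, h2⟩) hte
    filter_upwards [this, e1] with r h1 h2 using ⟨h1, h2⟩
  · rintro t ⟨htc, ht⟩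
    refine ⟨?_, ht⟩
    have hm : t ∈ closure s := htc
    obtain ⟨u, hu, hut⟩ := mem_closure_iff_seq_limit.1 hm
    have h1 : Tendsto (fun n => X (u n)) atTop (𝓝 (X t)) := (hX t ht).1.continuousAt.tendsto.comp hut
    have h2 : Tendsto (fun n => Z (u n)) atTop (𝓝 (Z t)) := (hZ t ht).1.continuousAt.tendsto.comp hut
    have h3 : (fun n => X (u n)) = fun n => Z (u n) := funext fun n => (hu n).1
    rw [h3] at h1
    exact tendsto_nhds_unique h1 h2

theorem IsODESolution.eqOn (hf : ∀ x ∈ Ω, ContDiffAt ℝ 1 f x) {τ τ' : ℝ} (hτ : 0 < τ) (hτ' : 0 < τ')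
    {X Z : ℝ → E} (hX : IsODESolution f Ω x₀ τ X) (hZ : IsODESolution f Ω x₀ τ' Z) :
    ∃ δ > 0, EqOn X Z (Ioo (-δ) (min τ τ')) := by
  obtain ⟨h0, δ, hδ, hX⟩ := hX
  obtain ⟨h0', δ', hδ', hZ⟩ := hZ
  refine ⟨min δ δ', lt_min hδ hδ', ODE_eqOn_of_contDiffAt hf (t₀ := 0) ?_ ?_ ?_ (h0.trans h0'.symm)⟩
  · exact ⟨by linarith [lt_min hδ hδ'], lt_min hτ hτ'⟩
  · exact fun t ht => hX t ⟨by linarith [ht.1, min_le_left δ δ'], ht.2.trans_le (min_le_left _ _)⟩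
  · exact fun t ht => hZ t ⟨by linarith [ht.1, min_le_right δ δ'], ht.2.trans_le (min_le_right _ _)⟩

variable [CompleteSpace E]

/-- The existence time is uniform over starting points near x, and over starting times because the
field is autonomous. A solution approaching x can therefore be restarted shortly before its end. -/
theorem ODE_exists_local (hΩ : IsOpen Ω) (hf : ∀ x ∈ Ω, ContDiffAt ℝ 1 f x) {x : E} (hx : x ∈ Ω) :
    ∃ r > (0:ℝ), ∃ ε > (0:ℝ), ∀ x' ∈ Metric.closedBall x r, ∀ t₀ : ℝ, ∃ α : ℝ → E, α t₀ = x' ∧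
      ∀ t ∈ Ioo (t₀ - ε) (t₀ + ε), HasDerivAt α (f (α t)) t ∧ α t ∈ Ω := by
  obtain ⟨ε, hε, a, r, L, K, hr, hpl⟩ := IsPicardLindelof.of_contDiffAt_one (hf x hx)
  obtain ⟨α, hα, hc⟩ := (hpl 0).exists_forall_mem_closedBall_eq_hasDerivWithinAt_continuousOn
  have hr' : (0:ℝ) < r := hr
  have hx0 : x ∈ Metric.closedBall x r := Metric.mem_closedBall_self hr'.le
  have hcat : ContinuousAt α (x, 0) := hc.continuousAt
    (prod_mem_nhds (Metric.closedBall_mem_nhds x hr') (Icc_mem_nhds (by linarith) (by linarith)))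
  have h0 : α (x, 0) = x := (hα x hx0).1
  have hev : ∀ᶠ p in 𝓝 (x, (0:ℝ)), α p ∈ Ω :=
    hcat.eventually (by rw [h0]; exact hΩ.mem_nhds hx)
  obtain ⟨η, hη, hball⟩ := Metric.eventually_nhds_iff_ball.1 hev
  refine ⟨min r (η / 2), lt_min hr' (by linarith), min ε (η / 2), lt_min hε (by linarith),
    fun x' hx' t₀ => ⟨fun t => α (x', t - t₀), ?_, fun t ht => ⟨?_, ?_⟩⟩⟩
  · have := (hα x' (Metric.closedBall_subset_closedBall (min_le_left _ _) hx')).1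
    simpa using this
  · have h1 := min_le_left ε (η / 2)
    have := ((hα x' (Metric.closedBall_subset_closedBall (min_le_left _ _) hx')).2 (t - t₀)
      ⟨by linarith [ht.1], by linarith [ht.2]⟩).hasDerivAt
      (Icc_mem_nhds (by linarith [ht.1]) (by linarith [ht.2]))
    exact this.comp_sub_const t t₀
  · have h1 := min_le_right ε (η / 2)
    apply hball
    rw [Metric.mem_ball, Prod.dist_eq, max_lt_iff]
    constructor
    · have := Metric.mem_closedBall.1 hx'
      linarith [min_le_right (r:ℝ) (η / 2)]
    · rw [Real.dist_eq, abs_lt]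
      constructor <;> linarith [ht.1, ht.2]

theorem IsODESolution.extend (hΩ : IsOpen Ω) (hf : ∀ x ∈ Ω, ContDiffAt ℝ 1 f x) {τ : ℝ} (hτ : 0 < τ)
    {X : ℝ → E} (hX : IsODESolution f Ω x₀ τ X) {x : E} (hx : x ∈ Ω)
    (hlim : Tendsto X (𝓝[<] τ) (𝓝 x)) :
    ∃ τ' > τ, ∃ Z, IsODESolution f Ω x₀ τ' Z := by
  obtain ⟨h0, δ, hδ, hX⟩ := hX
  obtain ⟨r, hr, ε, hε, hloc⟩ := ODE_exists_local hΩ hf hx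
  have e1 : ∀ᶠ t in 𝓝[<] τ, X t ∈ Metric.closedBall x r :=
    hlim (Metric.closedBall_mem_nhds x hr)
  have e2 : ∀ᶠ t in 𝓝[<] τ, t ∈ Ioo (max 0 (τ - ε)) τ :=
    Ioo_mem_nhdsLT (max_lt hτ (by linarith))
  -- The restart time s is within ε of τ and X s is within r of the limit, so the local solution
  -- from s survives past τ.
  obtain ⟨s, hs1, hs2, hs3⟩ := (e1.and e2).exists
  obtain ⟨hs0, hsε⟩ := max_lt_iff.1 hs2
  obtain ⟨α, hα0, hα⟩ := hloc _ hs1 s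
  have hagree : EqOn X α (Ioo (max (-δ) (s - ε)) τ) :=
    ODE_eqOn_of_contDiffAt hf (t₀ := s) ⟨max_lt (by linarith) (by linarith), hs3⟩
      (fun t ht => hX t ⟨(max_lt_iff.1 ht.1).1, ht.2⟩)
      (fun t ht => hα t ⟨(max_lt_iff.1 ht.1).2, by linarith [ht.2]⟩) hα0.symm
  set Z : ℝ → E := fun t => if t < s then X t else α t with hZ
  have z1 : ∀ t < τ, -δ < t → Z t = X t := by
    intro t ht ht'
    by_cases h : t < s
    · simp [hZ, h]
    · simp only [hZ, h, if_false]
      exact (hagree ⟨max_lt ht' (by linarith), ht⟩).symm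
  have z2 : ∀ t, s ≤ t → Z t = α t := fun t ht => by simp [hZ, not_lt.2 ht]
  refine ⟨s + ε, by linarith, Z, by rw [z1 0 hτ (by linarith), h0], δ, hδ, fun t ht => ?_⟩
  rcases lt_or_ge t τ with h | h
  · have he : Z =ᶠ[𝓝 t] X := by
      filter_upwards [Ioo_mem_nhds ht.1 h] with r hr using z1 r hr.2 hr.1
    rw [z1 t h ht.1]
    exact ⟨(hX t ⟨ht.1, h⟩).1.congr_of_eventuallyEq he, (hX t ⟨ht.1, h⟩).2⟩
  · have he : Z =ᶠ[𝓝 t] α := by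
      filter_upwards [Ioi_mem_nhds (hs3.trans_le h)] with r hr using z2 r (le_of_lt hr)
    rw [z2 t (by linarith)]
    have := hα t ⟨by linarith, ht.2⟩
    exact ⟨this.1.congr_of_eventuallyEq he, this.2⟩

/-- If every solution on a shorter interval has a limit in `Ω`, there is a solution up to `T`. -/
theorem exists_isODESolution (hΩ : IsOpen Ω) (hf : ∀ x ∈ Ω, ContDiffAt ℝ 1 f x) (hx₀ : x₀ ∈ Ω)
    {T : ℝ} (hT : 0 < T)
    (h : ∀ τ, 0 < τ → τ < T → ∀ X, IsODESolution f Ω x₀ τ X →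
      ∃ x ∈ Ω, Tendsto X (𝓝[<] τ) (𝓝 x)) : ∃ X, IsODESolution f Ω x₀ T X := by
  set S := {τ | 0 < τ ∧ τ ≤ T ∧ ∃ X, IsODESolution f Ω x₀ τ X} with hS
  have hne : S.Nonempty := by
    obtain ⟨r, hr, ε, hε, hloc⟩ := ODE_exists_local hΩ hf hx₀
    obtain ⟨α, h0, hα⟩ := hloc x₀ (Metric.mem_closedBall_self hr.le) 0
    refine ⟨min ε T, lt_min hε hT, min_le_right _ _, α, h0, ε, hε, fun t ht => hα t ?_⟩
    exact ⟨by linarith [ht.1], by linarith [ht.2, min_le_left ε T]⟩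
  have hbdd : BddAbove S := ⟨T, fun τ hτ => hτ.2.1⟩
  set τ := sSup S with hτdef
  have hτT : τ ≤ T := csSup_le hne fun τ hτ => hτ.2.1
  have hτ0 : 0 < τ := by
    obtain ⟨σ, hσ⟩ := hne
    exact hσ.1.trans_le (le_csSup hbdd hσ)
  have hmem : ∃ X, IsODESolution f Ω x₀ τ X := by
    by_cases hin : τ ∈ S
    · exact hin.2.2
    have hex : ∀ t < τ, ∃ σ ∈ S, t < σ := fun t ht => exists_lt_of_lt_csSup hne ht
    choose σ hσS hσ using hex
    have hsol : ∀ t (ht : t < τ), ∃ X, IsODESolution f Ω x₀ (σ t ht) X := fun t ht => (hσS t ht).2.2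
    choose Xs hXs using hsol
    obtain ⟨d0, δ, hδ, hd⟩ := hXs 0 hτ0
    have hagree : ∀ t (ht : t < τ), 0 ≤ t → ∀ t' (ht' : t' < τ) , 0 ≤ t' → ∀ r, 0 ≤ r →
        r < σ t ht → r < σ t' ht' → Xs t ht r = Xs t' ht' r := by
      intro t ht h0 t' ht' h0' r hr hr1 hr2
      obtain ⟨δ, hδ, he⟩ := (hXs t ht).eqOn hf (hσS t ht).1 (hσS t' ht').1 (hXs t' ht')
      exact he ⟨by linarith, lt_min hr1 hr2⟩
    -- For t > 0 the value is taken from a solution that lives beyond t. For t ≤ 0 one fixed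
    -- solution is used, so that a single δ serves on the left of 0.
    set X : ℝ → E := fun t => if t ≤ 0 then Xs 0 hτ0 t else
      if ht : t < τ then Xs t ht t else 0 with hXdef
    have x1 : ∀ t (ht : t < τ), 0 ≤ t → ∃ η > 0, ∀ r ∈ Ioo (-η) (σ t ht), X r = Xs t ht r := by
      intro t ht h0
      obtain ⟨η, hη, he⟩ := (hXs 0 hτ0).eqOn hf (hσS 0 hτ0).1 (hσS t ht).1 (hXs t ht)
      refine ⟨η, hη, fun r hr => ?_⟩
      by_cases h : r ≤ 0
      · simp only [hXdef, h, if_true]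
        exact he ⟨hr.1, lt_min (h.trans_lt (hσS 0 hτ0).1) hr.2⟩
      · have hrτ : r < τ := hr.2.trans_le (le_csSup hbdd (hσS t ht))
        simp only [hXdef, h, if_false, hrτ, dif_pos]
        exact hagree r hrτ (by linarith) t ht h0 r (by linarith) (hσ r hrτ) hr.2
    refine ⟨X, by simp [hXdef, d0], δ, hδ, fun t ht => ?_⟩
    rcases lt_or_ge t 0 with h | h
    · have he : X =ᶠ[𝓝 t] Xs 0 hτ0 := by
        filter_upwards [Iio_mem_nhds h] with r hr
        simp [hXdef, le_of_lt (mem_Iio.1 hr)]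
      have := hd t ⟨ht.1, h.trans (hσS 0 hτ0).1⟩
      rw [he.eq_of_nhds]
      exact ⟨this.1.congr_of_eventuallyEq he, this.2⟩
    · obtain ⟨η, hη, hx⟩ := x1 t ht.2 h
      have he : X =ᶠ[𝓝 t] Xs t ht.2 := by
        filter_upwards [Ioo_mem_nhds (show -η < t by linarith) (hσ t ht.2)] with r hr using hx r hr
      obtain ⟨_, δ', hδ', hd'⟩ := hXs t ht.2
      have := hd' t ⟨by linarith, hσ t ht.2⟩
      rw [he.eq_of_nhds]
      exact ⟨this.1.congr_of_eventuallyEq he, this.2⟩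
  rcases hτT.lt_or_eq with hlt | heq
  · obtain ⟨X, hX⟩ := hmem
    obtain ⟨x, hx, hlim⟩ := h τ hτ0 hlt X hX
    obtain ⟨τ', hτ', Z, hZ0, δ, hδ, hZ⟩ := hX.extend hΩ hf hτ0 hx hlim
    have : min τ' T ∈ S := ⟨lt_min (hτ0.trans hτ') hT, min_le_right _ _, Z, hZ0, δ, hδ,
      fun t ht => hZ t ⟨ht.1, ht.2.trans_le (min_le_left _ _)⟩⟩
    have := le_csSup hbdd this
    exact absurd (lt_min hτ' hlt) (not_lt.2 this)
  · rwa [heq] at hmem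

/-- A curve with bounded derivative on `[0, τ)` has a limit at `τ`. -/
theorem exists_tendsto_of_norm_deriv_le {X X' : ℝ → E} {τ C : ℝ} (hτ : 0 < τ)
    (h : ∀ t ∈ Ico 0 τ, HasDerivWithinAt X (X' t) (Ico 0 τ) t) (hC : ∀ t ∈ Ico 0 τ, ‖X' t‖ ≤ C) :
    ∃ x, Tendsto X (𝓝[<] τ) (𝓝 x) := by
  have hl : ∀ s ∈ Ico 0 τ, ∀ t ∈ Ico 0 τ, ‖X t - X s‖ ≤ C * ‖t - s‖ := fun s hs t ht =>
    (convex_Ico 0 τ).norm_image_sub_le_of_norm_hasDerivWithin_le h hC hs ht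
  have hC0 : 0 ≤ C := (norm_nonneg _).trans (hC 0 ⟨le_rfl, hτ⟩)
  have hlip : LipschitzOnWith C.toNNReal X (Ico 0 τ) := by
    refine LipschitzOnWith.of_dist_le_mul fun t ht s hs => ?_
    rw [Real.coe_toNNReal C hC0, dist_eq_norm, dist_eq_norm]
    exact hl s hs t ht
  have hcau : Cauchy (map X (𝓝[<] τ)) := by
    have : Cauchy (𝓝[Ico 0 τ] τ) := by
      rw [nhdsWithin_Ico_eq_nhdsLT hτ]
      exact (cauchy_nhds.mono nhdsWithin_le_nhds)
    have := this.map_of_le hlip.uniformContinuousOn inf_le_right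
    rwa [nhdsWithin_Ico_eq_nhdsLT hτ] at this
  exact CompleteSpace.complete hcau

end ODE

/-! ### Inverting the first order operators σ∂ + (1 + ρ)/l -/

namespace H1R

/-- The first order operator `u ↦ σ u' + (1 + ρ) u / l`. -/
noncomputable def firstOrder (σ l : ℝ) (ρ : H1R) : H1R →L[ℝ] L2R :=
  σ • D + l⁻¹ • (J + J.comp (mul ρ))

theorem firstOrder_apply (σ l : ℝ) (ρ u : H1R) :
    firstOrder σ l ρ u = σ • D u + l⁻¹ • (J u + mulL ρ (J u)) := by
  simp [firstOrder, J_mul]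

theorem contDiff_firstOrder (σ l : ℝ) : ContDiff ℝ 1 (firstOrder σ l) := by
  have : firstOrder σ l = fun ρ => σ • D + l⁻¹ • (J + (ContinuousLinearMap.compL ℝ H1R H1R L2R J) (mul ρ)) := by
    funext ρ; rfl
  rw [this]
  fun_prop

theorem inner_self_D (u : H1R) : inner ℝ (D u) (J u) = 0 := by
  have := inner_D_J u u
  rw [real_inner_comm (D u) (J u)] at this
  linarith

theorem integral_weight (ρ : H1R) (f g : L2R) :
    inner ℝ (f + mulL ρ f) g = ∫ x, (1 + rep ρ x) * (f x * g x) := by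
  rw [inner_eq]
  refine integral_congr_ae ?_
  filter_upwards [Lp.coeFn_add f (mulL ρ f), mulL_ae ρ f] with x a b
  rw [a, Pi.add_apply, b]; ring

theorem integrable_weight (ρ : H1R) (f g : L2R) :
    Integrable (fun x => (1 + rep ρ x) * (f x * g x)) := by
  refine (integrable_mul (f + mulL ρ f) g).congr ?_
  filter_upwards [Lp.coeFn_add f (mulL ρ f), mulL_ae ρ f] with x a b
  rw [a, Pi.add_apply, b]; ring

theorem coercive {ρ : H1R} {c : ℝ} (hc : ∀ x, c ≤ 1 + rep ρ x) (f : L2R) :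
    c * ‖f‖ ^ 2 ≤ inner ℝ (f + mulL ρ f) f := by
  rw [integral_weight, ← integral_sq, ← integral_const_mul]
  refine integral_mono ((integrable_sq f).const_mul c) (integrable_weight ρ f f) fun x => ?_
  have := mul_le_mul_of_nonneg_right (hc x) (sq_nonneg (f x))
  simp only
  linarith

variable {σ l c : ℝ} {ρ : H1R}

/-- Pairing with u kills the derivative term by skew-symmetry, and the positive weight gives
coercivity. -/
theorem norm_J_le_firstOrder (hl : 0 < l) (hc0 : 0 < c) (hc : ∀ x, c ≤ 1 + rep ρ x) (u : H1R) :
    ‖J u‖ ≤ l / c * ‖firstOrder σ l ρ u‖ := by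
  have h1 : c / l * ‖J u‖ ^ 2 ≤ inner ℝ (firstOrder σ l ρ u) (J u) := by
    rw [firstOrder_apply, inner_add_left, real_inner_smul_left, real_inner_smul_left, inner_self_D]
    have := mul_le_mul_of_nonneg_left (coercive hc (J u)) (inv_pos.2 hl).le
    calc c / l * ‖J u‖ ^ 2 = l⁻¹ * (c * ‖J u‖ ^ 2) := by ring
      _ ≤ _ := by linarith
  have h2 := real_inner_le_norm (firstOrder σ l ρ u) (J u)
  by_cases h0 : ‖J u‖ = 0
  · rw [h0]; positivity
  have h3 : 0 < ‖J u‖ := lt_of_le_of_ne (norm_nonneg _) (Ne.symm h0)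
  have h4 : c / l * ‖J u‖ ≤ ‖firstOrder σ l ρ u‖ := by
    refine le_of_mul_le_mul_right ?_ h3
    calc _ = c / l * ‖J u‖ ^ 2 := by ring
      _ ≤ _ := h1.trans h2
  calc ‖J u‖ = l / c * (c / l * ‖J u‖) := by field_simp
    _ ≤ _ := by gcongr

theorem norm_D_le_firstOrder (hσ : σ ^ 2 = 1) (hl : 0 < l) (hc0 : 0 < c)
    (hc : ∀ x, c ≤ 1 + rep ρ x) {c' : ℝ} (hc' : ∀ x, 1 + rep ρ x ≤ c') (u : H1R) :
    ‖D u‖ ≤ (1 + c' / c) * ‖firstOrder σ l ρ u‖ := by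
  have hσ' : |σ| = 1 := by
    have := sq_abs σ
    rw [hσ] at this
    nlinarith [abs_nonneg σ, sq_nonneg (|σ| - 1)]
  have hc'0 : 0 < c' := hc0.trans_le ((hc 0).trans (hc' 0))
  have h1 : σ • D u = firstOrder σ l ρ u - l⁻¹ • (J u + mulL ρ (J u)) := by
    rw [firstOrder_apply]; abel
  have h2 : ‖J u + mulL ρ (J u)‖ ≤ c' * ‖J u‖ := by
    refine norm_le_of_ae ?_
    filter_upwards [Lp.coeFn_add (J u) (mulL ρ (J u)), mulL_ae ρ (J u)] with x a b
    rw [a, Pi.add_apply, b, ← one_add_mul, abs_mul]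
    refine mul_le_mul_of_nonneg_right ?_ (abs_nonneg _)
    rw [abs_of_pos (hc0.trans_le (hc x))]
    exact hc' x
  have h3 : ‖D u‖ = ‖σ • D u‖ := by rw [norm_smul, Real.norm_eq_abs, hσ', one_mul]
  rw [h3, h1]
  refine (norm_sub_le _ _).trans ?_
  rw [norm_smul, norm_inv, Real.norm_eq_abs, abs_of_pos hl, one_add_mul]
  refine add_le_add le_rfl ?_
  calc l⁻¹ * ‖J u + mulL ρ (J u)‖ ≤ l⁻¹ * (c' * (l / c * ‖firstOrder σ l ρ u‖)) := by
        gcongr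
        exact h2.trans (by gcongr; exact norm_J_le_firstOrder hl hc0 hc u)
    _ = _ := by field_simp

theorem norm_le_firstOrder (hσ : σ ^ 2 = 1) (hl : 0 < l) (hc0 : 0 < c)
    (hc : ∀ x, c ≤ 1 + rep ρ x) {c' : ℝ} (hc' : ∀ x, 1 + rep ρ x ≤ c') (u : H1R) :
    ‖u‖ ≤ (l / c + (1 + c' / c)) * ‖firstOrder σ l ρ u‖ := by
  have h1 := norm_J_le_firstOrder (σ := σ) hl hc0 hc u
  have h2 := norm_D_le_firstOrder hσ hl hc0 hc hc' u
  linarith [norm_le u]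

/-- A smooth compactly supported function as an element of `H¹`. -/
theorem exists_test (φ : ℝ → ℝ) (hφ : ContDiff ℝ ∞ φ) (hc : HasCompactSupport φ) :
    ∃ u : H1R, rep u = φ ∧ J u =ᵐ[volume] φ ∧ D u =ᵐ[volume] deriv φ := by
  have hd : Continuous (deriv φ) := hφ.continuous_deriv (by simp)
  have h1 : MemLp φ 2 volume := hφ.continuous.memLp_of_hasCompactSupport hc
  have h2 : MemLp (deriv φ) 2 volume := hd.memLp_of_hasCompactSupport hc.deriv
  exact ⟨mk φ (deriv φ) (IsPrimitive.of_hasDerivAt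
    (fun x => (hφ.differentiable (by simp) x).hasDerivAt) hd) h1 h2, rep_mk _ _ _,
    by rw [J_mk]; exact h1.coeFn_toLp, by rw [D_mk]; exact h2.coeFn_toLp⟩

/-- A vector orthogonal to the range solves the adjoint equation h' = σ(1 + ρ)h/l weakly. So h lies
in H¹, and pairing h' with h gives zero on one side and a coercive form on the other. -/
theorem firstOrder_orthogonal (hσ : σ ^ 2 = 1) (hl : 0 < l) (hc0 : 0 < c)
    (hc : ∀ x, c ≤ 1 + rep ρ x) {h : L2R} (hh : ∀ u, inner ℝ (firstOrder σ l ρ u) h = 0) : h = 0 := by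
  have hw : IsWeakDeriv h ((σ * l⁻¹) • (h + mulL ρ h)) := by
    intro φ hφ hcs
    obtain ⟨u, -, hJ, hD⟩ := exists_test φ hφ hcs
    have h1 := hh u
    rw [firstOrder_apply, inner_add_left, real_inner_smul_left, real_inner_smul_left,
      inner_add_left, inner_mulL, ← inner_add_right] at h1
    have h2 : ∫ x, h x * deriv φ x = inner ℝ (D u) h := by
      rw [inner_eq]
      exact integral_congr_ae (hD.mono fun x hx => by simp only [hx, mul_comm])
    have h3 : ∫ x, ((σ * l⁻¹) • (h + mulL ρ h)) x * φ x
        = (σ * l⁻¹) * inner ℝ (J u) (h + mulL ρ h) := by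
      rw [← real_inner_smul_right, inner_eq]
      exact integral_congr_ae (hJ.mono fun x hx => by simp only [hx, mul_comm])
    rw [h2, h3]
    linear_combination σ * h1 - inner ℝ (D u) h * hσ
  have h1 := inner_self_D (ofWeak hw)
  rw [D_ofWeak, J_ofWeak, real_inner_smul_left] at h1
  have hne : σ * l⁻¹ ≠ 0 := by
    have : σ ≠ 0 := by rintro rfl; norm_num at hσ
    exact mul_ne_zero this (inv_ne_zero hl.ne')
  have h2 := (mul_eq_zero.1 h1).resolve_left hne
  have h3 := coercive hc h
  rw [h2] at h3
  have : ‖h‖ ^ 2 ≤ 0 := nonpos_of_mul_nonpos_right h3 hc0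
  have : ‖h‖ = 0 := by nlinarith [norm_nonneg h]
  exact norm_eq_zero.1 this

/-- The a priori estimate gives injectivity and a closed range; triviality of its orthogonal
complement makes the operator onto. -/
theorem firstOrder_equiv (hσ : σ ^ 2 = 1) (hl : 0 < l) (hc0 : 0 < c)
    (hc : ∀ x, c ≤ 1 + rep ρ x) : ∃ e : H1R ≃L[ℝ] L2R, (e : H1R →L[ℝ] L2R) = firstOrder σ l ρ := by
  have hc' : ∀ x, 1 + rep ρ x ≤ 1 + ‖ρ‖ := fun x => by linarith [(abs_le.1 (abs_rep_le ρ x)).2]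
  have hK := norm_le_firstOrder hσ hl hc0 hc hc'
  have hanti : AntilipschitzWith (l / c + (1 + (1 + ‖ρ‖) / c)).toNNReal (firstOrder σ l ρ) := by
    refine AddMonoidHomClass.antilipschitz_of_bound (firstOrder σ l ρ) fun u => ?_
    rw [Real.coe_toNNReal _ (by positivity)]
    exact hK u
  have hcl : IsClosed (LinearMap.range (firstOrder σ l ρ : H1R →ₗ[ℝ] L2R) : Set L2R) :=
    hanti.isClosed_range (firstOrder σ l ρ).uniformContinuous
  have hker : LinearMap.ker (firstOrder σ l ρ : H1R →ₗ[ℝ] L2R) = ⊥ :=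
    LinearMap.ker_eq_bot.2 hanti.injective
  have hran : LinearMap.range (firstOrder σ l ρ : H1R →ₗ[ℝ] L2R) = ⊤ := by
    have : CompleteSpace (LinearMap.range (firstOrder σ l ρ : H1R →ₗ[ℝ] L2R)) := hcl.completeSpace_coe
    rw [← Submodule.orthogonal_eq_bot_iff, Submodule.eq_bot_iff]
    intro h hh
    refine firstOrder_orthogonal hσ hl hc0 hc fun u => ?_
    exact (Submodule.mem_orthogonal _ _).1 hh _ ⟨u, rfl⟩
  exact ⟨ContinuousLinearEquiv.ofBijective (firstOrder σ l ρ) hker hran, rfl⟩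

/-- The solution `u` of `σ u' + (1 + ρ) u / l = f`. -/
noncomputable def solve (σ l : ℝ) (ρ : H1R) : L2R →L[ℝ] H1R := (firstOrder σ l ρ).inverse

theorem firstOrder_solve (hσ : σ ^ 2 = 1) (hl : 0 < l) (hc0 : 0 < c)
    (hc : ∀ x, c ≤ 1 + rep ρ x) (f : L2R) : firstOrder σ l ρ (solve σ l ρ f) = f := by
  obtain ⟨e, he⟩ := firstOrder_equiv hσ hl hc0 hc
  rw [solve, ← he, ContinuousLinearMap.inverse_equiv]
  exact e.apply_symm_apply f

/-- The operator is affine in ρ and inversion is smooth at invertible operators, so the nonlocal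
terms depend on the flow Jacobian in a C¹ way. -/
theorem contDiffAt_solve (hσ : σ ^ 2 = 1) (hl : 0 < l) (hc0 : 0 < c)
    (hc : ∀ x, c ≤ 1 + rep ρ x) : ContDiffAt ℝ 1 (solve σ l) ρ := by
  obtain ⟨e, he⟩ := firstOrder_equiv hσ hl hc0 hc
  have := contDiffAt_map_inverse (𝕜 := ℝ) (n := 1) e
  rw [he] at this
  exact this.comp ρ (contDiff_firstOrder σ l).contDiffAt

attribute [irreducible] firstOrder solve

end H1R

/-! ### The Lagrangian system and its vector field -/

/-- The coefficients of the transport form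
`ζ_t = (1 + aζ) ζ_x - (1 - l²∂²)⁻¹ ∂ₓ (2ζ + b₂ζ² + b₃ζ³ + b₄ζ⁴ - (a l²/2) ζ_x²)`. -/
structure TransportCoeff where
  a : ℝ
  l : ℝ
  b₂ : ℝ
  b₃ : ℝ
  b₄ : ℝ
  a_pos : 0 < a
  l_pos : 0 < l

/-- The states `(y - id + t, y_ξ - 1, ζ ∘ y, ζ_x ∘ y, ζ_xx ∘ y)` of the Lagrangian system. -/
abbrev LState : Type := H1R × H1R × H1R × H1R × H1R

namespace LState

/-- The displacement. -/
abbrev Y (X : LState) : H1R := X.1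
/-- The Jacobian of the flow minus one. -/
abbrev ρ (X : LState) : H1R := X.2.1
/-- The Lagrangian elevation. -/
abbrev z (X : LState) : H1R := X.2.2.1
/-- The Lagrangian slope. -/
abbrev v (X : LState) : H1R := X.2.2.2.1
/-- The Lagrangian second derivative. -/
abbrev w (X : LState) : H1R := X.2.2.2.2

section projections
variable (Y ρ z v w : H1R)
@[simp] theorem Y_mk : LState.Y (Y, ρ, z, v, w) = Y := rfl
@[simp] theorem ρ_mk : LState.ρ (Y, ρ, z, v, w) = ρ := rfl
@[simp] theorem z_mk : LState.z (Y, ρ, z, v, w) = z := rfl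
@[simp] theorem v_mk : LState.v (Y, ρ, z, v, w) = v := rfl
@[simp] theorem w_mk : LState.w (Y, ρ, z, v, w) = w := rfl
end projections

/-- The states whose flow Jacobian is bounded below by a positive constant. -/
def Omega : Set LState := {X | ∃ c > 0, ∀ x, c ≤ 1 + X.ρ.rep x}

theorem isOpen_Omega : IsOpen Omega := by
  rw [Metric.isOpen_iff]
  rintro X ⟨c, hc, h⟩
  refine ⟨c / 2, by linarith, fun X' hX' => ⟨c / 2, by linarith, fun x => ?_⟩⟩
  have h1 : ‖X'.ρ - X.ρ‖ ≤ ‖X' - X‖ := (norm_fst_le (X' - X).2).trans (norm_snd_le (X' - X))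
  have h2 := H1R.abs_rep_le (X'.ρ - X.ρ) x
  rw [H1R.rep_sub] at h2
  rw [Metric.mem_ball, dist_eq_norm] at hX'
  have := (abs_le.1 h2).1
  linarith [h x]

end LState

namespace TransportCoeff

open H1R LState

variable (p : TransportCoeff)

/-- `κ = l²`. -/
noncomputable def κ : ℝ := p.l ^ 2

theorem κ_pos : 0 < p.κ := pow_pos p.l_pos 2

/-- The polynomial `g(z) = 2z + b₂z² + b₃z³ + b₄z⁴`. -/
noncomputable def g (z : H1R) : H1R :=
  (2:ℝ) • z + p.b₂ • mul z z + p.b₃ • mul z (mul z z) + p.b₄ • mul z (mul z (mul z z))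

/-- `g'(z) v`. -/
noncomputable def g' (z v : H1R) : H1R :=
  (2:ℝ) • v + (2 * p.b₂) • mul z v + (3 * p.b₃) • mul z (mul z v)
    + (4 * p.b₄) • mul z (mul z (mul z v))

/-- The nonlocal density `q (g(z) - (aκ/2) v²)`. -/
noncomputable def f (X : LState) : H1R :=
  p.g X.z - (p.a * p.κ / 2) • mul X.v X.v + mul X.ρ (p.g X.z - (p.a * p.κ / 2) • mul X.v X.v)

/-- The nonlocal pressure `(1 - κ∂²)⁻¹ G` in Lagrangian variables. -/
noncomputable def R (X : LState) : H1R :=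
  (2 * p.l)⁻¹ • (solve 1 p.l X.ρ (J (p.f X)) + solve (-1) p.l X.ρ (J (p.f X)))

/-- The derivative of the nonlocal pressure in Lagrangian variables. -/
noncomputable def P (X : LState) : H1R :=
  (2 * p.κ)⁻¹ • (solve (-1) p.l X.ρ (J (p.f X)) - solve 1 p.l X.ρ (J (p.f X)))

/-- The Lagrangian vector field. -/
noncomputable def field (X : LState) : LState :=
  (-p.a • X.z,
   -p.a • (X.v + mul X.ρ X.v),
   -p.P X,
   (p.a / 2) • mul X.v X.v + p.κ⁻¹ • (p.g X.z - p.R X),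
   (2 * p.a) • mul X.v X.w + p.κ⁻¹ • (p.g' X.z X.v - p.P X))

theorem rep_g (z : H1R) (x : ℝ) : rep (p.g z) x = 2 * rep z x + p.b₂ * rep z x ^ 2
    + p.b₃ * rep z x ^ 3 + p.b₄ * rep z x ^ 4 := by
  simp [g]; ring

theorem rep_g' (z v : H1R) (x : ℝ) : rep (p.g' z v) x = (2 + 2 * p.b₂ * rep z x
    + 3 * p.b₃ * rep z x ^ 2 + 4 * p.b₄ * rep z x ^ 3) * rep v x := by
  simp [g']; ring

theorem rep_f (X : LState) (x : ℝ) : rep (p.f X) x =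
    (1 + rep X.ρ x) * (rep (p.g X.z) x - p.a * p.κ / 2 * rep X.v x ^ 2) := by
  simp [f]; ring

theorem D_g {z u : H1R} (h : D z = J u) : D (p.g z) = J (p.g' z u) := by
  have h2 := D_mul_of_D_eq h h
  have h3 := D_mul_of_D_eq h h2
  have h4 := D_mul_of_D_eq h h3
  simp only [g, map_add, map_smul, h, h2, h3, h4]
  simp only [← map_smul, ← map_add]
  congr 1
  exact ext_rep fun x => by simp [rep_g']; ring

section field
variable (X : LState)
@[simp] theorem field_Y : (p.field X).Y = -p.a • X.z := rfl
@[simp] theorem field_ρ : (p.field X).ρ = -p.a • (X.v + mul X.ρ X.v) := rfl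
@[simp] theorem field_z : (p.field X).z = -p.P X := rfl
@[simp] theorem field_v : (p.field X).v =
    (p.a / 2) • mul X.v X.v + p.κ⁻¹ • (p.g X.z - p.R X) := rfl
@[simp] theorem field_w : (p.field X).w =
    (2 * p.a) • mul X.v X.w + p.κ⁻¹ • (p.g' X.z X.v - p.P X) := rfl
end field

theorem contDiff_g : ContDiff ℝ 1 p.g := by
  unfold g; fun_prop

theorem contDiff_f : ContDiff ℝ 1 p.f := by
  have := p.contDiff_g
  unfold f; fun_prop

theorem contDiffAt_solve_f {σ : ℝ} (hσ : σ ^ 2 = 1) {X : LState} (hX : X ∈ Omega) :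
    ContDiffAt ℝ 1 (fun X : LState => solve σ p.l X.ρ (J (p.f X))) X := by
  obtain ⟨c, hc0, hc⟩ := hX
  have h1 : ContDiffAt ℝ 1 (fun X : LState => solve σ p.l X.ρ) X :=
    (contDiffAt_solve hσ p.l_pos hc0 hc).comp X (by fun_prop)
  have h2 := p.contDiff_f.contDiffAt (x := X)
  have h3 : ContDiffAt ℝ 1 (fun X : LState => J (p.f X)) X := by fun_prop
  exact h1.clm_apply h3

theorem contDiffAt_R {X : LState} (hX : X ∈ Omega) : ContDiffAt ℝ 1 p.R X :=
  ((p.contDiffAt_solve_f (by norm_num) hX).add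
    (p.contDiffAt_solve_f (by norm_num) hX)).const_smul _

theorem contDiffAt_P {X : LState} (hX : X ∈ Omega) : ContDiffAt ℝ 1 p.P X :=
  ((p.contDiffAt_solve_f (by norm_num) hX).sub
    (p.contDiffAt_solve_f (by norm_num) hX)).const_smul _

/-- Along characteristics the transport term disappears and the remaining nonlocal terms map back to
H¹, so the equation becomes an ODE without loss of derivatives. -/
theorem contDiffAt_field {X : LState} (hX : X ∈ Omega) : ContDiffAt ℝ 1 p.field X := by
  have h1 := p.contDiffAt_R hX
  have h2 := p.contDiffAt_P hX
  have h3 := p.contDiff_g.contDiffAt (x := X.z)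
  have h4 : ContDiffAt ℝ 1 (fun X : LState => p.g X.z) X := p.contDiff_g.contDiffAt.comp X (by fun_prop)
  unfold field g'
  refine ContDiffAt.prodMk (by fun_prop) (ContDiffAt.prodMk (by fun_prop)
    (ContDiffAt.prodMk h2.neg (ContDiffAt.prodMk ?_ ?_)))
  · exact ContDiffAt.add (by fun_prop) ((h4.sub h1).const_smul _)
  · exact ContDiffAt.add (by fun_prop) (ContDiffAt.const_smul _ (ContDiffAt.sub (by fun_prop) h2))

variable {p} {X : LState}

theorem D_solve_one (hX : X ∈ Omega) (f : L2R) : D (solve 1 p.l X.ρ f) =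
    f - p.l⁻¹ • (J (solve 1 p.l X.ρ f) + mulL X.ρ (J (solve 1 p.l X.ρ f))) := by
  obtain ⟨c, hc0, hc⟩ := hX
  have := firstOrder_solve (σ := 1) (by norm_num) p.l_pos hc0 hc f
  rw [firstOrder_apply, one_smul] at this
  exact eq_sub_of_add_eq this

theorem D_solve_neg_one (hX : X ∈ Omega) (f : L2R) : D (solve (-1) p.l X.ρ f) =
    p.l⁻¹ • (J (solve (-1) p.l X.ρ f) + mulL X.ρ (J (solve (-1) p.l X.ρ f))) - f := by
  obtain ⟨c, hc0, hc⟩ := hX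
  have := firstOrder_solve (σ := -1) (by norm_num) p.l_pos hc0 hc f
  rw [firstOrder_apply, neg_one_smul] at this
  nth_rw 4 [← this]
  abel

/-- From 1/(1 - l²∂²) = ½(1/(1 + l∂) + 1/(1 - l∂)), with ∂ₓ = q⁻¹∂_ξ and q = 1 + ρ: this relation
reads P = ∂ₓR, and its companion for `P` reads R - κ∂ₓP = G, both multiplied by q. -/
theorem D_R (hX : X ∈ Omega) : D (p.R X) = J (p.P X) + mulL X.ρ (J (p.P X)) := by
  have hl := p.l_pos.ne'
  simp only [R, P, map_smul, map_add, map_sub, D_solve_one hX, D_solve_neg_one hX, κ]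
  set A := J (solve 1 p.l X.ρ (J (p.f X)))
  set B := J (solve (-1) p.l X.ρ (J (p.f X)))
  match_scalars <;> field_simp <;> norm_num

theorem D_P (hX : X ∈ Omega) :
    D (p.P X) = p.κ⁻¹ • (J (p.R X) + mulL X.ρ (J (p.R X)) - J (p.f X)) := by
  have hl := p.l_pos.ne'
  simp only [R, P, map_smul, map_add, map_sub, D_solve_one hX, D_solve_neg_one hX, κ]
  set A := J (solve 1 p.l X.ρ (J (p.f X)))
  set B := J (solve (-1) p.l X.ρ (J (p.f X)))
  match_scalars <;> field_simp <;> norm_num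

theorem g_eq (z : H1R) : p.g z = (2:ℝ) • z + p.b₂ • mul z z + p.b₃ • mul z (mul z z)
    + p.b₄ • mul z (mul z (mul z z)) := rfl

theorem g'_eq (z v : H1R) : p.g' z v = (2:ℝ) • v + (2 * p.b₂) • mul z v
    + (3 * p.b₃) • mul z (mul z v) + (4 * p.b₄) • mul z (mul z (mul z v)) := rfl

theorem f_eq (X : LState) : p.f X = p.g X.z - (p.a * p.κ / 2) • mul X.v X.v
    + mul X.ρ (p.g X.z - (p.a * p.κ / 2) • mul X.v X.v) := rfl

theorem R_eq (X : LState) : p.R X = (2 * p.l)⁻¹ •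
    (solve 1 p.l X.ρ (J (p.f X)) + solve (-1) p.l X.ρ (J (p.f X))) := rfl

theorem P_eq (X : LState) : p.P X = (2 * p.κ)⁻¹ •
    (solve (-1) p.l X.ρ (J (p.f X)) - solve 1 p.l X.ρ (J (p.f X))) := rfl

theorem κ_eq : p.κ = p.l ^ 2 := rfl

attribute [irreducible] κ g g' f R P field

end TransportCoeff

/-! ### Consistency of the Lagrangian variables and conservation of energy -/

theorem eq_zero_of_norm_deriv_le {E : Type*} [NormedAddCommGroup E] [NormedSpace ℝ E]
    {f f' : ℝ → E} {K : ℝ → ℝ} {τ : ℝ} (hf : ∀ t ∈ Ico 0 τ, HasDerivAt f (f' t) t) (h0 : f 0 = 0)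
    (hK : ContinuousOn K (Ico 0 τ)) (h : ∀ t ∈ Ico 0 τ, ‖f' t‖ ≤ K t * ‖f t‖) :
    ∀ t ∈ Ico 0 τ, f t = 0 := by
  intro t ht
  have hsub : Icc 0 t ⊆ Ico 0 τ := fun s hs => ⟨hs.1, hs.2.trans_lt ht.2⟩
  obtain ⟨C, hC⟩ := (isCompact_Icc.image_of_continuousOn (hK.mono hsub)).bddAbove
  refine eq_zero_of_abs_deriv_le_mul_abs_self_of_eq_zero_right (K := C) (a := 0) (b := t)
    (fun s hs => (hf s (hsub hs)).continuousAt.continuousWithinAt)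
    (fun s hs => (hf s (hsub (Ico_subset_Icc_self hs))).hasDerivWithinAt) h0 (fun s hs => ?_)
    t ⟨ht.1, le_rfl⟩
  have hs' := Ico_subset_Icc_self hs
  exact (h s (hsub hs')).trans
    (mul_le_mul_of_nonneg_right (hC ⟨s, hs', rfl⟩) (norm_nonneg _))



namespace TransportCoeff

open H1R LState

variable {p : TransportCoeff}

/-- A solution of the Lagrangian system on `[0, τ)` which starts at the identity flow and whose
components are consistent derivatives of each other. -/
structure LagrangianSolution (p : TransportCoeff) (τ : ℝ) (X : ℝ → LState) : Prop where
  hasDerivAt : ∀ t ∈ Ico 0 τ, HasDerivAt X (p.field (X t)) t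
  mem_Omega : ∀ t ∈ Ico 0 τ, X t ∈ Omega
  ρ_zero : (X 0).ρ = 0
  D_Y : ∀ t ∈ Ico 0 τ, D (X t).Y = J (X t).ρ
  D_z : ∀ t ∈ Ico 0 τ, D (X t).z = J ((X t).v + mul (X t).ρ (X t).v)
  D_v : ∀ t ∈ Ico 0 τ, D (X t).v = J ((X t).w + mul (X t).ρ (X t).w)

section components

variable {X : ℝ → LState} {X' : LState} {t : ℝ}

theorem hasDerivAt_snd {E F : Type*} [NormedAddCommGroup E] [NormedSpace ℝ E]
    [NormedAddCommGroup F] [NormedSpace ℝ F] {f : ℝ → E × F} {f' : E × F}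
    (h : HasDerivAt f f' t) : HasDerivAt (fun t => (f t).2) f'.2 t :=
  (ContinuousLinearMap.snd ℝ E F).hasFDerivAt.comp_hasDerivAt t h

theorem hasDerivAt_fst {E F : Type*} [NormedAddCommGroup E] [NormedSpace ℝ E]
    [NormedAddCommGroup F] [NormedSpace ℝ F] {f : ℝ → E × F} {f' : E × F}
    (h : HasDerivAt f f' t) : HasDerivAt (fun t => (f t).1) f'.1 t :=
  (ContinuousLinearMap.fst ℝ E F).hasFDerivAt.comp_hasDerivAt t h

theorem hasDerivAt_Y (h : HasDerivAt X X' t) : HasDerivAt (fun t => (X t).Y) X'.Y t :=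
  hasDerivAt_fst h

theorem hasDerivAt_ρ (h : HasDerivAt X X' t) : HasDerivAt (fun t => (X t).ρ) X'.ρ t :=
  hasDerivAt_fst (hasDerivAt_snd h)

theorem hasDerivAt_z (h : HasDerivAt X X' t) : HasDerivAt (fun t => (X t).z) X'.z t :=
  hasDerivAt_fst (hasDerivAt_snd (hasDerivAt_snd h))

theorem hasDerivAt_v (h : HasDerivAt X X' t) : HasDerivAt (fun t => (X t).v) X'.v t :=
  hasDerivAt_fst (hasDerivAt_snd (hasDerivAt_snd (hasDerivAt_snd h)))

theorem hasDerivAt_w (h : HasDerivAt X X' t) : HasDerivAt (fun t => (X t).w) X'.w t :=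
  hasDerivAt_snd (hasDerivAt_snd (hasDerivAt_snd (hasDerivAt_snd h)))

end components

theorem hasDerivAt_clm {E F : Type*} [NormedAddCommGroup E] [NormedSpace ℝ E]
    [NormedAddCommGroup F] [NormedSpace ℝ F] (L : E →L[ℝ] F) {f : ℝ → E} {f' : E} {t : ℝ}
    (h : HasDerivAt f f' t) : HasDerivAt (fun t => L (f t)) (L f') t :=
  L.hasFDerivAt.comp_hasDerivAt t h

theorem hasDerivAt_bilin {E F G : Type*} [NormedAddCommGroup E] [NormedSpace ℝ E]
    [NormedAddCommGroup F] [NormedSpace ℝ F] [NormedAddCommGroup G] [NormedSpace ℝ G]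
    (B : E →L[ℝ] F →L[ℝ] G) {u : ℝ → E} {v : ℝ → F} {u' : E} {v' : F} {t : ℝ}
    (hu : HasDerivAt u u' t) (hv : HasDerivAt v v' t) :
    HasDerivAt (fun t => B (u t) (v t)) (B u' (v t) + B (u t) v') t :=
  (hasDerivAt_clm B hu).clm_apply hv

theorem hasDerivAt_mul {u v : ℝ → H1R} {u' v' : H1R} {t : ℝ} (hu : HasDerivAt u u' t)
    (hv : HasDerivAt v v' t) :
    HasDerivAt (fun t => mul (u t) (v t)) (mul u' (v t) + mul (u t) v') t :=
  hasDerivAt_bilin mul hu hv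

/-- Each consistency defect vanishes initially and solves a linear homogeneous equation: the defects
of Y and z are constant in time, and the defect d of v satisfies d' = a v d. -/
theorem lagrangianSolution_of_isODESolution {τ : ℝ} {X : ℝ → LState} {z₀ v₀ w₀ : H1R}
    (hz : D z₀ = J v₀) (hv : D v₀ = J w₀)
    (hX : IsODESolution p.field Omega (0, 0, z₀, v₀, w₀) τ X) : p.LagrangianSolution τ X := by
  obtain ⟨h0, δ, hδ, h⟩ := hX
  have hd : ∀ t ∈ Ico 0 τ, HasDerivAt X (p.field (X t)) t := fun t ht =>
    (h t ⟨by linarith [ht.1], ht.2⟩).1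
  have hO : ∀ t ∈ Ico 0 τ, X t ∈ Omega := fun t ht => (h t ⟨by linarith [ht.1], ht.2⟩).2
  have hκ := p.κ_pos.ne'
  have hDz : ∀ t ∈ Ico 0 τ, D (X t).z = J ((X t).v + mul (X t).ρ (X t).v) := by
    intro t ht
    refine sub_eq_zero.1 (eq_zero_of_norm_deriv_le (K := fun _ => 0) (τ := τ)
      (f := fun t => D (X t).z - J ((X t).v + mul (X t).ρ (X t).v)) (f' := fun _ => 0)
      (fun t ht => ?_) ?_ continuousOn_const (fun t _ => by simp) t ht)
    · have hX := hd t ht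
      refine HasDerivAt.congr_deriv ((hasDerivAt_clm D (hasDerivAt_z hX)).sub (hasDerivAt_clm J
        ((hasDerivAt_v hX).add (hasDerivAt_mul (hasDerivAt_ρ hX) (hasDerivAt_v hX))))) ?_
      rw [field_z, map_neg, D_P (hO t ht), ← J_mul,
        ← map_add, ← map_sub, ← map_smul, ← map_neg, ← map_sub]
      convert map_zero J
      refine ext_rep fun x => ?_
      simp [rep_f]
      field_simp
      ring
    · simp [h0, hz]
  refine ⟨hd, hO, by rw [h0], ?_, hDz, ?_⟩
  · intro t ht
    refine sub_eq_zero.1 (eq_zero_of_norm_deriv_le (K := fun _ => 0) (τ := τ)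
      (f := fun t => D (X t).Y - J (X t).ρ) (f' := fun _ => 0)
      (fun t ht => ?_) ?_ continuousOn_const (fun t _ => by simp) t ht)
    · have hX := hd t ht
      refine HasDerivAt.congr_deriv ((hasDerivAt_clm D (hasDerivAt_Y hX)).sub
        (hasDerivAt_clm J (hasDerivAt_ρ hX))) ?_
      simp only [field_Y, field_ρ, map_smul, hDz t ht, sub_self]
    · simp [h0]
  · intro t ht
    refine sub_eq_zero.1 (eq_zero_of_norm_deriv_le (K := fun t => ‖p.a‖ * ‖(X t).v‖) (τ := τ)
      (f := fun t => D (X t).v - J ((X t).w + mul (X t).ρ (X t).w))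
      (f' := fun t => p.a • mulL (X t).v (D (X t).v - J ((X t).w + mul (X t).ρ (X t).w)))
      (fun t ht => ?_) ?_ (continuousOn_const.mul (fun t ht =>
        (hasDerivAt_v (hd t ht)).continuousAt.continuousWithinAt.norm)) (fun t _ => ?_) t ht)
    · have hX := hd t ht
      refine HasDerivAt.congr_deriv ((hasDerivAt_clm D (hasDerivAt_v hX)).sub (hasDerivAt_clm J
        ((hasDerivAt_w hX).add (hasDerivAt_mul (hasDerivAt_ρ hX) (hasDerivAt_w hX))))) ?_
      rw [field_v, map_add, map_smul, map_smul, map_sub,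
        p.D_g (hDz t ht), D_R (hO t ht), D_mul, map_sub, ← J_mul, ← J_mul, ← map_add J, ← map_sub J,
        ← map_smul J, smul_sub]
      have : (p.a / 2) • (mulL (X t).v (D (X t).v) + mulL (X t).v (D (X t).v))
          = p.a • mulL (X t).v (D (X t).v) := by
        rw [← two_smul ℝ, smul_smul]; congr 1; ring
      rw [this, add_sub_assoc, smul_sub, sub_eq_add_neg (p.a • mulL (X t).v (D (X t).v)),
        ← map_smul J, ← map_neg J, ← map_sub J]
      congr 2
      refine ext_rep fun x => ?_
      simp [rep_g']
      field_simp
      ring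
    · simp [h0, hv]
    · rw [norm_smul, mul_assoc]
      exact mul_le_mul_of_nonneg_left (norm_mulL_le (abs_rep_le _) _) (norm_nonneg _)

/-- With m = zⁿ, integration by parts gives ⟨z', zⁿ⟩ = -n⟨z', zⁿ⟩, so the pairing vanishes. -/
theorem inner_D_pow {z m m' : H1R} {n : ℝ} (hn : 0 < n) (hm : m = mul m' z)
    (hD : D m = n • mulL m' (D z)) : inner ℝ (D z) (J m) = 0 := by
  have h1 := inner_D_J z m
  rw [hD, real_inner_smul_right, ← inner_mulL, ← J_mul, ← hm, real_inner_comm] at h1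
  have h2 : (1 + n) * inner ℝ (J m) (D z) = 0 := by linarith
  rw [real_inner_comm]
  exact (mul_eq_zero.1 h2).resolve_left (by linarith)

theorem D_sq (z : H1R) : D (mul z z) = (2:ℝ) • mulL z (D z) := by
  rw [D_mul, two_smul]

theorem D_cube (z : H1R) : D (mul z (mul z z)) = (3:ℝ) • mulL (mul z z) (D z) := by
  rw [D_mul, D_sq, map_smul, mulL_mulL]; module

theorem D_fourth (z : H1R) :
    D (mul z (mul z (mul z z))) = (4:ℝ) • mulL (mul z (mul z z)) (D z) := by
  rw [D_mul, D_cube, map_smul, mulL_mulL]; module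

theorem inner_D_sq (z : H1R) : inner ℝ (D z) (J (mul z z)) = 0 :=
  inner_D_pow (by norm_num) rfl (D_sq z)

theorem inner_D_g (z : H1R) : inner ℝ (D z) (J (p.g z)) = 0 := by
  have h3 : inner ℝ (D z) (J (mul z (mul z z))) = 0 :=
    inner_D_pow (by norm_num) (mul_swap _ _) (D_cube z)
  have h4 : inner ℝ (D z) (J (mul z (mul z (mul z z)))) = 0 :=
    inner_D_pow (by norm_num) (mul_swap _ _) (D_fourth z)
  simp only [g_eq, map_add, map_smul, inner_add_right, real_inner_smul_right, inner_D_sq, h3, h4,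
    inner_self_D, mul_zero, add_zero]

/-- The energy `∫ q (z² + κ v²)`. -/
noncomputable def energy (p : TransportCoeff) (X : LState) : ℝ :=
  inner ℝ (J X.z + mulL X.ρ (J X.z)) (J X.z) + p.κ * inner ℝ (J X.v + mulL X.ρ (J X.v)) (J X.v)

theorem hasDerivAt_weighted {ρ u : ℝ → H1R} {ρ' u' : H1R} {t : ℝ} (hρ : HasDerivAt ρ ρ' t)
    (hu : HasDerivAt u u' t) :
    HasDerivAt (fun t => inner ℝ (J (u t) + mulL (ρ t) (J (u t))) (J (u t)))
      (inner ℝ (J ((2:ℝ) • (u' + mul (ρ t) u') + mul ρ' (u t))) (J (u t))) t := by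
  have h1 := hasDerivAt_clm J hu
  have h2 := (h1.add (hasDerivAt_bilin mulL hρ h1)).inner ℝ h1
  refine h2.congr_deriv ?_
  simp only [map_add, map_smul, J_mul, inner_add_left, real_inner_smul_left, inner_mulL,
    real_inner_comm (J u') (J (u t)), Pi.add_apply]
  rw [← inner_mulL (ρ t) (J u') (J (u t)), real_inner_comm (mulL (ρ t) (J u')) (J (u t))]
  ring

/-- The coefficient a/2 in v_t makes the cubic term in v cancel against the change of the Jacobian.
The other local terms are total derivatives, and the two pressure terms, both multiples of ⟨R, z_ξ⟩,
cancel. -/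
theorem LagrangianSolution.energy_eq {τ : ℝ} {X : ℝ → LState} (h : p.LagrangianSolution τ X) :
    ∀ t ∈ Ico 0 τ, p.energy (X t) = p.energy (X 0) := by
  intro t ht
  refine sub_eq_zero.1 (eq_zero_of_norm_deriv_le (K := fun _ => 0) (τ := τ)
      (f := fun t => p.energy (X t) - p.energy (X 0)) (f' := fun _ => 0)
      (fun t ht => ?_) (sub_self _) continuousOn_const (fun t _ => by simp) t ht)
  have hX := h.hasDerivAt t ht
  have hκ := p.κ_pos.ne'
  refine HasDerivAt.congr_deriv (((hasDerivAt_weighted (hasDerivAt_ρ hX) (hasDerivAt_z hX)).add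
    ((hasDerivAt_weighted (hasDerivAt_ρ hX) (hasDerivAt_v hX)).const_mul p.κ)).sub_const _) ?_
  set Z := X t
  have e1 : (2:ℝ) • ((p.field Z).z + mul Z.ρ (p.field Z).z) + mul (p.field Z).ρ Z.z
      = (-p.a) • mul (Z.v + mul Z.ρ Z.v) Z.z - (2:ℝ) • (p.P Z + mul Z.ρ (p.P Z)) :=
    ext_rep fun x => by simp; ring
  have e2 : (2:ℝ) • ((p.field Z).v + mul Z.ρ (p.field Z).v) + mul (p.field Z).ρ Z.v
      = (2 * p.κ⁻¹) • ((p.g Z.z - p.R Z) + mul Z.ρ (p.g Z.z - p.R Z)) :=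
    ext_rep fun x => by simp; ring
  have e3 : inner ℝ (J (mul (Z.v + mul Z.ρ Z.v) Z.z)) (J Z.z) = 0 := by
    rw [mul_swap, J_mul, ← h.D_z t ht, inner_mulL, ← J_mul, inner_D_sq]
  have e4 : inner ℝ (J (p.P Z + mul Z.ρ (p.P Z))) (J Z.z) = - inner ℝ (J (p.R Z)) (D Z.z) := by
    rw [map_add, J_mul, ← D_R (h.mem_Omega t ht), inner_D_J]
  have e5 : inner ℝ (J ((p.g Z.z - p.R Z) + mul Z.ρ (p.g Z.z - p.R Z))) (J Z.v)
      = - inner ℝ (J (p.R Z)) (D Z.z) := by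
    rw [map_add, J_mul, inner_add_left, inner_mulL, ← inner_add_right, ← J_mul, ← map_add,
      ← h.D_z t ht, map_sub, inner_sub_left, real_inner_comm, inner_D_g, zero_sub]
  rw [e1, e2, map_sub, map_smul, map_smul, map_smul, inner_sub_left, real_inner_smul_left,
    real_inner_smul_left, real_inner_smul_left, e3, e4, e5]
  field_simp
  ring

end TransportCoeff

/-! ### Uniform bounds on elevation and pressure from the energy -/

namespace H1R

/-- A family in `H¹` which is uniformly bounded and whose `H¹` norm is controlled by `m`. -/
def IsTame {ι : Type*} (m : ι → ℝ) (u : ι → H1R) : Prop :=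
  ∃ S k : ℝ, 0 ≤ k ∧ ∀ i, (∀ x, |rep (u i) x| ≤ S) ∧ ‖u i‖ ≤ k * m i

namespace IsTame

variable {ι : Type*} {m : ι → ℝ} {u v : ι → H1R}

theorem add (hu : IsTame m u) (hv : IsTame m v) : IsTame m (fun i => u i + v i) := by
  obtain ⟨S, k, hk, h⟩ := hu
  obtain ⟨S', k', hk', h'⟩ := hv
  refine ⟨S + S', k + k', by positivity, fun i => ⟨fun x => ?_, ?_⟩⟩
  · rw [rep_add]
    exact (abs_add_le _ _).trans (add_le_add ((h i).1 x) ((h' i).1 x))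
  · refine (norm_add_le _ _).trans ?_
    linarith [(h i).2, (h' i).2]

theorem smul (r : ℝ) (hu : IsTame m u) : IsTame m (fun i => r • u i) := by
  obtain ⟨S, k, hk, h⟩ := hu
  refine ⟨|r| * S, |r| * k, by positivity, fun i => ⟨fun x => ?_, ?_⟩⟩
  · rw [rep_smul, abs_mul]
    exact mul_le_mul_of_nonneg_left ((h i).1 x) (abs_nonneg _)
  · rw [norm_smul, mul_assoc, Real.norm_eq_abs]
    exact mul_le_mul_of_nonneg_left (h i).2 (abs_nonneg _)

theorem sub (hu : IsTame m u) (hv : IsTame m v) :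
    IsTame m (fun i => u i - v i) := by
  have := hu.add (hv.smul (-1))
  simpa [sub_eq_add_neg] using this

theorem mul (hu : IsTame m u) (hv : IsTame m v) :
    IsTame m (fun i => H1R.mul (u i) (v i)) := by
  obtain ⟨S, k, hk, h⟩ := hu
  obtain ⟨S', k', hk', h'⟩ := hv
  refine ⟨|S| * |S'|, 2 * |S| * k' + |S'| * k, by positivity, fun i => ⟨fun x => ?_, ?_⟩⟩
  · rw [rep_mul, abs_mul]
    exact mul_le_mul (((h i).1 x).trans (le_abs_self _)) (((h' i).1 x).trans (le_abs_self _))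
      (abs_nonneg _) (abs_nonneg _)
  · refine (norm_mul_le (fun x => ((h i).1 x).trans (le_abs_self _))
      (fun x => ((h' i).1 x).trans (le_abs_self _))).trans ?_
    have h1 := mul_le_mul_of_nonneg_left (h' i).2 (by positivity : 0 ≤ 2 * |S|)
    have h2 := mul_le_mul_of_nonneg_left (h i).2 (abs_nonneg S')
    linarith

end IsTame

theorem weighted_nonneg {ρ : H1R} (hρ : ∀ x, 0 ≤ 1 + rep ρ x) (f : L2R) :
    0 ≤ inner ℝ (f + mulL ρ f) f := by
  simpa using coercive hρ f

/-- Weighted Sobolev inequality. -/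
theorem sq_rep_le_weighted {ρ u s : H1R} (hρ : ∀ x, 0 ≤ 1 + rep ρ x) (h : D u = J (s + mul ρ s))
    (x : ℝ) : rep u x ^ 2 ≤ inner ℝ (J u + mulL ρ (J u)) (J u)
      + inner ℝ (J s + mulL ρ (J s)) (J s) := by
  refine (sq_rep_le u x).trans ?_
  rw [integral_weight, integral_weight, ← integral_add (integrable_weight _ _ _)
    (integrable_weight _ _ _)]
  refine integral_mono_of_nonneg (ae_of_all _ fun t => abs_nonneg _)
    ((integrable_weight _ _ _).add (integrable_weight _ _ _)) ?_
  filter_upwards [J_ae u, J_ae s, J_ae (s + mul ρ s)] with t a b c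
  rw [h, c, a, b, rep_add, rep_mul, abs_le]
  have h0 := hρ t
  constructor <;> nlinarith [mul_nonneg h0 (sq_nonneg (rep u t + rep s t)),
    mul_nonneg h0 (sq_nonneg (rep u t - rep s t))]

end H1R

theorem le_of_sq_le_add_mul {r A B : ℝ} (hA : 0 ≤ A) (hB : 0 ≤ B) (h : r ^ 2 ≤ A + B * r) :
    r ≤ 1 + A + B := by
  by_contra hr
  push Not at hr
  nlinarith [mul_nonneg hA (by linarith : 0 ≤ r - 1)]

namespace TransportCoeff

open H1R LState

variable {p : TransportCoeff}

/-- A bound for `|g(z) / z|` when `|z| ≤ B`. -/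
noncomputable def gBound (p : TransportCoeff) (B : ℝ) : ℝ :=
  2 + |p.b₂| * B + |p.b₃| * B ^ 2 + |p.b₄| * B ^ 3

theorem gBound_nonneg {B : ℝ} (hB : 0 ≤ B) : 0 ≤ p.gBound B := by
  unfold gBound; positivity

theorem abs_g_le {z : H1R} {x B : ℝ} (hB : |rep z x| ≤ B) :
    |rep (p.g z) x| ≤ p.gBound B * |rep z x| := by
  have hB0 : 0 ≤ B := (abs_nonneg _).trans hB
  have : rep (p.g z) x = (2 + p.b₂ * rep z x + p.b₃ * rep z x ^ 2 + p.b₄ * rep z x ^ 3) * rep z x := by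
    rw [rep_g]; ring
  rw [this, abs_mul]
  refine mul_le_mul_of_nonneg_right ?_ (abs_nonneg _)
  refine (abs_add_le _ _).trans (add_le_add ((abs_add_le _ _).trans
    (add_le_add ((abs_add_le _ _).trans (add_le_add (by norm_num) ?_)) ?_)) ?_)
  · rw [abs_mul]; gcongr
  · rw [abs_mul, abs_pow]; gcongr
  · rw [abs_mul, abs_pow]; gcongr

theorem pos_of_mem_Omega {X : LState} (hX : X ∈ Omega) (x : ℝ) : 0 < 1 + rep X.ρ x := by
  obtain ⟨c, hc, h⟩ := hX
  exact hc.trans_le (h x)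

theorem sq_z_le {X : LState} (hX : X ∈ Omega) (hz : D X.z = J (X.v + mul X.ρ X.v)) (x : ℝ) :
    rep X.z x ^ 2 ≤ (1 + p.κ⁻¹) * p.energy X := by
  have hq := fun x => (pos_of_mem_Omega hX x).le
  refine (sq_rep_le_weighted hq hz x).trans ?_
  have h1 := weighted_nonneg hq (J X.z)
  have h2 := weighted_nonneg hq (J X.v)
  have hκ := p.κ_pos
  unfold energy
  have h3 : p.κ⁻¹ * p.κ = 1 := inv_mul_cancel₀ hκ.ne'
  have h4 := mul_nonneg (inv_pos.2 hκ).le h1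
  have h5 := mul_nonneg hκ.le h2
  calc _ ≤ inner ℝ (J X.z + mulL X.ρ (J X.z)) (J X.z)
        + (p.κ⁻¹ * p.κ) * inner ℝ (J X.v + mulL X.ρ (J X.v)) (J X.v)
        + p.κ⁻¹ * inner ℝ (J X.z + mulL X.ρ (J X.z)) (J X.z)
        + p.κ * inner ℝ (J X.v + mulL X.ρ (J X.v)) (J X.v) := by rw [h3]; linarith
    _ = _ := by ring

theorem energy_nonneg {X : LState} (hX : X ∈ Omega) : 0 ≤ p.energy X := by
  have hq := fun x => (pos_of_mem_Omega hX x).le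
  exact add_nonneg (weighted_nonneg hq _) (mul_nonneg p.κ_pos.le (weighted_nonneg hq _))

/-- This is the elliptic equation R - κR_xx = G tested with R, written with the weight q. -/
theorem pressure_identity {X : LState} (hX : X ∈ Omega) :
    inner ℝ (J (p.R X) + mulL X.ρ (J (p.R X))) (J (p.R X))
      + p.κ * inner ℝ (J (p.P X) + mulL X.ρ (J (p.P X))) (J (p.P X))
      = inner ℝ (J (p.f X)) (J (p.R X)) := by
  have h1 := inner_D_J (p.P X) (p.R X)
  rw [D_P hX, D_R hX, real_inner_smul_left, inner_sub_left,
    real_inner_comm (J (p.P X) + _) (J (p.P X))] at h1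
  have hκ := p.κ_pos.ne'
  field_simp at h1
  linarith

/-- The energy controls v² only in weighted L¹, so that part of the source must be paired with the
supremum r of |R|. The weighted Sobolev inequality then gives r² ≤ A + Br with A and B depending on
the energy and on B's bound for z, which bounds r. -/
theorem abs_R_le {X : LState} (hX : X ∈ Omega) {B : ℝ} (hB : ∀ x, |rep X.z x| ≤ B) (x : ℝ) :
    |rep (p.R X) x| ≤ 1 + (1 + p.κ⁻¹) * (p.gBound B ^ 2 * p.energy X)
      + (1 + p.κ⁻¹) * (p.a * p.energy X) := by
  have hq := fun x => (pos_of_mem_Omega hX x).le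
  have hκ := p.κ_pos
  have hκ' := inv_pos.2 hκ
  have ha := p.a_pos
  have hE := p.energy_nonneg hX
  -- The supremum is finite beforehand because R lies in H¹; without this the absorption below would
  -- be empty.
  set r := ⨆ x, |rep (p.R X) x| with hr
  have hbdd : BddAbove (range fun x => |rep (p.R X) x|) := by
    refine ⟨‖p.R X‖, ?_⟩
    rintro _ ⟨x, rfl⟩
    exact abs_rep_le _ x
  have hrx : ∀ x, |rep (p.R X) x| ≤ r := fun x => le_ciSup hbdd x
  have hr0 : 0 ≤ r := (abs_nonneg _).trans (hrx 0)
  set Q1 := inner ℝ (J (p.R X) + mulL X.ρ (J (p.R X))) (J (p.R X)) with hQ1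
  set Q2 := inner ℝ (J (p.P X) + mulL X.ρ (J (p.P X))) (J (p.P X)) with hQ2
  have q1 : 0 ≤ Q1 := weighted_nonneg hq _
  have q2 : 0 ≤ Q2 := weighted_nonneg hq _
  have e1 := weighted_nonneg hq (J X.z)
  have e2 := weighted_nonneg hq (J X.v)
  have hid := p.pressure_identity hX
  have hup : inner ℝ (J (p.f X)) (J (p.R X)) ≤ p.gBound B ^ 2 / 2 *
      inner ℝ (J X.z + mulL X.ρ (J X.z)) (J X.z) + 1 / 2 * Q1
      + p.a * p.κ / 2 * r * inner ℝ (J X.v + mulL X.ρ (J X.v)) (J X.v) := by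
    have I1 := (integrable_weight X.ρ (J X.z) (J X.z)).const_mul (p.gBound B ^ 2 / 2)
    have I2 := (integrable_weight X.ρ (J (p.R X)) (J (p.R X))).const_mul (1 / 2)
    have I3 := (integrable_weight X.ρ (J X.v) (J X.v)).const_mul (p.a * p.κ / 2 * r)
    rw [hQ1, inner_eq, integral_weight, integral_weight, integral_weight, ← integral_const_mul,
      ← integral_const_mul, ← integral_const_mul, ← integral_add I1 I2,
      ← integral_add (by exact I1.add I2) I3]
    refine integral_mono_ae (integrable_mul _ _) ((I1.add I2).add I3) ?_
    filter_upwards [J_ae (p.f X), J_ae (p.R X), J_ae X.z, J_ae X.v] with t t1 t2 t3 t4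
    rw [t1, t2, t3, t4, rep_f]
    have g1 := abs_g_le (p := p) (hB t)
    have hR := hrx t
    set q := 1 + rep X.ρ t
    set y := rep (p.R X) t
    set gz := rep (p.g X.z) t
    have hq0 : 0 ≤ q := hq t
    have i1 : gz * y ≤ p.gBound B ^ 2 / 2 * (rep X.z t * rep X.z t) + 1 / 2 * (y * y) := by
      have : gz ^ 2 ≤ (p.gBound B * |rep X.z t|) ^ 2 := sq_le_sq' (by linarith [(abs_le.1 g1).1])
        ((le_abs_self _).trans g1)
      rw [mul_pow, sq_abs] at this
      nlinarith [sq_nonneg (gz - y)]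
    have i2 : - (rep X.v t ^ 2 * y) ≤ rep X.v t ^ 2 * r := by
      nlinarith [mul_nonneg (sq_nonneg (rep X.v t)) (by linarith [(abs_le.1 hR).1] : 0 ≤ r + y)]
    have i3 := mul_le_mul_of_nonneg_left i1 hq0
    have i4 := mul_le_mul_of_nonneg_left i2 (by positivity : 0 ≤ q * (p.a * p.κ / 2))
    linarith
  have hQ : Q1 + p.κ * Q2 ≤ p.gBound B ^ 2 * p.energy X + p.a * p.energy X * r := by
    unfold energy
    have j1 := mul_nonneg hκ.le q2
    have j2 : 0 ≤ p.gBound B ^ 2 * (p.κ * inner ℝ (J X.v + mulL X.ρ (J X.v)) (J X.v)) := by positivity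
    have j3 : 0 ≤ p.a * r * inner ℝ (J X.z + mulL X.ρ (J X.z)) (J X.z) := by positivity
    linarith
  have hfin : ∀ x, |rep (p.R X) x| ^ 2 ≤ (1 + p.κ⁻¹) * (p.gBound B ^ 2 * p.energy X)
      + (1 + p.κ⁻¹) * (p.a * p.energy X) * r := by
    intro x
    rw [sq_abs]
    refine (sq_rep_le_weighted hq (s := p.P X) (by rw [map_add, J_mul]; exact D_R hX) x).trans ?_
    have k1 := mul_nonneg hκ'.le q1
    have k2 := mul_nonneg hκ.le q2
    have h3 : p.κ⁻¹ * p.κ = 1 := inv_mul_cancel₀ hκ.ne'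
    calc Q1 + Q2 ≤ Q1 + (p.κ⁻¹ * p.κ) * Q2 + p.κ⁻¹ * Q1 + p.κ * Q2 := by rw [h3]; linarith
      _ = (1 + p.κ⁻¹) * (Q1 + p.κ * Q2) := by ring
      _ ≤ (1 + p.κ⁻¹) * (p.gBound B ^ 2 * p.energy X + p.a * p.energy X * r) := by gcongr
      _ = _ := by ring
  -- The pointwise bound has a right-hand side independent of x, so it passes to the supremum and
  -- becomes a quadratic inequality for r.
  refine (hrx x).trans (le_of_sq_le_add_mul (by positivity) (by positivity) ?_)
  have : r ≤ √((1 + p.κ⁻¹) * (p.gBound B ^ 2 * p.energy X)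
      + (1 + p.κ⁻¹) * (p.a * p.energy X) * r) := ciSup_le fun x => Real.le_sqrt_of_sq_le (hfin x)
  calc r ^ 2 ≤ _ := pow_le_pow_left₀ hr0 this 2
    _ = _ := Real.sq_sqrt (by positivity)

namespace LagrangianSolution

variable {τ : ℝ} {X : ℝ → LState} (h : p.LagrangianSolution τ X)
include h

theorem ρ_pos {t : ℝ} (ht : t ∈ Ico 0 τ) (x : ℝ) : 0 < 1 + rep (X t).ρ x :=
  pos_of_mem_Omega (h.mem_Omega t ht) x

/-- Bounds that depend on the energy only. -/
theorem exists_energy_bound : ∃ C > 0, ∀ t ∈ Ico 0 τ, ∀ x, |rep (X t).z x| ≤ C ∧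
    |p.κ⁻¹ * (rep (p.g (X t).z) x - rep (p.R (X t)) x)| ≤ C := by
  set E := p.energy (X 0)
  set B := √((1 + p.κ⁻¹) * E) with hB
  set A := 1 + (1 + p.κ⁻¹) * (p.gBound B ^ 2 * E) + (1 + p.κ⁻¹) * (p.a * E) with hA
  have hz : ∀ t ∈ Ico 0 τ, ∀ x, |rep (X t).z x| ≤ B := fun t ht x => by
    refine Real.abs_le_sqrt ?_
    have := sq_z_le (p := p) (h.mem_Omega t ht) (h.D_z t ht) x
    rwa [h.energy_eq t ht] at this
  have hκ := inv_pos.2 p.κ_pos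
  refine ⟨B + |p.κ⁻¹ * (p.gBound B * B + A)| + 1, by positivity, fun t ht x => ⟨?_, ?_⟩⟩
  · have := abs_nonneg (p.κ⁻¹ * (p.gBound B * B + A))
    linarith [hz t ht x]
  · have h1 : |rep (p.R (X t)) x| ≤ A := by
      have := abs_R_le (p := p) (h.mem_Omega t ht) (hz t ht) x
      rwa [h.energy_eq t ht] at this
    have h2 := (abs_g_le (p := p) (hz t ht x)).trans
      (mul_le_mul_of_nonneg_left (hz t ht x) (gBound_nonneg (Real.sqrt_nonneg _)))
    have h3 : |p.κ⁻¹ * (rep (p.g (X t).z) x - rep (p.R (X t)) x)| ≤ p.κ⁻¹ * (p.gBound B * B + A) := by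
      rw [abs_mul, abs_of_pos hκ]
      exact mul_le_mul_of_nonneg_left ((abs_sub _ _).trans (add_le_add h2 h1)) hκ.le
    have := Real.sqrt_nonneg ((1 + p.κ⁻¹) * E)
    linarith [le_abs_self (p.κ⁻¹ * (p.gBound B * B + A))]

/-- The pointwise Riccati equation. Transport produces a v², and half of it is returned by the local
part of the nonlocal term, κ⁻¹G = κ⁻¹g(z) - (a/2)v². The positive sign of what remains allows
blow-up only upwards. -/
theorem hasDerivAt_rep_v {t : ℝ} (ht : t ∈ Ico 0 τ) (x : ℝ) :
    HasDerivAt (fun t => rep (X t).v x) (p.a / 2 * rep (X t).v x ^ 2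
      + p.κ⁻¹ * (rep (p.g (X t).z) x - rep (p.R (X t)) x)) t := by
  have := hasDerivAt_clm (evalL x) (hasDerivAt_v (h.hasDerivAt t ht))
  simp only [evalL_apply] at this
  refine this.congr_deriv ?_
  simp only [field_v, rep_add, rep_smul, rep_mul, rep_sub]; ring

theorem hasDerivAt_rep_ρ {t : ℝ} (ht : t ∈ Ico 0 τ) (x : ℝ) :
    HasDerivAt (fun t => 1 + rep (X t).ρ x) (-p.a * rep (X t).v x * (1 + rep (X t).ρ x)) t := by
  have := hasDerivAt_clm (evalL x) (hasDerivAt_ρ (h.hasDerivAt t ht))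
  simp only [evalL_apply] at this
  refine (this.const_add 1).congr_deriv ?_
  simp; ring

theorem hasDerivAt_rep_w {t : ℝ} (ht : t ∈ Ico 0 τ) (x : ℝ) :
    HasDerivAt (fun t => rep (X t).w x) (2 * p.a * rep (X t).v x * rep (X t).w x
      + p.κ⁻¹ * (rep (p.g' (X t).z (X t).v) x - rep (p.P (X t)) x)) t := by
  have := hasDerivAt_clm (evalL x) (hasDerivAt_w (h.hasDerivAt t ht))
  simp only [evalL_apply] at this
  refine this.congr_deriv ?_
  simp only [field_w, rep_add, rep_smul, rep_mul, rep_sub]; ring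

end LagrangianSolution

end TransportCoeff

/-! ### Continuation of the Lagrangian solution while the slope is bounded above -/

theorem monotoneOn_of_hasDerivAt_nonneg {f f' : ℝ → ℝ} {τ : ℝ}
    (hf : ∀ t ∈ Ico 0 τ, HasDerivAt f (f' t) t) (h : ∀ t ∈ Ico 0 τ, 0 ≤ f' t) :
    MonotoneOn f (Ico 0 τ) := by
  refine monotoneOn_of_deriv_nonneg (convex_Ico 0 τ)
    (fun t ht => (hf t ht).continuousAt.continuousWithinAt)
    (fun t ht => (hf t (interior_subset ht)).differentiableAt.differentiableWithinAt) fun t ht => ?_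
  rw [(hf t (interior_subset ht)).deriv]
  exact h t (interior_subset ht)

theorem norm_le_of_norm_deriv_le {E : Type*} [NormedAddCommGroup E] [NormedSpace ℝ E]
    {f f' : ℝ → E} {τ K ε δ : ℝ} (hK : 0 ≤ K) (hε : 0 ≤ ε) (hδ : 0 ≤ δ)
    (hf : ∀ t ∈ Ico 0 τ, HasDerivAt f (f' t) t) (h0 : ‖f 0‖ ≤ δ)
    (h : ∀ t ∈ Ico 0 τ, ‖f' t‖ ≤ K * ‖f t‖ + ε) :
    ∀ t ∈ Ico 0 τ, ‖f t‖ ≤ gronwallBound δ K ε τ := by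
  intro t ht
  have hsub : Icc 0 t ⊆ Ico 0 τ := fun s hs => ⟨hs.1, hs.2.trans_lt ht.2⟩
  have := norm_le_gronwallBound_of_norm_deriv_right_le (a := 0) (b := t) (δ := δ) (K := K) (ε := ε)
    (fun s hs => (hf s (hsub hs)).continuousAt.continuousWithinAt)
    (fun s hs => (hf s (hsub (Ico_subset_Icc_self hs))).hasDerivWithinAt) h0
    (fun s hs => h s (hsub (Ico_subset_Icc_self hs))) t ⟨ht.1, le_rfl⟩
  refine this.trans (gronwallBound_mono hδ hε hK ?_)
  linarith [ht.2]

namespace H1R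

/-- A family in `H¹` which is bounded in `L^∞` and in `L²`. -/
def IsBdd {ι : Type*} (u : ι → H1R) : Prop :=
  ∃ S k : ℝ, 0 ≤ k ∧ ∀ i, (∀ x, |rep (u i) x| ≤ S) ∧ ‖J (u i)‖ ≤ k

namespace IsBdd

variable {ι : Type*} {u v : ι → H1R}

theorem add (hu : IsBdd u) (hv : IsBdd v) : IsBdd (fun i => u i + v i) := by
  obtain ⟨S, k, hk, h⟩ := hu
  obtain ⟨S', k', hk', h'⟩ := hv
  refine ⟨S + S', k + k', by positivity, fun i => ⟨fun x => ?_, ?_⟩⟩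
  · rw [rep_add]
    exact (abs_add_le _ _).trans (add_le_add ((h i).1 x) ((h' i).1 x))
  · rw [map_add]
    exact (norm_add_le _ _).trans (add_le_add (h i).2 (h' i).2)

theorem smul (r : ℝ) (hu : IsBdd u) : IsBdd (fun i => r • u i) := by
  obtain ⟨S, k, hk, h⟩ := hu
  refine ⟨|r| * S, |r| * k, by positivity, fun i => ⟨fun x => ?_, ?_⟩⟩
  · rw [rep_smul, abs_mul]
    exact mul_le_mul_of_nonneg_left ((h i).1 x) (abs_nonneg _)
  · rw [map_smul, norm_smul, Real.norm_eq_abs]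
    exact mul_le_mul_of_nonneg_left (h i).2 (abs_nonneg _)

theorem sub (hu : IsBdd u) (hv : IsBdd v) : IsBdd (fun i => u i - v i) := by
  have := hu.add (hv.smul (-1))
  simpa [sub_eq_add_neg] using this

theorem mul {S : ℝ} (hu : ∀ i x, |rep (u i) x| ≤ S) (hv : IsBdd v) :
    IsBdd (fun i => H1R.mul (u i) (v i)) := by
  obtain ⟨S', k', hk', h'⟩ := hv
  refine ⟨|S| * S', |S| * k', by positivity, fun i => ⟨fun x => ?_, ?_⟩⟩
  · rw [rep_mul, abs_mul]
    exact mul_le_mul ((hu i x).trans (le_abs_self _)) ((h' i).1 x) (abs_nonneg _) (abs_nonneg _)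
  · rw [J_mul]
    exact (norm_mulL_le (fun x => (hu i x).trans (le_abs_self _)) _).trans
      (mul_le_mul_of_nonneg_left (h' i).2 (abs_nonneg S))

end IsBdd

end H1R

namespace TransportCoeff

open H1R LState

variable {p : TransportCoeff}

theorem isBdd_g {ι : Type*} {z : ι → H1R} (hz : IsBdd z) : IsBdd (fun i => p.g (z i)) := by
  obtain ⟨S, k, hk, h⟩ := id hz
  have hS := fun i x => (h i).1 x
  simp only [g_eq]
  have h2 := hz.mul hS
  have h3 := h2.mul hS
  exact (((hz.smul _).add (h2.smul _)).add (h3.smul _)).add ((h3.mul hS).smul _)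

theorem isTame_g {ι : Type*} {m : ι → ℝ} {z : ι → H1R} (hz : IsTame m z) :
    IsTame m (fun i => p.g (z i)) := by
  simp only [g_eq]
  have h2 := hz.mul hz
  have h3 := hz.mul h2
  exact (((hz.smul _).add (h2.smul _)).add (h3.smul _)).add ((hz.mul h3).smul _)

theorem isTame_g' {ι : Type*} {m : ι → ℝ} {z v : ι → H1R} (hz : IsTame m z) (hv : IsTame m v) :
    IsTame m (fun i => p.g' (z i) (v i)) := by
  simp only [g'_eq]
  have h2 := hz.mul hv
  have h3 := hz.mul h2
  exact (((hv.smul _).add (h2.smul _)).add (h3.smul _)).add ((hz.mul h3).smul _)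

theorem isBdd_f {ι : Type*} {X : ι → LState} {S : ℝ} (hρ : ∀ i x, |rep (X i).ρ x| ≤ S)
    (hz : IsBdd fun i => (X i).z) (hv : IsBdd fun i => (X i).v) : IsBdd (fun i => p.f (X i)) := by
  obtain ⟨S', k, hk, h⟩ := id hv
  have hS := fun i x => (h i).1 x
  simp only [f_eq]
  have h1 := (isBdd_g (p := p) hz).sub ((hv.mul hS).smul (p.a * p.κ / 2))
  exact h1.add (h1.mul hρ)

theorem isBdd_of_weighted {ι : Type*} {ρ u : ι → H1R} {S c C : ℝ} (hc : 0 < c)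
    (hρ : ∀ i x, c ≤ 1 + rep (ρ i) x) (hS : ∀ i x, |rep (u i) x| ≤ S)
    (hC : ∀ i, inner ℝ (J (u i) + mulL (ρ i) (J (u i))) (J (u i)) ≤ C) : IsBdd u := by
  refine ⟨S, √(C / c), Real.sqrt_nonneg _, fun i => ⟨hS i, ?_⟩⟩
  refine Real.le_sqrt_of_sq_le ?_
  rw [le_div_iff₀ hc]
  linarith [coercive (hρ i) (J (u i)), hC i]

/-- The H¹ norm of the solution needs only the L² norm of the source, so the family is bounded
outright; m ≥ 1 merely lets a constant be written as a multiple of m. -/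
theorem isTame_solve {ι : Type*} {m : ι → ℝ} (hm : ∀ i, 1 ≤ m i) {σ : ℝ} (hσ : σ ^ 2 = 1)
    {ρ f : ι → H1R} {c c' : ℝ} (hc : 0 < c) (hρ : ∀ i x, c ≤ 1 + rep (ρ i) x)
    (hρ' : ∀ i x, 1 + rep (ρ i) x ≤ c') (hf : IsBdd f) :
    IsTame m (fun i => solve σ p.l (ρ i) (J (f i))) := by
  obtain ⟨S, k, hk, h⟩ := hf
  rcases isEmpty_or_nonempty ι with hι | ⟨⟨i₀⟩⟩
  · exact ⟨0, 0, le_rfl, fun i => hι.elim i⟩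
  have hc' : 0 < c' := hc.trans_le ((hρ i₀ 0).trans (hρ' i₀ 0))
  have hl := p.l_pos
  have hb : ∀ i, ‖solve σ p.l (ρ i) (J (f i))‖ ≤ (p.l / c + (1 + c' / c)) * k := fun i => by
    refine (norm_le_firstOrder hσ hl hc (hρ i) (hρ' i) _).trans ?_
    rw [firstOrder_solve hσ hl hc (hρ i)]
    exact mul_le_mul_of_nonneg_left (h i).2 (by positivity)
  refine ⟨_, (p.l / c + (1 + c' / c)) * k, by positivity, fun i =>
    ⟨fun x => (abs_rep_le _ x).trans (hb i), (hb i).trans ?_⟩⟩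
  exact le_mul_of_one_le_right (by positivity) (hm i)

namespace LagrangianSolution

variable {τ : ℝ} {X : ℝ → LState} (h : p.LagrangianSolution τ X)
include h

/-- The lower bound costs nothing: the Riccati equation gives v_t ≥ -C, so v + Ct is nondecreasing
along each characteristic. -/
theorem exists_slope_bound {M : ℝ} (hτ : 0 < τ) (hM : ∀ t ∈ Ico 0 τ, ∀ x, rep (X t).v x ≤ M) :
    ∃ V ≥ 0, ∀ t ∈ Ico 0 τ, ∀ x, |rep (X t).v x| ≤ V := by
  obtain ⟨C, hC, hb⟩ := h.exists_energy_bound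
  refine ⟨|M| + ‖(X 0).v‖ + C * τ, by positivity, fun t ht x => abs_le.2 ⟨?_, ?_⟩⟩
  · have hmono := monotoneOn_of_hasDerivAt_nonneg
      (fun t ht => (h.hasDerivAt_rep_v ht x).add ((hasDerivAt_id t).const_mul C)) (fun t ht => by
        have h1 := (abs_le.1 (hb t ht x).2).1
        have h2 := mul_nonneg p.a_pos.le (sq_nonneg (rep (X t).v x))
        linarith)
    have := hmono ⟨le_rfl, hτ⟩ ht ht.1
    simp only [Pi.add_apply, id] at this
    have h3 := (abs_le.1 (abs_rep_le (X 0).v x)).1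
    have h4 := mul_le_mul_of_nonneg_left ht.2.le hC.le
    linarith [abs_nonneg M]
  · have := mul_nonneg hC.le hτ.le
    linarith [hM t ht x, le_abs_self M, norm_nonneg (X 0).v]

/-- Since q_t = -a v q and q = 1 initially, q·exp(aVt) increases and q·exp(-aVt) decreases. -/
theorem exists_jacobian_bound {V : ℝ} (hτ : 0 < τ) (hV0 : 0 ≤ V)
    (hV : ∀ t ∈ Ico 0 τ, ∀ x, |rep (X t).v x| ≤ V) :
    ∃ c > 0, ∃ c', ∀ t ∈ Ico 0 τ, ∀ x, c ≤ 1 + rep (X t).ρ x ∧ 1 + rep (X t).ρ x ≤ c' := by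
  have ha := p.a_pos
  have hexp : ∀ r t : ℝ, HasDerivAt (fun t => Real.exp (r * t)) (Real.exp (r * t) * r) t := fun r t => by
    simpa using ((hasDerivAt_id t).const_mul r).exp
  have h0 : ∀ x, 1 + rep (X 0).ρ x = 1 := fun x => by rw [h.ρ_zero]; simp
  refine ⟨Real.exp (-(p.a * V * τ)), Real.exp_pos _, Real.exp (p.a * V * τ), fun t ht x => ⟨?_, ?_⟩⟩
  · have hmono := monotoneOn_of_hasDerivAt_nonneg
      (fun t ht => (h.hasDerivAt_rep_ρ ht x).mul (hexp (p.a * V) t)) (fun t ht => by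
        have h1 := (abs_le.1 (hV t ht x)).2
        have h2 : 0 ≤ p.a * (V - rep (X t).v x) * ((1 + rep (X t).ρ x) * Real.exp (p.a * V * t)) :=
          mul_nonneg (mul_nonneg ha.le (by linarith))
            (mul_nonneg (h.ρ_pos ht x).le (Real.exp_pos _).le)
        linarith)
    have := hmono ⟨le_rfl, hτ⟩ ht ht.1
    simp only [Pi.mul_apply, h0, mul_zero, Real.exp_zero, mul_one] at this
    have h1 : Real.exp (p.a * V * t) ≤ Real.exp (p.a * V * τ) := by
      apply Real.exp_le_exp.2
      exact mul_le_mul_of_nonneg_left ht.2.le (by positivity)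
    rw [Real.exp_neg, inv_le_iff_one_le_mul₀ (Real.exp_pos _)]
    exact this.trans (mul_le_mul_of_nonneg_left h1 (h.ρ_pos ht x).le)
  · have hmono := monotoneOn_of_hasDerivAt_nonneg
      (fun t ht => ((h.hasDerivAt_rep_ρ ht x).mul (hexp (-(p.a * V)) t)).neg) (fun t ht => by
        have h1 := (abs_le.1 (hV t ht x)).1
        have h2 : 0 ≤ p.a * (V + rep (X t).v x) * ((1 + rep (X t).ρ x) * Real.exp (-(p.a * V) * t)) :=
          mul_nonneg (mul_nonneg ha.le (by linarith))
            (mul_nonneg (h.ρ_pos ht x).le (Real.exp_pos _).le)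
        linarith)
    have := hmono ⟨le_rfl, hτ⟩ ht ht.1
    simp only [Pi.mul_apply, Pi.neg_apply, h0, mul_zero, Real.exp_zero, neg_le_neg_iff,
      neg_mul, Real.exp_neg, inv_one, mul_one] at this
    rw [← div_eq_mul_inv, div_le_one (Real.exp_pos _)] at this
    refine this.trans (Real.exp_le_exp.2 ?_)
    exact mul_le_mul_of_nonneg_left ht.2.le (by positivity)

/-- If the slope is bounded above, the Lagrangian solution converges inside the domain. -/
theorem exists_tendsto {M : ℝ} (hτ : 0 < τ) (hM : ∀ t ∈ Ico 0 τ, ∀ x, rep (X t).v x ≤ M) :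
    ∃ X₁ ∈ Omega, Tendsto X (𝓝[<] τ) (𝓝 X₁) := by
  obtain ⟨C, hC, hb⟩ := h.exists_energy_bound
  obtain ⟨V, hV0, hV⟩ := h.exists_slope_bound hτ hM
  obtain ⟨c, hc, c', hcc⟩ := h.exists_jacobian_bound hτ hV0 hV
  have ha := p.a_pos
  have hκ := p.κ_pos
  set ι := {t // t ∈ Ico 0 τ}
  -- Tameness relative to 1 + ‖X‖ is linear growth; every component of the field is shown to be tame
  -- along the solution.
  set m : ι → ℝ := fun t => 1 + ‖X t‖ with hm
  have hm1 : ∀ i, 1 ≤ m i := fun i => by simp [hm]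
  have hS : ∀ (i : ι) x, |rep (X i).ρ x| ≤ 1 + c' := fun i x => by
    have := hcc i i.2 x
    rw [abs_le]; constructor <;> linarith
  have hle : ∀ (i : ι) (u : H1R), ‖u‖ ≤ ‖X i‖ → ‖u‖ ≤ 1 * m i := fun i u hu => by
    simp only [hm]; linarith
  have n2 : ∀ Z : LState, ‖Z.2‖ ≤ ‖Z‖ := fun Z => norm_snd_le Z
  have n3 : ∀ Z : LState, ‖Z.2.2‖ ≤ ‖Z‖ := fun Z => (norm_snd_le _).trans (n2 Z)
  have n4 : ∀ Z : LState, ‖Z.2.2.2‖ ≤ ‖Z‖ := fun Z => (norm_snd_le _).trans (n3 Z)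
  have tρ : IsTame m fun i : ι => (X i).ρ := ⟨1 + c', 1, zero_le_one, fun i =>
    ⟨hS i, hle i _ ((norm_fst_le _).trans (n2 _))⟩⟩
  have tz : IsTame m fun i : ι => (X i).z := ⟨C, 1, zero_le_one, fun i =>
    ⟨fun x => (hb i i.2 x).1, hle i _ ((norm_fst_le _).trans (n3 _))⟩⟩
  have tv : IsTame m fun i : ι => (X i).v := ⟨V, 1, zero_le_one, fun i =>
    ⟨fun x => hV i i.2 x, hle i _ ((norm_fst_le _).trans (n4 _))⟩⟩
  have hEz : ∀ i : ι, inner ℝ (J (X i).z + mulL (X i).ρ (J (X i).z)) (J (X i).z)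
      ≤ p.energy (X 0) := fun i => by
    rw [← h.energy_eq i i.2]
    exact le_add_of_nonneg_right (mul_nonneg hκ.le
      (weighted_nonneg (fun x => (h.ρ_pos i.2 x).le) _))
  have hEv : ∀ i : ι, inner ℝ (J (X i).v + mulL (X i).ρ (J (X i).v)) (J (X i).v)
      ≤ p.κ⁻¹ * p.energy (X 0) := fun i => by
    rw [← h.energy_eq i i.2, ← div_eq_inv_mul, le_div_iff₀ hκ, mul_comm]
    exact le_add_of_nonneg_left (weighted_nonneg (fun x => (h.ρ_pos i.2 x).le) _)
  -- Conserved weighted norms become plain L² bounds because q ≥ c.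
  have bz : IsBdd fun i : ι => (X i).z :=
    isBdd_of_weighted hc (fun i x => (hcc i i.2 x).1) (fun i x => (hb i i.2 x).1) hEz
  have bv : IsBdd fun i : ι => (X i).v :=
    isBdd_of_weighted hc (fun i x => (hcc i i.2 x).1) (fun i x => hV i i.2 x) hEv
  have bf : IsBdd fun i : ι => p.f (X i) := isBdd_f hS bz bv
  have t1 := isTame_solve (p := p) hm1 (σ := 1) (by norm_num) hc
    (fun (i : ι) x => (hcc i i.2 x).1) (fun i x => (hcc i i.2 x).2) bf
  have t2 := isTame_solve (p := p) hm1 (σ := -1) (by norm_num) hc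
    (fun (i : ι) x => (hcc i i.2 x).1) (fun i x => (hcc i i.2 x).2) bf
  have tR : IsTame m fun i : ι => p.R (X i) := by
    simp only [R_eq]; exact (t1.add t2).smul _
  have tP : IsTame m fun i : ι => p.P (X i) := by
    simp only [P_eq]; exact (t2.sub t1).smul _
  have tF := ((isTame_g' (p := p) tz tv).sub tP).smul p.κ⁻¹
  -- At each label w solves a linear equation with bounded coefficient 2av and bounded forcing, so a
  -- pointwise Gronwall estimate bounds it in sup norm before its H¹ norm is known to stay bounded.
  have tw : IsTame m fun i : ι => (X i).w := by
    obtain ⟨S, k, hk, hSk⟩ := tF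
    refine ⟨gronwallBound ‖(X 0).w‖ (2 * p.a * V) |S| τ, 1, zero_le_one, fun i =>
      ⟨fun x => ?_, hle i _ ((norm_snd_le _).trans (n4 _))⟩⟩
    refine norm_le_of_norm_deriv_le (f := fun t => rep (X t).w x) (by positivity)
      (abs_nonneg S) (norm_nonneg _)
      (fun t ht => h.hasDerivAt_rep_w ht x) (abs_rep_le _ x) (fun t ht => ?_) i i.2
    have h1 := (hSk ⟨t, ht⟩).1 x
    simp only [rep_smul, rep_sub] at h1
    rw [Real.norm_eq_abs, Real.norm_eq_abs]
    refine (abs_add_le _ _).trans (add_le_add ?_ (h1.trans (le_abs_self S)))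
    rw [abs_mul, abs_mul, abs_of_pos (by positivity : 0 < 2 * p.a)]
    have := hV t ht x
    gcongr
  have f1 := tz.smul (-p.a)
  have f2 := (tv.add (tρ.mul tv)).smul (-p.a)
  have f3 := tP.smul (-1)
  have f4 := ((tv.mul tv).smul (p.a / 2)).add (((isTame_g (p := p) tz).sub tR).smul p.κ⁻¹)
  have f5 := ((tv.mul tw).smul (2 * p.a)).add tF
  obtain ⟨_, k1, _, g1⟩ := f1
  obtain ⟨_, k2, _, g2⟩ := f2
  obtain ⟨_, k3, _, g3⟩ := f3
  obtain ⟨_, k4, _, g4⟩ := f4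
  obtain ⟨_, k5, _, g5⟩ := f5
  set K := max k1 (max k2 (max k3 (max k4 k5))) with hK
  have hfield : ∀ t ∈ Ico 0 τ, ‖p.field (X t)‖ ≤ |K| * (1 + ‖X t‖) := by
    intro t ht
    have hKa := le_abs_self K
    have hpos : 0 ≤ 1 + ‖X t‖ := by positivity
    have hup : ∀ k ≤ K, ∀ {u : H1R}, ‖u‖ ≤ k * m ⟨t, ht⟩ → ‖u‖ ≤ |K| * (1 + ‖X t‖) :=
      fun k hk u hu => hu.trans (mul_le_mul_of_nonneg_right (hk.trans hKa) hpos)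
    have e : p.field (X t) = ((p.field (X t)).Y, (p.field (X t)).ρ, (p.field (X t)).z,
      (p.field (X t)).v, (p.field (X t)).w) := rfl
    rw [e]
    simp only [norm_prod_le_iff]
    simp only [field_Y, field_ρ, field_z, field_v, field_w]
    refine ⟨hup k1 ?_ (g1 ⟨t, ht⟩).2, hup k2 ?_ (g2 ⟨t, ht⟩).2, hup k3 ?_ ?_,
      hup k4 ?_ (g4 ⟨t, ht⟩).2, hup k5 ?_ (g5 ⟨t, ht⟩).2⟩
    · exact le_max_left _ _
    · exact (le_max_left _ _).trans (le_max_right _ _)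
    · exact (le_max_left _ _).trans ((le_max_right _ _).trans (le_max_right _ _))
    · simpa using (g3 ⟨t, ht⟩).2
    · exact (le_max_left _ _).trans ((le_max_right _ _).trans
        ((le_max_right _ _).trans (le_max_right _ _)))
    · exact (le_max_right _ _).trans ((le_max_right _ _).trans
        ((le_max_right _ _).trans (le_max_right _ _)))
  have hbound := norm_le_of_norm_deriv_le (K := |K|) (ε := |K|) (abs_nonneg _) (abs_nonneg _)
    (norm_nonneg (X 0)) h.hasDerivAt le_rfl (fun t ht => by linarith [hfield t ht])
  obtain ⟨X₁, hX₁⟩ := exists_tendsto_of_norm_deriv_le hτ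
    (fun t ht => (h.hasDerivAt t ht).hasDerivWithinAt)
    (C := |K| * (1 + gronwallBound ‖X 0‖ |K| |K| τ)) (fun t ht => (hfield t ht).trans
      (mul_le_mul_of_nonneg_left (by linarith [hbound t ht]) (abs_nonneg _)))
  -- Evaluation at a point is continuous on H¹, so the uniform lower bound on the Jacobian survives
  -- in the limit.
  refine ⟨X₁, ⟨c, hc, fun x => ?_⟩, hX₁⟩
  have hev : Continuous (fun Z : LState => 1 + evalL x Z.ρ) := by fun_prop
  have h1 := (hev.tendsto X₁).comp hX₁
  simp only [evalL_apply] at h1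
  refine ge_of_tendsto h1 ?_
  filter_upwards [Ioo_mem_nhdsLT hτ] with t ht using (hcc t ⟨ht.1.le, ht.2⟩ x).1

end LagrangianSolution

end TransportCoeff

/-! ### The flow map, pull-back to Eulerian coordinates, and test functions -/

namespace H1R

/-- The characteristic map `ξ ↦ ξ - t + Y(ξ)`. -/
noncomputable def flowMap (t : ℝ) (Y : H1R) (ξ : ℝ) : ℝ := ξ - t + rep Y ξ

/-- The inverse of the characteristic map. -/
noncomputable def flowInv (t : ℝ) (Y : H1R) : ℝ → ℝ := Function.invFun (flowMap t Y)

/-- `ρ` is the derivative of `Y` and the characteristic map is a diffeomorphism. -/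
structure IsFlow (Y ρ : H1R) : Prop where
  D_eq : D Y = J ρ
  lower : ∃ c > 0, ∀ x, c ≤ 1 + rep ρ x

theorem hasDerivAt_rep {u v : H1R} (h : D u = J v) (x : ℝ) : HasDerivAt (rep u) (rep v x) x :=
  ((isPrimitive u).congr_right (h ▸ J_ae v)).hasDerivAt_of_continuous (continuous_rep v) x

@[fun_prop]
theorem continuous_flowMap (t : ℝ) (Y : H1R) : Continuous (flowMap t Y) := by
  unfold flowMap; fun_prop

theorem flowMap_surjective (t : ℝ) (Y : H1R) : Function.Surjective (flowMap t Y) := by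
  refine (continuous_flowMap t Y).surjective ?_ ?_
  · refine tendsto_atTop_mono (f := fun ξ => ξ + (- t - ‖Y‖)) (fun ξ => ?_)
      (tendsto_atTop_add_const_right _ _ tendsto_id)
    have := (abs_le.1 (abs_rep_le Y ξ)).1
    simp only [flowMap]; linarith
  · refine tendsto_atBot_mono (g := flowMap t Y) (f := fun ξ => ξ + (- t + ‖Y‖)) (fun ξ => ?_)
      (tendsto_atBot_add_const_right _ _ tendsto_id)
    have := (abs_le.1 (abs_rep_le Y ξ)).2
    simp only [flowMap]; linarith

theorem flowMap_flowInv (t : ℝ) (Y : H1R) (x : ℝ) : flowMap t Y (flowInv t Y x) = x :=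
  Function.rightInverse_invFun (flowMap_surjective t Y) x

/-- The pull-back `f ↦ f ∘ y⁻¹` on `L²` along the inverse of the characteristic map. -/
noncomputable def pull (t : ℝ) (Y : H1R) (f : L2R) : L2R :=
  open Classical in
  if h : MemLp (fun x => f (flowInv t Y x)) 2 volume then h.toLp else 0

namespace IsFlow

variable {t : ℝ} {Y ρ : H1R} (h : IsFlow Y ρ)
include h

theorem pos (x : ℝ) : 0 < 1 + rep ρ x := by
  obtain ⟨c, hc, hl⟩ := h.lower
  exact hc.trans_le (hl x)

theorem hasDerivAt (ξ : ℝ) : HasDerivAt (flowMap t Y) (1 + rep ρ ξ) ξ :=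
  ((hasDerivAt_id ξ).sub_const t).add (hasDerivAt_rep h.D_eq ξ)

theorem strictMono : StrictMono (flowMap t Y) :=
  strictMono_of_hasDerivAt_pos h.hasDerivAt h.pos

theorem flowInv_flowMap (ξ : ℝ) : flowInv t Y (flowMap t Y ξ) = ξ :=
  Function.leftInverse_invFun (h.strictMono (t := t)).injective ξ

theorem exists_homeomorph : ∃ e : ℝ ≃ₜ ℝ, ⇑e = flowMap t Y ∧ ⇑e.symm = flowInv t Y := by
  refine ⟨(StrictMono.orderIsoOfSurjective _ (h.strictMono (t := t)) (flowMap_surjective t Y)).toHomeomorph,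
    rfl, funext fun x => ?_⟩
  apply (h.strictMono (t := t)).injective
  rw [flowMap_flowInv]
  exact StrictMono.orderIsoOfSurjective_self_symm_apply _ (h.strictMono (t := t)) (flowMap_surjective t Y) x

theorem continuous_flowInv : Continuous (flowInv t Y) := by
  obtain ⟨e, -, he⟩ := h.exists_homeomorph (t := t)
  exact he ▸ e.symm.continuous

theorem integral_comp (g : ℝ → ℝ) :
    ∫ x, g x = ∫ ξ, (1 + rep ρ ξ) * g (flowMap t Y ξ) := by
  have := integral_image_eq_integral_abs_deriv_smul (s := univ) MeasurableSet.univ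
    (fun x _ => (h.hasDerivAt (t := t) x).hasDerivWithinAt) (h.strictMono (t := t)).injective.injOn g
  rw [image_univ, (flowMap_surjective t Y).range_eq, setIntegral_univ, setIntegral_univ] at this
  rw [this]
  congr 1; ext ξ
  rw [abs_of_pos (h.pos ξ), smul_eq_mul]

theorem integrable_comp_iff (g : ℝ → ℝ) :
    Integrable g ↔ Integrable fun ξ => (1 + rep ρ ξ) * g (flowMap t Y ξ) := by
  have := integrableOn_image_iff_integrableOn_abs_deriv_smul (s := univ) MeasurableSet.univ
    (fun x _ => (h.hasDerivAt (t := t) x).hasDerivWithinAt) (h.strictMono (t := t)).injective.injOn g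
  rw [image_univ, (flowMap_surjective t Y).range_eq, integrableOn_univ, integrableOn_univ] at this
  rw [this]
  simp only [abs_of_pos (h.pos _), smul_eq_mul]

theorem ae_flowInv {P : ℝ → Prop} (hP : ∀ᵐ ξ, P ξ) : ∀ᵐ x, P (flowInv t Y x) := by
  rw [ae_iff] at hP ⊢
  have : {x | ¬ P (flowInv t Y x)} = flowMap t Y '' {ξ | ¬ P ξ} := by
    ext x
    constructor
    · exact fun hx => ⟨flowInv t Y x, hx, flowMap_flowInv t Y x⟩
    · rintro ⟨ξ, hξ, rfl⟩
      change ¬ P (flowInv t Y (flowMap t Y ξ))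
      rwa [h.flowInv_flowMap]
  rw [this]
  exact addHaar_image_eq_zero_of_differentiableOn_of_addHaar_eq_zero volume
    (fun x _ => (h.hasDerivAt x).differentiableAt.differentiableWithinAt) hP

theorem memLp_comp (f : L2R) : MemLp (fun x => f (flowInv t Y x)) 2 volume := by
  have hm : StronglyMeasurable (fun x => f (flowInv t Y x)) :=
    (Lp.stronglyMeasurable f).comp_measurable h.continuous_flowInv.measurable
  rw [memLp_two_iff_integrable_sq hm.aestronglyMeasurable, h.integrable_comp_iff (t := t)]
  simp only [h.flowInv_flowMap, sq]
  exact integrable_weight ρ f f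

theorem pull_ae (f : L2R) : pull t Y f =ᵐ[volume] fun x => f (flowInv t Y x) := by
  rw [pull, dif_pos (h.memLp_comp f)]
  exact (h.memLp_comp f).coeFn_toLp

theorem integral_pull_mul (f : L2R) (g : ℝ → ℝ) :
    ∫ x, pull t Y f x * g x = ∫ ξ, (1 + rep ρ ξ) * (f ξ * g (flowMap t Y ξ)) := by
  rw [integral_congr_ae (g := fun x => f (flowInv t Y x) * g x)
    ((h.pull_ae (t := t) f).mono fun x hx => by simp only [hx]), h.integral_comp (t := t)]
  simp only [h.flowInv_flowMap]

theorem norm_pull_sq (f : L2R) : ‖pull t Y f‖ ^ 2 = inner ℝ (f + mulL ρ f) f := by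
  rw [← integral_sq, integral_weight, integral_congr_ae (g := fun x => f (flowInv t Y x) ^ 2)
    ((h.pull_ae (t := t) f).mono fun x hx => by simp only [hx]), h.integral_comp (t := t)]
  simp only [h.flowInv_flowMap, sq]

theorem integral_deriv_comp {u : H1R} {φ : ℝ → ℝ} (hφ : ContDiff ℝ ∞ φ) (hc : HasCompactSupport φ) :
    ∫ ξ, rep u ξ * (deriv φ (flowMap t Y ξ) * (1 + rep ρ ξ)) = - ∫ ξ, D u ξ * φ (flowMap t Y ξ) := by
  have hd : ∀ ξ, HasDerivAt (fun ξ => φ (flowMap t Y ξ)) (deriv φ (flowMap t Y ξ) * (1 + rep ρ ξ)) ξ :=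
    fun ξ => (hφ.differentiable (by simp) _).hasDerivAt.comp ξ (h.hasDerivAt ξ)
  have hcd : Continuous (deriv φ) := hφ.continuous_deriv (by simp)
  obtain ⟨e, he, -⟩ := h.exists_homeomorph (t := t)
  refine (isPrimitive u).integral_mul_deriv hd (by fun_prop) ?_
  have := hc.comp_homeomorph e
  rwa [he] at this

/-- The chain rule for the pull-back. -/
theorem isWeakDeriv_pull {u : H1R} {s : L2R} (hs : D u = s + mulL ρ s) :
    IsWeakDeriv (pull t Y (J u)) (pull t Y s) := by
  intro φ hφ hc
  rw [h.integral_pull_mul, h.integral_pull_mul]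
  have h1 := h.integral_deriv_comp (t := t) (u := u) hφ hc
  calc _ = ∫ ξ, rep u ξ * (deriv φ (flowMap t Y ξ) * (1 + rep ρ ξ)) := by
        refine integral_congr_ae ((J_ae u).mono fun ξ hξ => ?_)
        simp only [hξ]; ring
    _ = - ∫ ξ, D u ξ * φ (flowMap t Y ξ) := h1
    _ = _ := by
        congr 1
        refine integral_congr_ae ?_
        filter_upwards [Lp.coeFn_add s (mulL ρ s), mulL_ae ρ s] with ξ a b
        rw [hs, a, Pi.add_apply, b]; ring

end IsFlow

/-- The test functions as a subspace of `L²`. -/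
def testSubmodule : Submodule ℝ L2R where
  carrier := {f | ∃ φ : ℝ → ℝ, ContDiff ℝ ∞ φ ∧ HasCompactSupport φ ∧ f =ᵐ[volume] φ}
  zero_mem' := ⟨0, contDiff_const, HasCompactSupport.zero, Lp.coeFn_zero _ _ _⟩
  add_mem' := by
    rintro f g ⟨φ, h1, h2, h3⟩ ⟨ψ, h4, h5, h6⟩
    exact ⟨φ + ψ, h1.add h4, h2.add h5, (Lp.coeFn_add f g).trans (h3.add h6)⟩
  smul_mem' := by
    rintro c f ⟨φ, h1, h2, h3⟩
    refine ⟨fun x => c * φ x, contDiff_const.mul h1, h2.mul_left, ?_⟩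
    filter_upwards [Lp.coeFn_smul c f, h3] with x a b
    rw [a, Pi.smul_apply, b, smul_eq_mul]

theorem dense_test : Dense (testSubmodule : Set L2R) := by
  rw [Submodule.dense_iff_topologicalClosure_eq_top, Submodule.topologicalClosure_eq_top_iff,
    Submodule.eq_bot_iff]
  intro u hu
  have := ae_eq_zero_of_integral_contDiff_smul_eq_zero (Lp_locallyIntegrable u) (fun φ hφ hc => by
    have hm : MemLp φ 2 volume := hφ.continuous.memLp_of_hasCompactSupport hc
    have h0 := (Submodule.mem_orthogonal _ _).1 hu (hm.toLp φ) ⟨φ, hφ, hc, hm.coeFn_toLp⟩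
    rw [inner_eq] at h0
    rw [← h0]
    exact integral_congr_ae (hm.coeFn_toLp.mono fun x hx => by simp only [hx, smul_eq_mul]))
  exact Lp.ext ((show u =ᵐ[volume] 0 from this).trans (Lp.coeFn_zero _ _ _).symm)

/-- The `L²` norm can be estimated by testing. -/
theorem norm_le_of_forall_test {G : L2R} {C : ℝ}
    (h : ∀ f ∈ testSubmodule, |inner ℝ G f| ≤ C * ‖f‖) : ‖G‖ ≤ C := by
  have hcl : IsClosed {f : L2R | |inner ℝ G f| ≤ C * ‖f‖} :=
    isClosed_le (by fun_prop) (by fun_prop)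
  have hall : ∀ f : L2R, |inner ℝ G f| ≤ C * ‖f‖ := fun f =>
    (dense_test.closure_eq ▸ hcl.closure_subset_iff.2 (fun f hf => h f hf)) (mem_univ f)
  have h1 := hall G
  rw [real_inner_self_eq_norm_sq, abs_of_nonneg (sq_nonneg _)] at h1
  by_cases h0 : ‖G‖ = 0
  -- For G = 0 the claim is 0 ≤ C, which needs some nonzero element of L² to test with.
  · by_contra hC
    push Not at hC
    have hC0 : C < 0 := by rwa [h0] at hC
    obtain ⟨φ, hφ⟩ : ∃ f : L2R, f ≠ 0 := by
      let η : ContDiffBump (0:ℝ) := ⟨1, 2, by norm_num, by norm_num⟩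
      obtain ⟨u, hu, -, -⟩ := exists_test η η.contDiff η.hasCompactSupport
      refine ⟨J u, fun hJ => ?_⟩
      have : u = 0 := J_injective (hJ.trans (map_zero J).symm)
      have h1 : η 0 = 0 := by rw [← hu, this, rep_zero]
      have h2 : η 0 = 1 := η.one_of_mem_closedBall (by simp [η])
      linarith
    have := hall φ
    nlinarith [abs_nonneg (inner ℝ G φ), norm_pos_iff.2 hφ]
  · have hpos : 0 < ‖G‖ := lt_of_le_of_ne (norm_nonneg _) (Ne.symm h0)
    nlinarith

theorem abs_taylor_le {φ : ℝ → ℝ} (hφ : ContDiff ℝ ∞ φ) {L : ℝ} (hL : ∀ x, |deriv (deriv φ) x| ≤ L)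
    (a b : ℝ) : |φ b - φ a - deriv φ a * (b - a)| ≤ L * (b - a) ^ 2 := by
  have hd : Differentiable ℝ φ := hφ.differentiable (by simp)
  have hd' : Differentiable ℝ (deriv φ) := (contDiff_infty_iff_deriv.1 hφ).2.differentiable (by simp)
  have hL0 : 0 ≤ L := (abs_nonneg _).trans (hL 0)
  have hlip : ∀ x, |deriv φ x - deriv φ a| ≤ L * |x - a| := fun x =>
    convex_univ.norm_image_sub_le_of_norm_deriv_le (fun y _ => hd' y) (fun y _ => hL y)
      (mem_univ a) (mem_univ x)
  have h1 := (convex_uIcc a b).norm_image_sub_le_of_norm_hasDerivWithin_le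
    (f := fun x => φ x - deriv φ a * x) (f' := fun x => deriv φ x - deriv φ a) (C := L * |b - a|)
    (fun x _ => (((hd x).hasDerivAt.sub ((hasDerivAt_id x).const_mul (deriv φ a))).congr_deriv
      (by simp)).hasDerivWithinAt)
    (fun x hx => (hlip x).trans (mul_le_mul_of_nonneg_left (abs_sub_left_of_mem_uIcc hx) hL0))
    left_mem_uIcc right_mem_uIcc
  calc _ = ‖φ b - deriv φ a * b - (φ a - deriv φ a * a)‖ := by rw [Real.norm_eq_abs]; congr 1; ring
    _ ≤ _ := h1
    _ = _ := by rw [Real.norm_eq_abs, mul_assoc, ← abs_mul, ← sq, abs_of_nonneg (sq_nonneg _)]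

theorem exists_abs_le_of_hasCompactSupport {φ : ℝ → ℝ} (hφ : Continuous φ)
    (hc : HasCompactSupport φ) : ∃ L, ∀ x, |φ x| ≤ L := by
  obtain ⟨L, hL⟩ := hc.exists_bound_of_continuous hφ
  exact ⟨L, hL⟩

theorem abs_flowMap_sub_le (t : ℝ) (Y : H1R) (ξ : ℝ) : |flowMap t Y ξ - ξ| ≤ |t| + ‖Y‖ := by
  have : flowMap t Y ξ - ξ = -t + rep Y ξ := by unfold flowMap; ring
  rw [this]
  refine (abs_add_le _ _).trans (add_le_add (abs_neg t).le (abs_rep_le Y ξ))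

theorem exists_zero_outside {φ : ℝ → ℝ} (hc : HasCompactSupport φ) :
    ∃ r, ∀ t Y ξ, r + |t| + ‖Y‖ < |ξ| → φ (flowMap t Y ξ) = 0 := by
  obtain ⟨r, hr⟩ := hc.isCompact.isBounded.subset_closedBall 0
  refine ⟨r, fun t Y ξ h => ?_⟩
  by_contra hne
  have h1 := hr (subset_tsupport _ hne)
  rw [mem_closedBall_zero_iff, Real.norm_eq_abs] at h1
  have h2 := abs_flowMap_sub_le t Y ξ
  have h3 := abs_sub_abs_le_abs_sub ξ (flowMap t Y ξ)
  rw [abs_sub_comm] at h3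
  linarith

theorem memLp_test_comp {φ : ℝ → ℝ} (hφ : Continuous φ) (hc : HasCompactSupport φ) (t : ℝ) (Y : H1R) :
    MemLp (fun ξ => φ (flowMap t Y ξ)) 2 volume := by
  obtain ⟨r, hr⟩ := exists_zero_outside hc
  refine Continuous.memLp_of_hasCompactSupport (by fun_prop) ?_
  refine HasCompactSupport.of_support_subset_isCompact
    (isCompact_Icc (a := -(r + |t| + ‖Y‖)) (b := r + |t| + ‖Y‖)) fun ξ hξ => ?_
  have := not_lt.1 (mt (hr t Y ξ) hξ)
  exact abs_le.1 this

/-- Composition of a test function with the characteristic map, as an element of `L²`. -/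
noncomputable def testComp {φ : ℝ → ℝ} (hφ : Continuous φ) (hc : HasCompactSupport φ) (t : ℝ)
    (Y : H1R) : L2R :=
  (memLp_test_comp hφ hc t Y).toLp _

theorem testComp_ae {φ : ℝ → ℝ} (hφ : Continuous φ) (hc : HasCompactSupport φ) (t : ℝ) (Y : H1R) :
    testComp hφ hc t Y =ᵐ[volume] fun ξ => φ (flowMap t Y ξ) :=
  (memLp_test_comp hφ hc t Y).coeFn_toLp

/-- Differentiating f∘y⁻¹ in time directly would cost a derivative of f. Moving the flow onto a test
function avoids this: φ∘y is differentiable in L² because its Taylor remainder is quadratically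
small on a fixed compact interval and zero outside. -/
theorem hasDerivAt_testComp {φ : ℝ → ℝ} (hφ : ContDiff ℝ ∞ φ) (hc : HasCompactSupport φ)
    (hφ' : Continuous (deriv φ)) {Y : ℝ → H1R} {Y' : H1R} {t₀ : ℝ} (hY : HasDerivAt Y Y' t₀) :
    HasDerivAt (fun t => testComp hφ.continuous hc t (Y t))
      (mulL Y' (testComp hφ' hc.deriv t₀ (Y t₀)) - testComp hφ' hc.deriv t₀ (Y t₀)) t₀ := by
  obtain ⟨r, hr⟩ := exists_zero_outside hc
  obtain ⟨r', hr'⟩ := exists_zero_outside hc.deriv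
  obtain ⟨L₁, hL₁⟩ := exists_abs_le_of_hasCompactSupport hφ' hc.deriv
  have hφ2 := (contDiff_infty_iff_deriv.1 hφ).2
  obtain ⟨L₂, hL₂⟩ := exists_abs_le_of_hasCompactSupport
    (hφ2.continuous_deriv (by simp)) hc.deriv.deriv
  have hL1 : 0 ≤ L₁ := (abs_nonneg _).trans (hL₁ 0)
  have hL2 : 0 ≤ L₂ := (abs_nonneg _).trans (hL₂ 0)
  -- Outside [-N, N] the compositions of φ at t and t₀, and of φ' at t₀, all vanish once t and Y t
  -- are within 1 of t₀ and Y t₀.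
  set N := max r r' + (|t₀| + 1) + (‖Y t₀‖ + 1) with hN
  set g : L2R := indicatorConstLp 2 (measurableSet_Icc (a := -N) (b := N)) (by simp) (1:ℝ) with hg
  have hgae : g =ᵐ[volume] (Icc (-N) N).indicator fun _ => (1:ℝ) := indicatorConstLp_coeFn
  set δ : ℝ → ℝ := fun t => |t - t₀| + ‖Y t - Y t₀‖ with hδ
  set η : ℝ → ℝ := fun t => ‖Y t - Y t₀ - (t - t₀) • Y'‖ with hη
  have hη' : η =o[𝓝 t₀] fun t => t - t₀ := by
    rw [hη, Asymptotics.isLittleO_norm_left]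
    exact hasDerivAt_iff_isLittleO.1 hY
  have hδ1 : δ =O[𝓝 t₀] fun t => t - t₀ :=
    (Asymptotics.isBigO_refl _ _).abs_left.add hY.isBigO_sub.norm_left
  have hδ0 : Tendsto δ (𝓝 t₀) (𝓝 0) := hδ1.trans_tendsto (by
    have : Tendsto (fun t => t - t₀) (𝓝 t₀) (𝓝 (t₀ - t₀)) := tendsto_id.sub_const t₀
    rwa [sub_self] at this)
  have hB : (fun t => (L₂ * δ t ^ 2 + L₁ * η t) * ‖g‖) =o[𝓝 t₀] fun t => t - t₀ := by
    have h1 : (fun t => δ t ^ 2) =o[𝓝 t₀] fun t => t - t₀ := by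
      have : (fun t => δ t * δ t) =o[𝓝 t₀] fun t => 1 * (t - t₀) :=
        ((Asymptotics.isLittleO_one_iff ℝ).2 hδ0).mul_isBigO hδ1
      simpa [sq] using this
    have := ((h1.const_mul_left L₂).add (hη'.const_mul_left L₁)).const_mul_left ‖g‖
    simpa only [mul_comm ‖g‖] using this
  rw [hasDerivAt_iff_isLittleO]
  refine Asymptotics.IsBigO.trans_isLittleO (Asymptotics.IsBigO.of_bound 1 ?_) hB
  have hev : ∀ᶠ t in 𝓝 t₀, δ t < 1 := hδ0.eventually (gt_mem_nhds one_pos)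
  filter_upwards [hev] with t ht
  have hδt : 0 ≤ δ t := by positivity
  have hηt : 0 ≤ η t := norm_nonneg _
  rw [one_mul, Real.norm_eq_abs, abs_of_nonneg (by positivity : 0 ≤ (L₂ * δ t ^ 2 + L₁ * η t) * ‖g‖)]
  refine norm_le_of_ae ?_
  set F0 := testComp hφ.continuous hc t₀ (Y t₀)
  set F1 := testComp hφ.continuous hc t (Y t)
  set F2 := testComp hφ' hc.deriv t₀ (Y t₀)
  filter_upwards [hgae, testComp_ae hφ.continuous hc t₀ (Y t₀), testComp_ae hφ.continuous hc t (Y t),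
    testComp_ae hφ' hc.deriv t₀ (Y t₀), mulL_ae Y' F2, Lp.coeFn_sub (mulL Y' F2) F2,
    Lp.coeFn_smul (t - t₀) (mulL Y' F2 - F2), Lp.coeFn_sub F1 F0,
    Lp.coeFn_sub (F1 - F0) ((t - t₀) • (mulL Y' F2 - F2))] with ξ a1 a2 a3 a4 a5 a6 a7 a8 a9
  rw [a9, Pi.sub_apply, a8, a7, Pi.sub_apply, Pi.smul_apply, a6, Pi.sub_apply, a5, a1, a2, a3, a4,
    smul_eq_mul]
  have b1 := abs_rep_le (Y t - Y t₀) ξ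
  rw [rep_sub] at b1
  by_cases hξ : ξ ∈ Icc (-N) N
  · rw [indicator_of_mem hξ, abs_one, mul_one]
    set y := flowMap t (Y t) ξ with hy
    set y₀ := flowMap t₀ (Y t₀) ξ with hy₀
    have b2 := abs_taylor_le hφ hL₂ y₀ y
    have b3 := abs_rep_le (Y t - Y t₀ - (t - t₀) • Y') ξ
    simp only [rep_sub, rep_smul] at b3
    have b4 : y - y₀ = -(t - t₀) + (rep (Y t) ξ - rep (Y t₀) ξ) := by
      simp only [hy, hy₀, flowMap]; ring
    have b5 : |y - y₀| ≤ δ t := by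
      rw [b4]
      exact (abs_add_le _ _).trans (add_le_add (abs_neg _).le b1)
    have b6 : (y - y₀) ^ 2 ≤ δ t ^ 2 := by
      rw [← sq_abs]; exact pow_le_pow_left₀ (abs_nonneg _) b5 2
    have b7 : φ y - φ y₀ - (t - t₀) * (rep Y' ξ * deriv φ y₀ - deriv φ y₀)
        = (φ y - φ y₀ - deriv φ y₀ * (y - y₀))
          + deriv φ y₀ * (rep (Y t) ξ - rep (Y t₀) ξ - (t - t₀) * rep Y' ξ) := by
      rw [b4]; ring
    rw [b7]
    refine (abs_add_le _ _).trans (add_le_add (b2.trans (mul_le_mul_of_nonneg_left b6 hL2)) ?_)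
    rw [abs_mul]
    exact mul_le_mul (hL₁ _) b3 (abs_nonneg _) hL1
  · rw [indicator_of_notMem hξ, abs_zero, mul_zero]
    have hξN : N < |ξ| := by
      by_contra h; exact hξ (abs_le.1 (not_lt.1 h))
    have c1 : |t| ≤ |t₀| + 1 := by
      have : |t - t₀| ≤ δ t := by simp only [hδ]; linarith [norm_nonneg (Y t - Y t₀)]
      linarith [abs_sub_abs_le_abs_sub t t₀]
    have c2 : ‖Y t‖ ≤ ‖Y t₀‖ + 1 := by
      have : ‖Y t - Y t₀‖ ≤ δ t := by simp only [hδ]; linarith [abs_nonneg (t - t₀)]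
      linarith [norm_sub_norm_le (Y t) (Y t₀)]
    rw [hr t (Y t) ξ (by linarith [le_max_left r r']), hr t₀ (Y t₀) ξ (by linarith [le_max_left r r']),
      hr' t₀ (Y t₀) ξ (by linarith [le_max_right r r'])]
    simp

end H1R

/-! ### Division by the Jacobian, and strong limits and derivatives from tested ones -/

namespace H1R

/-- Division by `1 + ρ` on `L²`. -/
noncomputable def divL (ρ : H1R) : L2R →L[ℝ] L2R :=
  Ring.inverse (ContinuousLinearMap.id ℝ L2R + mulL ρ)

theorem isUnit_weight {ρ : H1R} (h : ∃ c > 0, ∀ x, c ≤ 1 + rep ρ x) :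
    IsUnit (ContinuousLinearMap.id ℝ L2R + mulL ρ) := by
  obtain ⟨c, hc, hl⟩ := h
  have hpos : ∀ x, 0 < 1 + rep ρ x := fun x => hc.trans_le (hl x)
  rw [ContinuousLinearMap.isUnit_iff_bijective]
  refine ⟨(injective_iff_map_eq_zero _).2 fun f hf => ?_, fun f => ?_⟩
  · have h1 := coercive hl f
    have h2 : f + mulL ρ f = 0 := hf
    rw [h2, inner_zero_left] at h1
    have : ‖f‖ ^ 2 = 0 := le_antisymm (by nlinarith [sq_nonneg ‖f‖]) (sq_nonneg _)
    exact norm_eq_zero.1 (pow_eq_zero_iff two_ne_zero |>.1 this)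
  · have hm : MemLp (fun x => f x / (1 + rep ρ x)) 2 volume := by
      refine MemLp.of_le_mul (c := c⁻¹) (Lp.memLp f) ?_ (ae_of_all _ fun x => ?_)
      · exact (Lp.stronglyMeasurable f).aestronglyMeasurable.div₀ (continuous_const.add
          (continuous_rep ρ)).aestronglyMeasurable
      · rw [norm_div, Real.norm_of_nonneg (hpos x).le, div_eq_inv_mul]
        exact mul_le_mul_of_nonneg_right (inv_anti₀ hc (hl x)) (norm_nonneg _)
    refine ⟨hm.toLp, Lp.ext ?_⟩
    filter_upwards [hm.coeFn_toLp, Lp.coeFn_add hm.toLp (mulL ρ hm.toLp), mulL_ae ρ hm.toLp]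
      with x a b d
    change (hm.toLp + mulL ρ hm.toLp) x = f x
    rw [b, Pi.add_apply, d, a]
    field_simp [(hpos x).ne']

theorem divL_add_mulL {ρ : H1R} (h : ∃ c > 0, ∀ x, c ≤ 1 + rep ρ x) (f : L2R) :
    divL ρ f + mulL ρ (divL ρ f) = f := by
  have := Ring.mul_inverse_cancel _ (isUnit_weight h)
  exact DFunLike.congr_fun this f

/-- Inversion in a Banach algebra is continuous at units, so division by 1 + ρ is continuous in
operator norm with respect to ρ. -/
theorem continuousAt_divL {ρ : H1R} (h : ∃ c > 0, ∀ x, c ≤ 1 + rep ρ x) :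
    ContinuousAt divL ρ := by
  obtain ⟨u, hu⟩ := isUnit_weight h
  have h1 : ContinuousAt (Ring.inverse : (L2R →L[ℝ] L2R) → _)
      (ContinuousLinearMap.id ℝ L2R + mulL ρ) := by
    rw [← hu]; exact NormedRing.inverse_continuousAt u
  exact ContinuousAt.comp (f := fun ρ => ContinuousLinearMap.id ℝ L2R + mulL ρ) h1 (by fun_prop)

/-- In a Hilbert space, convergence of norms together with weak convergence on a dense set is strong
convergence. -/
theorem tendsto_of_tendsto_inner {ι : Type*} {l : Filter ι} {F : ι → L2R} {F₀ : L2R}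
    (hn : Tendsto (fun i => ‖F i‖ ^ 2) l (𝓝 (‖F₀‖ ^ 2)))
    (h : ∀ ψ ∈ testSubmodule, Tendsto (fun i => inner ℝ (F i) ψ) l (𝓝 (inner ℝ F₀ ψ))) :
    Tendsto F l (𝓝 F₀) := by
  rw [Metric.tendsto_nhds]
  intro ε hε
  obtain ⟨ψ, hd, hψ⟩ := Metric.dense_iff.1 dense_test F₀ (ε / 2) (half_pos hε)
  have h1 : Tendsto (fun i => ‖F i - ψ‖ ^ 2) l (𝓝 (‖F₀ - ψ‖ ^ 2)) := by
    simp only [norm_sub_sq_real]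
    exact (hn.sub ((h ψ hψ).const_mul 2)).add_const _
  have h2 : ‖F₀ - ψ‖ < ε / 2 := by rwa [← dist_eq_norm, dist_comm]
  filter_upwards [h1.eventually (gt_mem_nhds (pow_lt_pow_left₀ h2 (norm_nonneg _) two_ne_zero))]
    with i hi
  have h3 := lt_of_pow_lt_pow_left₀ 2 (half_pos hε).le hi
  rw [dist_eq_norm]
  calc ‖F i - F₀‖ = ‖(F i - ψ) - (F₀ - ψ)‖ := by congr 1; abel
    _ ≤ _ := norm_sub_le _ _
    _ < ε := by linarith

/-- The mean value inequality for the tested function has an error at most ε‖ψ‖|t - t₀|, with ε from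
the L² continuity of the candidate derivative. It is uniform in ψ, so duality gives the strong
derivative. -/
theorem hasDerivWithinAt_of_inner {S : Set ℝ} (hS : Convex ℝ S) {F H : ℝ → L2R} {t₀ : ℝ}
    (ht₀ : t₀ ∈ S) (hH : ContinuousWithinAt H S t₀)
    (h : ∀ ψ ∈ testSubmodule, ∀ t ∈ S,
      HasDerivWithinAt (fun t => inner ℝ (F t) ψ) (inner ℝ (H t) ψ) S t) :
    HasDerivWithinAt F (H t₀) S t₀ := by
  rw [hasDerivWithinAt_iff_isLittleO, Asymptotics.isLittleO_iff]
  intro ε hε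
  obtain ⟨δ, hδ, hd⟩ := Metric.continuousWithinAt_iff.1 hH ε hε
  filter_upwards [inter_mem_nhdsWithin S (Metric.ball_mem_nhds t₀ hδ)] with t ht
  refine norm_le_of_forall_test fun ψ hψ => ?_
  have hder : ∀ s ∈ S ∩ Metric.ball t₀ δ,
      HasDerivWithinAt (fun s => inner ℝ (F s) ψ - s * inner ℝ (H t₀) ψ)
        (inner ℝ (H s) ψ - 1 * inner ℝ (H t₀) ψ) (S ∩ Metric.ball t₀ δ) s := fun s hs =>
    ((h ψ hψ s hs.1).mono inter_subset_left).sub ((hasDerivWithinAt_id s _).mul_const _)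
  have h1 := (hS.inter (convex_ball t₀ δ)).norm_image_sub_le_of_norm_hasDerivWithin_le hder
    (C := ε * ‖ψ‖) (fun s hs => by
      rw [one_mul, ← inner_sub_left]
      refine (norm_inner_le_norm _ _).trans (mul_le_mul_of_nonneg_right ?_ (norm_nonneg _))
      rw [← dist_eq_norm]
      exact (hd hs.1 hs.2).le) ⟨ht₀, Metric.mem_ball_self hδ⟩ ht
  calc _ = ‖inner ℝ (F t) ψ - t * inner ℝ (H t₀) ψ - (inner ℝ (F t₀) ψ - t₀ * inner ℝ (H t₀) ψ)‖ := by
        rw [inner_sub_left, inner_sub_left, real_inner_smul_left, Real.norm_eq_abs]; congr 1; ring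
    _ ≤ _ := h1
    _ = _ := by ring

theorem inner_eq_integral_mul {f ψ : L2R} {φ : ℝ → ℝ} (h : ψ =ᵐ[volume] φ) :
    inner ℝ f ψ = ∫ x, f x * φ x := by
  rw [inner_eq]
  exact integral_congr_ae (h.mono fun x hx => by simp only [hx])

theorem IsFlow.inner_pull {t : ℝ} {Y ρ : H1R} (h : IsFlow Y ρ) {φ : ℝ → ℝ} (hφ : Continuous φ)
    (hc : HasCompactSupport φ) {ψ : L2R} (hψ : ψ =ᵐ[volume] φ) (f : L2R) :
    inner ℝ (pull t Y f) ψ = inner ℝ (f + mulL ρ f) (testComp hφ hc t Y) := by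
  rw [inner_eq_integral_mul hψ, h.integral_pull_mul, integral_weight]
  exact integral_congr_ae ((testComp_ae hφ hc t Y).mono fun x hx => by simp only [hx])

theorem IsFlow.inner_testComp_deriv {t : ℝ} {Y ρ : H1R} (h : IsFlow Y ρ) {φ : ℝ → ℝ}
    (hφ : ContDiff ℝ ∞ φ) (hc : HasCompactSupport φ) (hφ' : Continuous (deriv φ)) (u : H1R) :
    inner ℝ (J u + mulL ρ (J u)) (testComp hφ' hc.deriv t Y)
      = - inner ℝ (D u) (testComp hφ.continuous hc t Y) := by
  rw [integral_weight, inner_eq_integral_mul (testComp_ae hφ.continuous hc t Y),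
    ← h.integral_deriv_comp hφ hc]
  refine integral_congr_ae ?_
  filter_upwards [testComp_ae hφ' hc.deriv t Y, J_ae u] with x a b
  rw [a, b]; ring

theorem mulL_comm (u v : H1R) (f : L2R) : mulL u (mulL v f) = mulL v (mulL u f) := by
  rw [mulL_mulL, mulL_mulL, mul_swap]

theorem mulL_J_comm (u v : H1R) : mulL u (J v) = mulL v (J u) := by
  rw [← J_mul, ← J_mul, mul_swap]

/-- Transport of a quantity along the flow, tested against a smooth function. -/
theorem IsFlow.hasDerivAt_inner_testComp {t₀ a : ℝ} {Y ρ f : ℝ → H1R} {z ρ' f' : H1R} {s : L2R}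
    (h : IsFlow (Y t₀) (ρ t₀)) (hY : HasDerivAt Y (-a • z) t₀) (hρ : HasDerivAt ρ ρ' t₀)
    (hz : J ρ' = -a • D z) (hf : HasDerivAt f f' t₀)
    (hs : D (f t₀) = s + mulL (ρ t₀) s) {φ : ℝ → ℝ} (hφ : ContDiff ℝ ∞ φ)
    (hc : HasCompactSupport φ) :
    HasDerivAt (fun t => inner ℝ (J (f t) + mulL (ρ t) (J (f t))) (testComp hφ.continuous hc t (Y t)))
      (inner ℝ ((J f' + s + a • mulL z s) + mulL (ρ t₀) (J f' + s + a • mulL z s))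
        (testComp hφ.continuous hc t₀ (Y t₀))) t₀ := by
  have hφ' : Continuous (deriv φ) := hφ.continuous_deriv (by simp)
  have hJ := TransportCoeff.hasDerivAt_clm J hf
  refine HasDerivAt.congr_deriv ((hJ.add (TransportCoeff.hasDerivAt_bilin mulL hρ hJ)).inner ℝ
    (hasDerivAt_testComp hφ hc hφ' hY)) ?_
  -- Since y_t = -(1 + az), the time derivative of φ∘y is -(1 + az)φ'∘y. Integration by parts moves
  -- the derivative onto f + azf.
  have key := h.inner_testComp_deriv (t := t₀) hφ hc hφ' (f t₀ + a • mul z (f t₀))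
  set Φ := testComp hφ.continuous hc t₀ (Y t₀)
  set Φ' := testComp hφ' hc.deriv t₀ (Y t₀)
  have h1 : inner ℝ (J (f t₀) + mulL (ρ t₀) (J (f t₀))) (mulL (-a • z) Φ' - Φ')
      = inner ℝ (D (f t₀ + a • mul z (f t₀))) Φ := by
    rw [← neg_neg (inner ℝ (D _) Φ), ← key]
    simp only [map_add, map_smul, J_mul, mulL_comm (ρ t₀) z, inner_sub_right,
      smul_apply, real_inner_smul_right, ← inner_mulL, inner_add_left,
      real_inner_smul_left]
    ring
  simp only [Pi.add_apply]
  rw [h1, ← inner_add_left]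
  congr 1
  -- The term a z_ξ f from the product rule cancels against ρ' f, since ρ' = -a z_ξ.
  rw [map_add, map_smul, D_mul, hs, mulL_J_comm ρ' (f t₀), hz]
  simp only [map_add, map_smul, mulL_comm (ρ t₀) z]
  module

end H1R

/-! ### From Lagrangian to Eulerian solutions -/

namespace SobolevH

open H1R

/-- The `i`-th weak derivative as a continuous linear map. -/
noncomputable def dL {k : ℕ} (i : Fin (k + 1)) : SobolevH k →L[ℝ] L2R :=
  (PiLp.proj 2 (fun _ : Fin (k + 1) => L2R) i).comp (sobolevSubmodule k).subtypeL

theorem ext_d {k : ℕ} {u v : SobolevH k} (h : ∀ i, u.d i = v.d i) : u = v :=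
  Subtype.ext (PiLp.ext h)

theorem continuousOn_of_d {k : ℕ} {U : ℝ → SobolevH k} {S : Set ℝ}
    (h : ∀ i, ContinuousOn (fun t => (U t).d i) S) : ContinuousOn U S := by
  rw [continuousOn_iff_continuous_domRestrict, continuous_induced_rng]
  refine (PiLp.continuous_toLp 2 _).comp (continuous_pi fun i => ?_)
  exact continuousOn_iff_continuous_domRestrict.1 (h i)

theorem norm_le_sum {k : ℕ} (u : SobolevH k) : ‖u‖ ≤ ∑ i, ‖u.d i‖ := by
  have h1 : ‖u‖ = ‖(u.1 : PiLp 2 (fun _ : Fin (k + 1) => L2R))‖ := rfl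
  rw [h1, PiLp.norm_eq_of_L2]
  refine Real.sqrt_le_iff.2 ⟨Finset.sum_nonneg fun i _ => norm_nonneg _, ?_⟩
  exact Finset.sum_sq_le_sq_sum_of_nonneg fun i _ => norm_nonneg _

theorem hasDerivWithinAt_of_d {k : ℕ} {U : ℝ → SobolevH k} {W : SobolevH k} {S : Set ℝ} {t : ℝ}
    (h : ∀ i, HasDerivWithinAt (fun t => (U t).d i) (W.d i) S t) : HasDerivWithinAt U W S t := by
  rw [hasDerivWithinAt_iff_isLittleO]
  refine Asymptotics.IsLittleO.trans_le
    (g := fun s => s - t) (Asymptotics.IsBigO.trans_isLittleO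
    (g := fun s => ∑ i, ‖(U s).d i - (U t).d i - (s - t) • W.d i‖)
    (Asymptotics.isBigO_of_le _ fun s => ?_)
    ?_) fun _ => le_rfl
  · exact (norm_le_sum _).trans (le_abs_self _)
  · have := Asymptotics.IsLittleO.sum (s := Finset.univ)
      fun i _ => (hasDerivWithinAt_iff_isLittleO.1 (h i)).norm_left
    refine this.congr_left fun s => ?_
    rw [Finset.sum_apply]

theorem exists_of_tuple {k : ℕ} {S : Set ℝ} (F : ℝ → Fin (k + 1) → L2R)
    (h : ∀ t ∈ S, ∀ i : Fin k, IsWeakDeriv (F t i.castSucc) (F t i.succ)) :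
    ∃ U : ℝ → SobolevH k, ∀ t ∈ S, ∀ i, (U t).d i = F t i := by
  classical
  refine ⟨fun t => if ht : t ∈ S then ⟨WithLp.toLp 2 (F t), h t ht⟩ else 0, fun t ht i => ?_⟩
  simp only [dif_pos ht]
  rfl

end SobolevH

/-- The defining pairing identity is differentiated in time against a fixed test function. It
supplies the H² compatibility of the velocity components. -/
theorem IsWeakDeriv.of_hasDerivWithinAt {F G : ℝ → L2R} {F' G' : L2R} {S : Set ℝ} {t : ℝ}
    (h : ∀ s ∈ S, IsWeakDeriv (F s) (G s)) (hF : HasDerivWithinAt F F' S t)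
    (hG : HasDerivWithinAt G G' S t) (ht : t ∈ S) (hS : UniqueDiffWithinAt ℝ S t) :
    IsWeakDeriv F' G' := by
  intro φ hφ hc
  obtain ⟨u, -, hJ, hD⟩ := H1R.exists_test φ hφ hc
  have h1 : ∀ s ∈ S, inner ℝ (F s) (H1R.D u) = - inner ℝ (G s) (H1R.J u) := fun s hs => by
    rw [H1R.inner_eq_integral_mul hJ, H1R.inner_eq_integral_mul hD, h s hs φ hφ hc]
  have h2 := hF.inner ℝ (hasDerivWithinAt_const t S (H1R.D u))
  have h3 := ((hG.inner ℝ (hasDerivWithinAt_const t S (H1R.J u))).neg).congr h1 (h1 t ht)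
  have h4 := hS.eq_deriv S h2 h3
  simp only [inner_zero_right, zero_add] at h4
  rw [← H1R.inner_eq_integral_mul hJ, ← H1R.inner_eq_integral_mul hD, h4]

namespace TransportCoeff

open H1R LState

variable {p : TransportCoeff}

/-- The profile and its first three derivatives in Lagrangian coordinates. -/
noncomputable def lagProfile (X : LState) : Fin 4 → L2R :=
  ![J X.z, J X.v, J X.w, divL X.ρ (D X.w)]

/-- The time derivative of the profile and its first two derivatives in Lagrangian coordinates. -/
noncomputable def lagVelocity (p : TransportCoeff) (X : LState) : Fin 3 → L2R :=
  ![J (p.field X).z + J X.v + p.a • mulL X.z (J X.v),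
    J (p.field X).v + J X.w + p.a • mulL X.z (J X.w),
    J (p.field X).w + divL X.ρ (D X.w) + p.a • mulL X.z (divL X.ρ (D X.w))]

namespace LagrangianSolution

variable {τ : ℝ} {X : ℝ → LState} (h : p.LagrangianSolution τ X)
include h

theorem isFlow {t : ℝ} (ht : t ∈ Ico 0 τ) : IsFlow (X t).Y (X t).ρ := ⟨h.D_Y t ht, h.mem_Omega t ht⟩

theorem continuousOn_field : ContinuousOn (fun t => p.field (X t)) (Ico 0 τ) := fun t ht =>
  ((contDiffAt_field p (h.mem_Omega t ht)).continuousAt.comp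
    (h.hasDerivAt t ht).continuousAt).continuousWithinAt

theorem continuousOn_ρ : ContinuousOn (fun t => (X t).ρ) (Ico 0 τ) := fun t ht =>
  (hasDerivAt_ρ (h.hasDerivAt t ht)).continuousAt.continuousWithinAt

theorem continuousOn_z : ContinuousOn (fun t => (X t).z) (Ico 0 τ) := fun t ht =>
  (hasDerivAt_z (h.hasDerivAt t ht)).continuousAt.continuousWithinAt

theorem continuousOn_v : ContinuousOn (fun t => (X t).v) (Ico 0 τ) := fun t ht =>
  (hasDerivAt_v (h.hasDerivAt t ht)).continuousAt.continuousWithinAt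

theorem continuousOn_w : ContinuousOn (fun t => (X t).w) (Ico 0 τ) := fun t ht =>
  (hasDerivAt_w (h.hasDerivAt t ht)).continuousAt.continuousWithinAt

theorem continuousOn_s : ContinuousOn (fun t => divL (X t).ρ (D (X t).w)) (Ico 0 τ) := fun t ht =>
  ContinuousWithinAt.clm_apply
    (ContinuousAt.comp_continuousWithinAt (f := fun t => (X t).ρ) (continuousAt_divL (h.mem_Omega t ht)) (h.continuousOn_ρ t ht))
    (D.continuous.continuousAt.comp_continuousWithinAt (h.continuousOn_w t ht))

theorem continuousOn_pull {f : ℝ → L2R} (hf : ContinuousOn f (Ico 0 τ)) :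
    ContinuousOn (fun t => pull t (X t).Y (f t)) (Ico 0 τ) := by
  intro t₀ ht₀
  have hg : ContinuousWithinAt (fun t => f t + mulL (X t).ρ (f t)) (Ico 0 τ) t₀ :=
    (hf t₀ ht₀).add (ContinuousWithinAt.clm_apply
      (mulL.continuous.continuousAt.comp_continuousWithinAt (h.continuousOn_ρ t₀ ht₀)) (hf t₀ ht₀))
  refine tendsto_of_tendsto_inner ?_ fun ψ ⟨φ, hφ, hc, hψ⟩ => ?_
  · have h1 : ContinuousWithinAt (fun t => inner ℝ (f t + mulL (X t).ρ (f t)) (f t)) (Ico 0 τ) t₀ :=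
      ContinuousWithinAt.inner (𝕜 := ℝ) hg (hf t₀ ht₀)
    exact h1.congr (fun t ht => (h.isFlow ht).norm_pull_sq _) ((h.isFlow ht₀).norm_pull_sq _)
  · have h1 : ContinuousWithinAt (fun t => inner ℝ (f t + mulL (X t).ρ (f t))
        (testComp hφ.continuous hc t (X t).Y)) (Ico 0 τ) t₀ :=
      ContinuousWithinAt.inner (𝕜 := ℝ) hg (hasDerivAt_testComp hφ hc (hφ.continuous_deriv (by simp))
        (hasDerivAt_Y (h.hasDerivAt t₀ ht₀))).continuousAt.continuousWithinAt
    exact h1.congr (fun t ht => (h.isFlow ht).inner_pull hφ.continuous hc hψ _)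
      ((h.isFlow ht₀).inner_pull hφ.continuous hc hψ _)

/-- The chain rule with y_t = -(1 + az), where s is the spatial Eulerian derivative read along the
flow. The tested version suffices because the candidate derivative is continuous in L². -/
theorem hasDerivWithinAt_pull {f f' : ℝ → H1R} {s : ℝ → L2R}
    (hf : ∀ t ∈ Ico 0 τ, HasDerivAt f (f' t) t) (hf' : ContinuousOn f' (Ico 0 τ))
    (hs : ContinuousOn s (Ico 0 τ)) (hD : ∀ t ∈ Ico 0 τ, D (f t) = s t + mulL (X t).ρ (s t))
    {t₀ : ℝ} (ht₀ : t₀ ∈ Ico 0 τ) :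
    HasDerivWithinAt (fun t => pull t (X t).Y (J (f t)))
      (pull t₀ (X t₀).Y (J (f' t₀) + s t₀ + p.a • mulL (X t₀).z (s t₀))) (Ico 0 τ) t₀ := by
  have hH : ContinuousOn (fun t => J (f' t) + s t + p.a • mulL (X t).z (s t)) (Ico 0 τ) :=
    ((J.continuous.comp_continuousOn hf').add hs).add
      (((mulL.continuous.comp_continuousOn h.continuousOn_z).clm_apply hs).const_smul p.a)
  refine hasDerivWithinAt_of_inner
    (H := fun t => pull t (X t).Y (J (f' t) + s t + p.a • mulL (X t).z (s t)))
    (convex_Ico 0 τ) ht₀ (h.continuousOn_pull hH t₀ ht₀) fun ψ ⟨φ, hφ, hc, hψ⟩ t ht => ?_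
  have hX := h.hasDerivAt t ht
  have h1 := (h.isFlow ht).hasDerivAt_inner_testComp (t₀ := t) (Y := fun t => (X t).Y)
    (ρ := fun t => (X t).ρ) (a := p.a) (z := (X t).z)
    (by have := hasDerivAt_Y hX; rwa [field_Y] at this) (hasDerivAt_ρ hX) (by rw [field_ρ, map_smul, h.D_z t ht]) (hf t ht) (hD t ht)
    hφ hc
  rw [← (h.isFlow ht).inner_pull hφ.continuous hc hψ] at h1
  exact h1.hasDerivWithinAt.congr (fun r hr => (h.isFlow hr).inner_pull hφ.continuous hc hψ _)
    ((h.isFlow ht).inner_pull hφ.continuous hc hψ _)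

theorem D_z_eq {t : ℝ} (ht : t ∈ Ico 0 τ) : D (X t).z = J (X t).v + mulL (X t).ρ (J (X t).v) := by
  rw [h.D_z t ht, map_add, J_mul]

theorem D_v_eq {t : ℝ} (ht : t ∈ Ico 0 τ) : D (X t).v = J (X t).w + mulL (X t).ρ (J (X t).w) := by
  rw [h.D_v t ht, map_add, J_mul]

theorem D_w_eq {t : ℝ} (ht : t ∈ Ico 0 τ) : D (X t).w =
    divL (X t).ρ (D (X t).w) + mulL (X t).ρ (divL (X t).ρ (D (X t).w)) :=
  (divL_add_mulL (h.mem_Omega t ht) _).symm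

theorem hasDerivWithinAt_lagProfile (i : Fin 3) {t : ℝ} (ht : t ∈ Ico 0 τ) :
    HasDerivWithinAt (fun t => pull t (X t).Y (lagProfile (X t) i.castSucc))
      (pull t (X t).Y (p.lagVelocity (X t) i)) (Ico 0 τ) t := by
  fin_cases i
  · exact h.hasDerivWithinAt_pull (f := fun t => (X t).z) (f' := fun t => (p.field (X t)).z)
      (s := fun t => J (X t).v)
      (fun t ht => hasDerivAt_z (h.hasDerivAt t ht))
      (continuous_fst.comp_continuousOn (continuous_snd.comp_continuousOn
        (continuous_snd.comp_continuousOn h.continuousOn_field)))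
      (J.continuous.comp_continuousOn h.continuousOn_v) (fun t ht => h.D_z_eq ht) ht
  · exact h.hasDerivWithinAt_pull (f := fun t => (X t).v) (f' := fun t => (p.field (X t)).v)
      (s := fun t => J (X t).w)
      (fun t ht => hasDerivAt_v (h.hasDerivAt t ht))
      (continuous_fst.comp_continuousOn (continuous_snd.comp_continuousOn
        (continuous_snd.comp_continuousOn (continuous_snd.comp_continuousOn h.continuousOn_field))))
      (J.continuous.comp_continuousOn h.continuousOn_w) (fun t ht => h.D_v_eq ht) ht
  · exact h.hasDerivWithinAt_pull (f := fun t => (X t).w) (f' := fun t => (p.field (X t)).w)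
      (s := fun t => divL (X t).ρ (D (X t).w))
      (fun t ht => hasDerivAt_w (h.hasDerivAt t ht))
      (continuous_snd.comp_continuousOn (continuous_snd.comp_continuousOn
        (continuous_snd.comp_continuousOn (continuous_snd.comp_continuousOn h.continuousOn_field))))
      h.continuousOn_s (fun t ht => h.D_w_eq ht) ht

theorem isWeakDeriv_lagProfile {t : ℝ} (ht : t ∈ Ico 0 τ) (i : Fin 3) :
    IsWeakDeriv (pull t (X t).Y (lagProfile (X t) i.castSucc))
      (pull t (X t).Y (lagProfile (X t) i.succ)) := by
  fin_cases i
  · exact (h.isFlow ht).isWeakDeriv_pull (h.D_z_eq ht)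
  · exact (h.isFlow ht).isWeakDeriv_pull (h.D_v_eq ht)
  · exact (h.isFlow ht).isWeakDeriv_pull (h.D_w_eq ht)

theorem continuousOn_lagProfile (i : Fin 4) :
    ContinuousOn (fun t => lagProfile (X t) i) (Ico 0 τ) := by
  fin_cases i
  · exact J.continuous.comp_continuousOn h.continuousOn_z
  · exact J.continuous.comp_continuousOn h.continuousOn_v
  · exact J.continuous.comp_continuousOn h.continuousOn_w
  · exact h.continuousOn_s

theorem continuousOn_lagVelocity (i : Fin 3) :
    ContinuousOn (fun t => p.lagVelocity (X t) i) (Ico 0 τ) := by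
  have hF := h.continuousOn_field
  have hz := mulL.continuous.comp_continuousOn h.continuousOn_z
  have hv := J.continuous.comp_continuousOn h.continuousOn_v
  have hw := J.continuous.comp_continuousOn h.continuousOn_w
  fin_cases i
  · exact ((J.continuous.comp_continuousOn (continuous_fst.comp_continuousOn
      (continuous_snd.comp_continuousOn (continuous_snd.comp_continuousOn hF)))).add hv).add
      ((hz.clm_apply hv).const_smul p.a)
  · exact ((J.continuous.comp_continuousOn (continuous_fst.comp_continuousOn
      (continuous_snd.comp_continuousOn (continuous_snd.comp_continuousOn
        (continuous_snd.comp_continuousOn hF))))).add hw).add ((hz.clm_apply hw).const_smul p.a)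
  · exact ((J.continuous.comp_continuousOn (continuous_snd.comp_continuousOn
      (continuous_snd.comp_continuousOn (continuous_snd.comp_continuousOn
        (continuous_snd.comp_continuousOn hF))))).add h.continuousOn_s).add
        ((hz.clm_apply h.continuousOn_s).const_smul p.a)

/-- Four components vary continuously in L², but only the first three can be differentiated in time:
each time derivative uses the next space derivative. This is the class C(H³) ∩ C¹(H²). -/
theorem exists_eulerian : ∃ (U : ℝ → SobolevH 3) (W : ℝ → SobolevH 2),
    (∀ t ∈ Ico 0 τ, ∀ i, (U t).d i = pull t (X t).Y (lagProfile (X t) i)) ∧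
    (∀ t ∈ Ico 0 τ, ∀ i, (W t).d i = pull t (X t).Y (p.lagVelocity (X t) i)) ∧
    ContinuousOn U (Ico 0 τ) ∧ ContinuousOn W (Ico 0 τ) ∧
    ∀ t ∈ Ico 0 τ, HasDerivWithinAt (fun t => (U t).incl) (W t) (Ico 0 τ) t := by
  obtain ⟨U, hU⟩ := SobolevH.exists_of_tuple (k := 3) (S := Ico 0 τ)
    (fun t i => pull t (X t).Y (lagProfile (X t) i)) fun t ht i => h.isWeakDeriv_lagProfile ht i
  obtain ⟨W, hW⟩ := SobolevH.exists_of_tuple (k := 2) (S := Ico 0 τ)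
    (fun t i => pull t (X t).Y (p.lagVelocity (X t) i)) fun t ht i =>
      IsWeakDeriv.of_hasDerivWithinAt (fun s hs => h.isWeakDeriv_lagProfile hs i.castSucc)
        (h.hasDerivWithinAt_lagProfile i.castSucc ht) (h.hasDerivWithinAt_lagProfile i.succ ht) ht
        (uniqueDiffOn_Ico 0 τ t ht)
  refine ⟨U, W, hU, hW, SobolevH.continuousOn_of_d fun i => ?_, SobolevH.continuousOn_of_d fun i => ?_,
    fun t ht => SobolevH.hasDerivWithinAt_of_d fun i => ?_⟩
  · exact (h.continuousOn_pull (h.continuousOn_lagProfile i)).congr fun t ht => hU t ht i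
  · exact (h.continuousOn_pull (h.continuousOn_lagVelocity i)).congr fun t ht => hW t ht i
  · rw [hW t ht i]
    exact (h.hasDerivWithinAt_lagProfile i ht).congr (fun s hs => hU s hs i.castSucc)
      (hU t ht i.castSucc)

/-- The nonlocal term P enters the zeroth velocity component as -P and κ times the second one also
as -P. It cancels in their difference, leaving a local identity that is checked along the flow and
carried over by the inverse flow, which preserves null sets. -/
theorem eulerian_eq {t : ℝ} (ht : t ∈ Ico 0 τ) {U : SobolevH 3} {W : SobolevH 2}
    (hU : ∀ i, U.d i = pull t (X t).Y (lagProfile (X t) i))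
    (hW : ∀ i, W.d i = pull t (X t).Y (p.lagVelocity (X t) i)) :
    ∀ᵐ x, W.d 0 x + U.d 1 x + ((2 * p.b₂ - p.a) * U.d 0 x + 3 * p.b₃ * U.d 0 x ^ 2
      + 4 * p.b₄ * U.d 0 x ^ 3) * U.d 1 x + p.κ * (U.d 3 x - W.d 2 x)
      + p.a * p.κ * (U.d 0 x * U.d 3 x + 2 * U.d 1 x * U.d 2 x) = 0 := by
  have hfl := h.isFlow ht
  have hκ := p.κ_pos.ne'
  set S := divL (X t).ρ (D (X t).w) with hS
  have key : ∀ᵐ ξ, p.lagVelocity (X t) 0 ξ + lagProfile (X t) 1 ξ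
      + ((2 * p.b₂ - p.a) * lagProfile (X t) 0 ξ + 3 * p.b₃ * lagProfile (X t) 0 ξ ^ 2
      + 4 * p.b₄ * lagProfile (X t) 0 ξ ^ 3) * lagProfile (X t) 1 ξ
      + p.κ * (lagProfile (X t) 3 ξ - p.lagVelocity (X t) 2 ξ)
      + p.a * p.κ * (lagProfile (X t) 0 ξ * lagProfile (X t) 3 ξ
        + 2 * lagProfile (X t) 1 ξ * lagProfile (X t) 2 ξ) = 0 := by
    have e0 : lagProfile (X t) 0 = J (X t).z := rfl
    have e1 : lagProfile (X t) 1 = J (X t).v := rfl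
    have e2 : lagProfile (X t) 2 = J (X t).w := rfl
    have e3 : lagProfile (X t) 3 = S := rfl
    have f0 : p.lagVelocity (X t) 0
      = J (p.field (X t)).z + J (X t).v + p.a • mulL (X t).z (J (X t).v) := rfl
    have f2 : p.lagVelocity (X t) 2 = J (p.field (X t)).w + S + p.a • mulL (X t).z S := rfl
    rw [e0, e1, e2, e3, f0, f2]
    filter_upwards [J_ae (X t).z, J_ae (X t).v, J_ae (X t).w, J_ae (p.field (X t)).z,
      J_ae (p.field (X t)).w, mulL_ae (X t).z (J (X t).v), mulL_ae (X t).z S,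
      Lp.coeFn_smul p.a (mulL (X t).z (J (X t).v)), Lp.coeFn_smul p.a (mulL (X t).z S),
      Lp.coeFn_add (J (p.field (X t)).z) (J (X t).v),
      Lp.coeFn_add (J (p.field (X t)).z + J (X t).v) (p.a • mulL (X t).z (J (X t).v)),
      Lp.coeFn_add (J (p.field (X t)).w) S,
      Lp.coeFn_add (J (p.field (X t)).w + S) (p.a • mulL (X t).z S)]
      with ξ a1 a2 a3 a4 a5 a6 a7 a8 a9 a10 a11 a12 a13
    simp only [Pi.add_apply, Pi.smul_apply] at a8 a9 a10 a11 a12 a13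
    rw [a11, a10, a13, a12, a8, a9, a6, a7, a5, a4, a1, a2, a3, field_z, field_w]
    simp only [rep_neg, rep_add, rep_smul, rep_mul, rep_sub, rep_g', smul_eq_mul]
    field_simp
    ring
  filter_upwards [hfl.ae_flowInv (t := t) key, hfl.pull_ae (t := t) (lagProfile (X t) 0),
    hfl.pull_ae (t := t) (lagProfile (X t) 1), hfl.pull_ae (t := t) (lagProfile (X t) 2),
    hfl.pull_ae (t := t) (lagProfile (X t) 3), hfl.pull_ae (t := t) (p.lagVelocity (X t) 0),
    hfl.pull_ae (t := t) (p.lagVelocity (X t) 2)] with x b b0 b1 b2 b3 c0 c2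
  rw [hU 0, hU 1, hU 2, hU 3, hW 0, hW 2, b0, b1, b2, b3, c0, c2, b]

end LagrangianSolution

end TransportCoeff

/-! ### Uniqueness of Eulerian solutions by an H¹ energy estimate -/

namespace SobolevH

open H1R

/-- The `i`-th weak derivative as an element of `H¹`. -/
noncomputable def toH1 {k : ℕ} (i : Fin k) : SobolevH k →L[ℝ] H1R :=
  LinearMap.mkContinuous
    { toFun := fun u => ofWeak (u.2 i)
      map_add' := fun u v => J_injective (by rw [map_add, J_ofWeak, J_ofWeak, J_ofWeak]; rfl)
      map_smul' := fun c u => J_injective (by rw [map_smul, J_ofWeak, J_ofWeak]; rfl) } 2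
    fun u => by
      have h1 : ∀ j : Fin (k + 1), ‖u.d j‖ ≤ ‖u‖ := fun j => PiLp.norm_apply_le u.1 j
      refine (norm_le _).trans ?_
      change ‖J (ofWeak (u.2 i))‖ + ‖D (ofWeak (u.2 i))‖ ≤ _
      rw [J_ofWeak, D_ofWeak]
      linarith [h1 i.castSucc, h1 i.succ, show u.d i.castSucc = u.1 i.castSucc from rfl,
        show ‖u.1 i.castSucc‖ ≤ ‖u‖ from h1 _, show ‖u.1 i.succ‖ ≤ ‖u‖ from h1 _]

@[simp] theorem J_toH1 {k : ℕ} (i : Fin k) (u : SobolevH k) : J (toH1 i u) = u.d i.castSucc :=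
  J_ofWeak (u.2 i)

@[simp] theorem D_toH1 {k : ℕ} (i : Fin k) (u : SobolevH k) : D (toH1 i u) = u.d i.succ :=
  D_ofWeak (u.2 i)

attribute [irreducible] toH1

end SobolevH

namespace H1R

theorem inner_mulL_J_comm (u v w : H1R) :
    inner ℝ (mulL u (J v)) (J w) = inner ℝ (mulL u (J w)) (J v) := by
  rw [inner_mulL, real_inner_comm]

theorem abs_inner_mulL_le (u : H1R) (f g : L2R) : |inner ℝ f (mulL u g)| ≤ ‖u‖ * (‖f‖ * ‖g‖) := by
  calc _ ≤ ‖f‖ * ‖mulL u g‖ := abs_real_inner_le_norm _ _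
    _ ≤ ‖f‖ * (‖u‖ * ‖g‖) :=
      mul_le_mul_of_nonneg_left (norm_mulL_le (abs_rep_le u) g) (norm_nonneg _)
    _ = _ := by ring

/-- The cancellation of third derivatives in the quasilinear term. -/
theorem inner_quasilinear {a₀ a₁ a₂ b₀ b₁ b₂ : H1R} (ha₀ : D a₀ = J a₁) (ha₁ : D a₁ = J a₂)
    (hb₀ : D b₀ = J b₁) (hb₁ : D b₁ = J b₂) :
    inner ℝ (J a₀) ((2:ℝ)⁻¹ • (mulL a₀ (D b₂) + mulL b₀ (D a₂)) + mulL a₁ (J b₂) + mulL b₁ (J a₂))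
      = -(1 / 4) * inner ℝ (J a₁) (mulL b₁ (J a₁)) - 1 / 2 * inner ℝ (J a₀) (mulL b₂ (J a₁)) := by
  -- Integrations by parts remove the third derivatives of a; the remaining pairing of b a' with a''
  -- is, up to half of b'(a')², a total derivative.
  have ibp : ∀ u v w : H1R, inner ℝ (mulL u (J v)) (D w) =
      - (inner ℝ (mulL v (D u)) (J w) + inner ℝ (mulL u (D v)) (J w)) := fun u v w => by
    rw [← J_mul, ← neg_neg (inner ℝ (J _) (D w)), ← inner_D_J, D_mul, inner_add_left]
  have e1 := ibp b₀ a₀ a₂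
  have e2 := ibp b₀ a₁ a₁
  have e3 := ibp a₀ a₀ b₂
  have e4 := ibp b₁ a₀ a₁
  rw [ha₀, hb₀] at e1
  rw [ha₁, hb₀] at e2
  rw [ha₀] at e3
  rw [ha₀, ha₁, hb₁] at e4
  rw [inner_mulL_J_comm b₀ a₂ a₁] at e2
  rw [mulL_J_comm a₀ b₁] at e1
  rw [mulL_J_comm a₁ b₁] at e2
  rw [mulL_J_comm a₀ b₂] at e4
  simp only [inner_add_right, real_inner_smul_right, ← inner_mulL]
  rw [mulL_J_comm a₁ a₀, inner_mulL_J_comm a₀ a₁ b₂, mulL_J_comm a₀ b₂] at *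
  linarith

end H1R

namespace TransportCoeff

open H1R SobolevH

/-- The equation in Eulerian coordinates, for `W` in the role of `U_t`. -/
def EulerEq (p : TransportCoeff) (U : SobolevH 3) (W : SobolevH 2) : Prop :=
  ∀ᵐ x, W.d 0 x + U.d 1 x + ((2 * p.b₂ - p.a) * U.d 0 x + 3 * p.b₃ * U.d 0 x ^ 2
      + 4 * p.b₄ * U.d 0 x ^ 3) * U.d 1 x + p.κ * (U.d 3 x - W.d 2 x)
      + p.a * p.κ * (U.d 0 x * U.d 3 x + 2 * U.d 1 x * U.d 2 x) = 0

/-- A solution in `C(S; H³) ∩ C¹(S; H²)`. -/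
structure EulerSolution (p : TransportCoeff) (S : Set ℝ) (U : ℝ → SobolevH 3) : Prop where
  continuousOn : ContinuousOn U S
  exists_deriv : ∀ t ∈ S, ∃ W, HasDerivWithinAt (fun t => (U t).incl) W S t ∧ p.EulerEq (U t) W

variable (p : TransportCoeff)

/-- The coefficient of `∂ₓ(U₁ - U₂)` in the difference of the semilinear terms. -/
noncomputable def diffCoeff₁ (U : SobolevH 3) : H1R :=
  (2 * p.b₂ - p.a) • toH1 0 U + (3 * p.b₃) • mul (toH1 0 U) (toH1 0 U)
    + (4 * p.b₄) • mul (toH1 0 U) (mul (toH1 0 U) (toH1 0 U))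

/-- The coefficient of `U₁ - U₂` in the difference of the semilinear terms. -/
noncomputable def diffCoeff₀ (U₁ U₂ : SobolevH 3) : H1R :=
  (2 * p.b₂ - p.a) • toH1 1 U₂ + (3 * p.b₃) • mul (toH1 0 U₁ + toH1 0 U₂) (toH1 1 U₂)
    + (4 * p.b₄) • mul (mul (toH1 0 U₁) (toH1 0 U₁) + mul (toH1 0 U₁) (toH1 0 U₂)
      + mul (toH1 0 U₂) (toH1 0 U₂)) (toH1 1 U₂)

variable {p}

/-- With V the difference and S the sum, polarisation writes the difference of UU_xxx + 2U_xU_xx as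
½(VS_xxx + SV_xxx) + V_xS_xx + S_xV_xx, the symmetric form in which the third derivatives of V can
be integrated away. -/
theorem EulerEq.sub_eq {U₁ U₂ : SobolevH 3} {W₁ W₂ : SobolevH 2} (h₁ : p.EulerEq U₁ W₁)
    (h₂ : p.EulerEq U₂ W₂) : (W₁ - W₂).d 0 - p.κ • (W₁ - W₂).d 2 =
      -((U₁ - U₂).d 1 + p.κ • (U₁ - U₂).d 3 + mulL (p.diffCoeff₁ U₁) ((U₁ - U₂).d 1)
        + mulL (p.diffCoeff₀ U₁ U₂) ((U₁ - U₂).d 0)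
        + (p.a * p.κ) • ((2:ℝ)⁻¹ • (mulL (toH1 0 (U₁ - U₂)) ((U₁ + U₂).d 3)
          + mulL (toH1 0 (U₁ + U₂)) ((U₁ - U₂).d 3))
          + mulL (toH1 1 (U₁ - U₂)) ((U₁ + U₂).d 2) + mulL (toH1 1 (U₁ + U₂)) ((U₁ - U₂).d 2))) := by
  have hd : ∀ i, (U₁ - U₂).d i =ᵐ[volume] fun x => U₁.d i x - U₂.d i x := fun i =>
    Lp.coeFn_sub (U₁.d i) (U₂.d i)
  have hs : ∀ i, (U₁ + U₂).d i =ᵐ[volume] fun x => U₁.d i x + U₂.d i x := fun i =>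
    Lp.coeFn_add (U₁.d i) (U₂.d i)
  have hw : ∀ i, (W₁ - W₂).d i =ᵐ[volume] fun x => W₁.d i x - W₂.d i x := fun i =>
    Lp.coeFn_sub (W₁.d i) (W₂.d i)
  refine Lp.ext ?_
  set A := p.diffCoeff₁ U₁ with hA
  set B := p.diffCoeff₀ U₁ U₂ with hB
  set m₁ := mulL A ((U₁ - U₂).d 1)
  set m₂ := mulL B ((U₁ - U₂).d 0)
  set m₃ := mulL (toH1 0 (U₁ - U₂)) ((U₁ + U₂).d 3)
  set m₄ := mulL (toH1 0 (U₁ + U₂)) ((U₁ - U₂).d 3)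
  set m₅ := mulL (toH1 1 (U₁ - U₂)) ((U₁ + U₂).d 2)
  set m₆ := mulL (toH1 1 (U₁ + U₂)) ((U₁ - U₂).d 2)
  have r : ∀ (i : Fin 3) (U : SobolevH 3), U.d i.castSucc =ᵐ[volume] rep (toH1 i U) := fun i U =>
    J_toH1 i U ▸ J_ae (toH1 i U)
  have e1 : ((W₁ - W₂).d 0 - p.κ • (W₁ - W₂).d 2 : L2R) =ᵐ[volume]
      fun x => (W₁ - W₂).d 0 x - p.κ * (W₁ - W₂).d 2 x := by
    filter_upwards [Lp.coeFn_sub ((W₁ - W₂).d 0) (p.κ • (W₁ - W₂).d 2),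
      Lp.coeFn_smul p.κ ((W₁ - W₂).d 2)] with x a b
    rw [a, Pi.sub_apply, b]; rfl
  have e2 : (-((U₁ - U₂).d 1 + p.κ • (U₁ - U₂).d 3 + m₁ + m₂
      + (p.a * p.κ) • ((2:ℝ)⁻¹ • (m₃ + m₄) + m₅ + m₆)) : L2R) =ᵐ[volume]
      fun x => -((U₁ - U₂).d 1 x + p.κ * (U₁ - U₂).d 3 x + m₁ x + m₂ x
      + (p.a * p.κ) * ((2:ℝ)⁻¹ * (m₃ x + m₄ x) + m₅ x + m₆ x)) := by
    filter_upwards [Lp.coeFn_neg ((U₁ - U₂).d 1 + p.κ • (U₁ - U₂).d 3 + m₁ + m₂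
      + (p.a * p.κ) • ((2:ℝ)⁻¹ • (m₃ + m₄) + m₅ + m₆)),
      Lp.coeFn_add ((U₁ - U₂).d 1 + p.κ • (U₁ - U₂).d 3 + m₁ + m₂)
        ((p.a * p.κ) • ((2:ℝ)⁻¹ • (m₃ + m₄) + m₅ + m₆)),
      Lp.coeFn_add ((U₁ - U₂).d 1 + p.κ • (U₁ - U₂).d 3 + m₁) m₂,
      Lp.coeFn_add ((U₁ - U₂).d 1 + p.κ • (U₁ - U₂).d 3) m₁,
      Lp.coeFn_add ((U₁ - U₂).d 1) (p.κ • (U₁ - U₂).d 3),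
      Lp.coeFn_smul p.κ ((U₁ - U₂).d 3),
      Lp.coeFn_smul (p.a * p.κ) ((2:ℝ)⁻¹ • (m₃ + m₄) + m₅ + m₆),
      Lp.coeFn_add ((2:ℝ)⁻¹ • (m₃ + m₄) + m₅) m₆,
      Lp.coeFn_add ((2:ℝ)⁻¹ • (m₃ + m₄)) m₅,
      Lp.coeFn_smul (2:ℝ)⁻¹ (m₃ + m₄), Lp.coeFn_add m₃ m₄] with x a1 a2 a3 a4 a5 a6 a7 a8 a9 a10 a11
    simp only [Pi.add_apply, Pi.smul_apply, Pi.neg_apply, smul_eq_mul] at *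
    rw [a1, a2, a3, a4, a5, a6, a7, a8, a9, a10, a11]
  have rA : ∀ x, rep A x = (2 * p.b₂ - p.a) * rep (toH1 0 U₁) x + 3 * p.b₃ * rep (toH1 0 U₁) x ^ 2
      + 4 * p.b₄ * rep (toH1 0 U₁) x ^ 3 := fun x => by
    simp only [hA, diffCoeff₁, rep_add, rep_smul, rep_mul]; ring
  have rB : ∀ x, rep B x = ((2 * p.b₂ - p.a) + 3 * p.b₃ * (rep (toH1 0 U₁) x + rep (toH1 0 U₂) x)
      + 4 * p.b₄ * (rep (toH1 0 U₁) x ^ 2 + rep (toH1 0 U₁) x * rep (toH1 0 U₂) x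
        + rep (toH1 0 U₂) x ^ 2)) * rep (toH1 1 U₂) x := fun x => by
    simp only [hB, diffCoeff₀, rep_add, rep_smul, rep_mul]; ring
  filter_upwards [e1, e2, h₁, h₂, hd 0, hd 1, hd 2, hd 3, hs 2, hs 3, hw 0, hw 2,
    mulL_ae A ((U₁ - U₂).d 1), mulL_ae B ((U₁ - U₂).d 0),
    mulL_ae (toH1 0 (U₁ - U₂)) ((U₁ + U₂).d 3), mulL_ae (toH1 0 (U₁ + U₂)) ((U₁ - U₂).d 3),
    mulL_ae (toH1 1 (U₁ - U₂)) ((U₁ + U₂).d 2), mulL_ae (toH1 1 (U₁ + U₂)) ((U₁ - U₂).d 2),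
    r 0 U₁, r 0 U₂, r 1 U₁, r 1 U₂]
    with x e1 e2 h₁ h₂ d0 d1 d2 d3 s2 s3 w0 w2 n1 n2 n3 n4 n5 n6 r1 r2 r3 r4
  change U₁.d 0 x = _ at r1
  change U₂.d 0 x = _ at r2
  change U₁.d 1 x = _ at r3
  change U₂.d 1 x = _ at r4
  rw [e1, e2, n1, n2, n3, n4, n5, n6, rA, rB, d0, d1, d2, d3, s2, s3, w0, w2]
  simp only [map_sub, map_add, rep_sub, rep_add, ← r1, ← r2, ← r3, ← r4]
  linear_combination h₁ - h₂

/-- Testing with V itself: the pairings with V_x and V_xxx vanish by skew-symmetry and the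
quasilinear term loses its top derivatives, so only V and V_x remain on the right. -/
theorem EulerEq.inner_eq {U₁ U₂ : SobolevH 3} {W₁ W₂ : SobolevH 2} (h₁ : p.EulerEq U₁ W₁)
    (h₂ : p.EulerEq U₂ W₂) :
    inner ℝ ((U₁ - U₂).d 0) ((W₁ - W₂).d 0) + p.κ * inner ℝ ((U₁ - U₂).d 1) ((W₁ - W₂).d 1) =
      -(inner ℝ ((U₁ - U₂).d 0) (mulL (p.diffCoeff₁ U₁) ((U₁ - U₂).d 1))
        + inner ℝ ((U₁ - U₂).d 0) (mulL (p.diffCoeff₀ U₁ U₂) ((U₁ - U₂).d 0))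
        + p.a * p.κ * (-(1 / 4) * inner ℝ ((U₁ - U₂).d 1) (mulL (toH1 1 (U₁ + U₂)) ((U₁ - U₂).d 1))
          - 1 / 2 * inner ℝ ((U₁ - U₂).d 0) (mulL (toH1 2 (U₁ + U₂)) ((U₁ - U₂).d 1)))) := by
  have key := h₁.sub_eq h₂
  set V := U₁ - U₂
  set S := U₁ + U₂
  set W := W₁ - W₂
  have h3 : inner ℝ (V.d 1) (W.d 1) = - inner ℝ (V.d 0) (W.d 2) := by
    have := inner_D_J (toH1 0 V) (toH1 1 W)
    simp only [J_toH1, D_toH1] at this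
    exact this
  have h4 : inner ℝ (V.d 0) (W.d 0) + p.κ * inner ℝ (V.d 1) (W.d 1)
      = inner ℝ (V.d 0) (W.d 0 - p.κ • W.d 2) := by
    rw [h3, inner_sub_right, real_inner_smul_right]; ring
  have h5 : inner ℝ (V.d 0) (V.d 1) = 0 := by
    have := inner_self_D (toH1 0 V)
    simp only [J_toH1, D_toH1] at this
    rw [real_inner_comm]; exact this
  have h6 : inner ℝ (V.d 0) (V.d 3) = 0 := by
    have e1 : inner ℝ (V.d 1) (V.d 2) = - inner ℝ (V.d 0) (V.d 3) := by
      have := inner_D_J (toH1 0 V) (toH1 2 V)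
      simp only [J_toH1, D_toH1] at this
      exact this
    have e2 : inner ℝ (V.d 2) (V.d 1) = (0:ℝ) := by
      have := inner_self_D (toH1 1 V)
      simp only [J_toH1, D_toH1] at this
      exact this
    rw [real_inner_comm] at e2
    linarith
  have h7 := inner_quasilinear (a₀ := toH1 0 V) (a₁ := toH1 1 V) (a₂ := toH1 2 V)
    (b₀ := toH1 0 S) (b₁ := toH1 1 S) (b₂ := toH1 2 S) (by simp only [J_toH1, D_toH1]; rfl)
    (by simp only [J_toH1, D_toH1]; rfl) (by simp only [J_toH1, D_toH1]; rfl)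
    (by simp only [J_toH1, D_toH1]; rfl)
  simp only [J_toH1, D_toH1] at h7
  change inner ℝ (V.d 0) ((2:ℝ)⁻¹ • (mulL (toH1 0 V) (S.d 3) + mulL (toH1 0 S) (V.d 3))
    + mulL (toH1 1 V) (S.d 2) + mulL (toH1 1 S) (V.d 2))
    = -(1 / 4) * inner ℝ (V.d 1) (mulL (toH1 1 S) (V.d 1))
      - 1 / 2 * inner ℝ (V.d 0) (mulL (toH1 2 S) (V.d 1)) at h7
  rw [h4, key, inner_neg_right, inner_add_right, inner_add_right, inner_add_right, inner_add_right,
    real_inner_smul_right, real_inner_smul_right, h5, h6, h7]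
  ring

theorem abs_add_le_of_products {a κ x y A B C E i₁ i₂ i₃ i₄ : ℝ} (ha : 0 < a) (hκ : 0 < κ)
    (hA : 0 ≤ A) (hB : 0 ≤ B) (hC : 0 ≤ C) (hE : 0 ≤ E) (n1 : |i₁| ≤ A * (x * y))
    (n2 : |i₂| ≤ B * (x * x)) (n3 : |i₃| ≤ C * (y * y)) (n4 : |i₄| ≤ E * (x * y)) :
    |-(i₁ + i₂ + a * κ * (-(1 / 4) * i₃ - 1 / 2 * i₄))| ≤
      (A + B + a * κ * (C + E)) * (1 + κ⁻¹) * (x ^ 2 + κ * y ^ 2) := by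
  rw [abs_le] at n1 n2 n3 n4
  set Z := x ^ 2 + y ^ 2 with hZ
  have hZ0 : 0 ≤ Z := by positivity
  have hZle : Z ≤ (1 + κ⁻¹) * (x ^ 2 + κ * y ^ 2) := by
    have : (1 + κ⁻¹) * (x ^ 2 + κ * y ^ 2) = Z + (κ⁻¹ * x ^ 2 + κ * y ^ 2) := by
      field_simp; ring
    rw [this]
    have : 0 ≤ κ⁻¹ * x ^ 2 + κ * y ^ 2 := by positivity
    linarith
  have hxy : x * y ≤ Z := by nlinarith [sq_nonneg (x - y)]
  have hxx : x * x ≤ Z := by nlinarith [sq_nonneg y]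
  have hyy : y * y ≤ Z := by nlinarith [sq_nonneg x]
  have m1 := mul_le_mul_of_nonneg_left hxy hA
  have m2 := mul_le_mul_of_nonneg_left hxx hB
  have m3 := mul_le_mul_of_nonneg_left hyy hC
  have m4 := mul_le_mul_of_nonneg_left hxy hE
  have hAZ := mul_nonneg hA hZ0
  have hCZ := mul_nonneg hC hZ0
  have hEZ := mul_nonneg hE hZ0
  have q1 : |-(1 / 4) * i₃ - 1 / 2 * i₄| ≤ (C + E) * Z := by
    rw [abs_le]; constructor <;> linarith
  have q2 : |a * κ * (-(1 / 4) * i₃ - 1 / 2 * i₄)| ≤ a * κ * ((C + E) * Z) := by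
    rw [abs_mul, abs_of_pos (mul_pos ha hκ)]
    exact mul_le_mul_of_nonneg_left q1 (mul_pos ha hκ).le
  have q3 := abs_le.1 q2
  have q4 : (A + B + a * κ * (C + E)) * Z = A * Z + B * Z + a * κ * ((C + E) * Z) := by ring
  calc _ ≤ (A + B + a * κ * (C + E)) * Z := by
        rw [q4, abs_le]; constructor <;> linarith [n1.1, n1.2, n2.1, n2.2, q3.1, q3.2]
    _ ≤ (A + B + a * κ * (C + E)) * ((1 + κ⁻¹) * (x ^ 2 + κ * y ^ 2)) :=
        mul_le_mul_of_nonneg_left hZle (by positivity)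
    _ = _ := by ring

/-- The growth rate of the difference of two solutions in the energy norm. -/
noncomputable def diffBound (p : TransportCoeff) (q : SobolevH 3 × SobolevH 3) : ℝ :=
  (‖p.diffCoeff₁ q.1‖ + ‖p.diffCoeff₀ q.1 q.2‖ + p.a * p.κ * (‖toH1 1 (q.1 + q.2)‖
        + ‖toH1 2 (q.1 + q.2)‖)) * (1 + p.κ⁻¹)

theorem EulerEq.abs_inner_le {U₁ U₂ : SobolevH 3} {W₁ W₂ : SobolevH 2} (h₁ : p.EulerEq U₁ W₁)
    (h₂ : p.EulerEq U₂ W₂) :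
    |inner ℝ ((U₁ - U₂).d 0) ((W₁ - W₂).d 0) + p.κ * inner ℝ ((U₁ - U₂).d 1) ((W₁ - W₂).d 1)| ≤
      p.diffBound (U₁, U₂) * (‖(U₁ - U₂).d 0‖ ^ 2 + p.κ * ‖(U₁ - U₂).d 1‖ ^ 2) := by
  rw [h₁.inner_eq h₂, diffBound]
  exact abs_add_le_of_products p.a_pos p.κ_pos (norm_nonneg _) (norm_nonneg _) (norm_nonneg _)
    (norm_nonneg _) (abs_inner_mulL_le _ _ _) (abs_inner_mulL_le _ _ _) (abs_inner_mulL_le _ _ _)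
    (abs_inner_mulL_le _ _ _)

theorem continuous_diffCoeff₁ : Continuous p.diffCoeff₁ := by
  unfold diffCoeff₁; fun_prop

theorem continuous_diffCoeff₀ : Continuous fun q : SobolevH 3 × SobolevH 3 =>
    p.diffCoeff₀ q.1 q.2 := by
  unfold diffCoeff₀; fun_prop

theorem continuous_diffBound : Continuous p.diffBound := by
  have := continuous_diffCoeff₀ (p := p)
  have := (continuous_diffCoeff₁ (p := p)).comp
    (continuous_fst : Continuous (Prod.fst : SobolevH 3 × SobolevH 3 → _))
  simp only [Function.comp_def] at this
  unfold diffBound; fun_prop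

attribute [irreducible] diffBound

/-- Gronwall for ‖V‖² + κ‖V_x‖². The growth rate is continuous in the H³ norms of the two solutions,
hence bounded on compact time intervals. -/
theorem EulerSolution.eqOn {τ : ℝ} {U₁ U₂ : ℝ → SobolevH 3} (h₁ : p.EulerSolution (Ico 0 τ) U₁)
    (h₂ : p.EulerSolution (Ico 0 τ) U₂) (h0 : U₁ 0 = U₂ 0) : EqOn U₁ U₂ (Ico 0 τ) := by
  intro t₁ ht₁
  have hκ := p.κ_pos
  have hsub : Icc 0 t₁ ⊆ Ico 0 τ := fun s hs => ⟨hs.1, hs.2.trans_lt ht₁.2⟩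
  set K : ℝ → ℝ := fun t => p.diffBound (U₁ t, U₂ t) with hK
  have hKc : ContinuousOn K (Ico 0 τ) :=
    continuous_diffBound.comp_continuousOn (h₁.continuousOn.prodMk h₂.continuousOn)
  obtain ⟨C, hC⟩ := (isCompact_Icc.image_of_continuousOn (hKc.mono hsub)).bddAbove
  set e : ℝ → ℝ := fun t => ‖(U₁ t - U₂ t).d 0‖ ^ 2 + p.κ * ‖(U₁ t - U₂ t).d 1‖ ^ 2 with he
  have he0 : ∀ t, 0 ≤ e t := fun t => by positivity
  have hder : ∀ t ∈ Ico 0 τ, ∃ e', HasDerivWithinAt e e' (Ico 0 τ) t ∧ |e'| ≤ 2 * K t * e t := by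
    intro t ht
    obtain ⟨W₁, hW₁, hE₁⟩ := h₁.exists_deriv t ht
    obtain ⟨W₂, hW₂, hE₂⟩ := h₂.exists_deriv t ht
    have hd : ∀ i : Fin 3, HasDerivWithinAt (fun t => (U₁ t - U₂ t).d i.castSucc)
        ((W₁ - W₂).d i) (Ico 0 τ) t := fun i =>
      (dL i).hasFDerivAt.comp_hasDerivWithinAt t (hW₁.sub hW₂)
    refine ⟨_, ((hd 0).norm_sq).add (((hd 1).norm_sq).const_mul p.κ), ?_⟩
    have := hE₁.abs_inner_le hE₂
    calc _ = 2 * |inner ℝ ((U₁ t - U₂ t).d 0) ((W₁ - W₂).d 0)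
          + p.κ * inner ℝ ((U₁ t - U₂ t).d 1) ((W₁ - W₂).d 1)| := by
          rw [← abs_two, ← abs_mul, abs_two]
          congr 1
          change 2 * inner ℝ ((U₁ t - U₂ t).d 0) ((W₁ - W₂).d 0)
            + p.κ * (2 * inner ℝ ((U₁ t - U₂ t).d 1) ((W₁ - W₂).d 1)) = _
          ring
      _ ≤ 2 * (K t * e t) := mul_le_mul_of_nonneg_left this zero_le_two
      _ = _ := by ring
  have hez : e t₁ = 0 := by
    choose! e' he' hle using hder
    refine eq_zero_of_abs_deriv_le_mul_abs_self_of_eq_zero_right (f := e) (f' := e') (K := 2 * C)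
      (a := 0) (b := t₁) (fun s hs => (he' s (hsub hs)).continuousWithinAt.mono hsub)
      (fun s hs => (he' s (hsub (Ico_subset_Icc_self hs))).mono_of_mem_nhdsWithin ?_)
      (by simp only [he, h0, sub_self]
          have : ∀ i, (0 : SobolevH 3).d i = 0 := fun i => rfl
          rw [this, this, norm_zero]; ring) (fun s hs => ?_) t₁ ⟨ht₁.1, le_rfl⟩
    · exact mem_of_superset (Ico_mem_nhdsGE (hs.2.trans ht₁.2)) (Ico_subset_Ico_left hs.1)
    · have hs' := Ico_subset_Icc_self hs
      have := hC ⟨s, hs', rfl⟩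
      rw [Real.norm_eq_abs, Real.norm_eq_abs, abs_of_nonneg (he0 s)]
      exact (hle s (hsub hs')).trans (mul_le_mul_of_nonneg_right (by linarith) (he0 s))
  have h1 : ‖(U₁ t₁ - U₂ t₁).d 0‖ ^ 2 = 0 := by
    have a1 := sq_nonneg ‖(U₁ t₁ - U₂ t₁).d 0‖
    have a2 : 0 ≤ p.κ * ‖(U₁ t₁ - U₂ t₁).d 1‖ ^ 2 := by positivity
    simp only [he] at hez
    linarith
  have h2 : (U₁ t₁ - U₂ t₁).d 0 = 0 := norm_eq_zero.1 (pow_eq_zero_iff two_ne_zero |>.1 h1)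
  -- A weak derivative is determined by its function, so vanishing of the zeroth entry propagates to
  -- all entries of the tuple.
  have hD : ∀ (V : SobolevH 3) (i : Fin 3), V.d i.castSucc = 0 → V.d i.succ = 0 := fun V i hV => by
    have : toH1 i V = 0 := J_injective (by rw [J_toH1, hV, map_zero])
    rw [← D_toH1, this, map_zero]
  have h3 := hD _ 0 h2
  have h4 := hD _ 1 h3
  have h5 := hD _ 2 h4
  refine sub_eq_zero.1 (ext_d fun i => ?_)
  fin_cases i
  exacts [h2, h3, h4, h5]

end TransportCoeff

/-! ### Eulerian solutions read along the Lagrangian flow -/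

theorem H1R.bddAbove_range_rep (u : H1R) : BddAbove (range (rep u)) :=
  ⟨‖u‖, by rintro _ ⟨ξ, rfl⟩; exact (le_abs_self _).trans (abs_rep_le _ _)⟩

namespace TransportCoeff

open H1R SobolevH LState

variable {p : TransportCoeff}

theorem EulerSolution.mono {S S' : Set ℝ} {U : ℝ → SobolevH 3} (h : p.EulerSolution S U)
    (hS : S' ⊆ S) : p.EulerSolution S' U :=
  ⟨h.continuousOn.mono hS, fun t ht => by
    obtain ⟨W, h1, h2⟩ := h.exists_deriv t (hS ht)
    exact ⟨W, h1.mono hS, h2⟩⟩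

/-- The initial state of the Lagrangian system. -/
noncomputable def initialState (ζ₀ : SobolevH 3) : LState :=
  (0, 0, toH1 0 ζ₀, toH1 1 ζ₀, toH1 2 ζ₀)

theorem initialState_mem (ζ₀ : SobolevH 3) : initialState ζ₀ ∈ Omega :=
  ⟨1, one_pos, fun x => by simp [initialState]⟩

theorem lagrangianSolution_of_initialState {ζ₀ : SobolevH 3} {τ : ℝ} {X : ℝ → LState}
    (hX : IsODESolution p.field Omega (initialState ζ₀) τ X) : p.LagrangianSolution τ X :=
  lagrangianSolution_of_isODESolution (by rw [D_toH1, J_toH1]; rfl) (by rw [D_toH1, J_toH1]; rfl) hX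

theorem pull_zero (f : L2R) : pull 0 0 f = f := by
  refine Lp.ext ?_
  have h : IsFlow 0 0 := ⟨by rw [map_zero, map_zero], 1, one_pos, fun x => by simp⟩
  filter_upwards [h.pull_ae (t := 0) f] with x hx
  have h1 := h.flowInv_flowMap (t := 0) x
  rw [show flowMap 0 0 x = x by simp [flowMap]] at h1
  rw [hx, h1]

theorem pull_initialState (ζ₀ : SobolevH 3) (i : Fin 4) :
    pull 0 (initialState ζ₀).Y (lagProfile (initialState ζ₀) i) = ζ₀.d i := by
  change pull 0 0 _ = _
  rw [pull_zero]
  fin_cases i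
  · exact J_toH1 0 ζ₀
  · exact J_toH1 1 ζ₀
  · exact J_toH1 2 ζ₀
  · have := divL_add_mulL (ρ := 0) ⟨1, one_pos, fun x => by simp⟩ (D (toH1 2 ζ₀))
    rw [map_zero, zero_apply, add_zero] at this
    exact this.trans (D_toH1 2 ζ₀)

/-- The Eulerian solution with the same initial profile is carried by the Lagrangian one. -/
theorem EulerSolution.d_eq_pull {ζ₀ : SobolevH 3} {τ : ℝ} {U : ℝ → SobolevH 3} {X : ℝ → LState}
    (hU : p.EulerSolution (Ico 0 τ) U) (hU0 : U 0 = ζ₀)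
    (hX : IsODESolution p.field Omega (initialState ζ₀) τ X) {t : ℝ} (ht : t ∈ Ico 0 τ) (i : Fin 4) :
    (U t).d i = pull t (X t).Y (lagProfile (X t) i) := by
  have h := lagrangianSolution_of_initialState hX
  obtain ⟨V, W, hV, hW, hVc, -, hd⟩ := h.exists_eulerian
  have hV' : p.EulerSolution (Ico 0 τ) V :=
    ⟨hVc, fun t ht => ⟨W t, hd t ht, h.eulerian_eq ht (hV t ht) (hW t ht)⟩⟩
  have h0 : (0:ℝ) ∈ Ico 0 τ := ⟨le_rfl, ht.1.trans_lt ht.2⟩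
  have hV0 : V 0 = ζ₀ := ext_d fun i => by
    rw [hV 0 h0, hX.1]; exact pull_initialState ζ₀ i
  rw [hU.eqOn hV' (hU0.trans hV0.symm) ht, hV t ht]

theorem rep_toH1_flowMap {X : LState} {t : ℝ} (h : IsFlow X.Y X.ρ) {V u : H1R}
    (hV : J V = pull t X.Y (J u)) (ξ : ℝ) : rep V (flowMap t X.Y ξ) = rep u ξ := by
  have : rep V = fun x => rep u (flowInv t X.Y x) := by
    refine rep_eq_of_ae ((continuous_rep u).comp h.continuous_flowInv) ?_
    rw [hV]
    filter_upwards [h.pull_ae (t := t) (J u), h.ae_flowInv (t := t) (J_ae u)] with x a b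
    rw [a, b]
  rw [this]
  simp only [h.flowInv_flowMap]

section eulerian

variable {ζ₀ : SobolevH 3} {τ : ℝ} {U : ℝ → SobolevH 3} {X : ℝ → LState}
  (hU : p.EulerSolution (Ico 0 τ) U) (hU0 : U 0 = ζ₀)
  (hX : IsODESolution p.field Omega (initialState ζ₀) τ X)
include hU hU0 hX

theorem EulerSolution.rep_z {t : ℝ} (ht : t ∈ Ico 0 τ) (ξ : ℝ) :
    rep (toH1 0 (U t)) (flowMap t (X t).Y ξ) = rep (X t).z ξ :=
  rep_toH1_flowMap ((lagrangianSolution_of_initialState hX).isFlow ht)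
    ((J_toH1 0 (U t)).trans (hU.d_eq_pull hU0 hX ht 0)) ξ

theorem EulerSolution.rep_v {t : ℝ} (ht : t ∈ Ico 0 τ) (ξ : ℝ) :
    rep (toH1 1 (U t)) (flowMap t (X t).Y ξ) = rep (X t).v ξ :=
  rep_toH1_flowMap ((lagrangianSolution_of_initialState hX).isFlow ht)
    ((J_toH1 1 (U t)).trans (hU.d_eq_pull hU0 hX ht 1)) ξ

theorem EulerSolution.exists_abs_z_le : ∃ C, ∀ t ∈ Ico 0 τ, ∀ x, |rep (toH1 0 (U t)) x| ≤ C := by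
  have h := lagrangianSolution_of_initialState hX
  obtain ⟨C, -, hC⟩ := h.exists_energy_bound
  refine ⟨C, fun t ht x => ?_⟩
  obtain ⟨ξ, rfl⟩ := flowMap_surjective t (X t).Y x
  rw [hU.rep_z hU0 hX ht]
  exact (hC t ht ξ).1

theorem EulerSolution.iSup_slope {t : ℝ} (ht : t ∈ Ico 0 τ) :
    ⨆ x, rep (toH1 1 (U t)) x = ⨆ ξ, rep (X t).v ξ := by
  rw [← (flowMap_surjective t (X t).Y).iSup_comp]
  exact iSup_congr fun ξ => hU.rep_v hU0 hX ht ξ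

end eulerian

/-- A Lagrangian solution exists as long as the Eulerian one does. -/
theorem EulerSolution.exists_lagrangian {ζ₀ : SobolevH 3} {T : ℝ} {U : ℝ → SobolevH 3} (hT : 0 < T)
    (hU : p.EulerSolution (Ico 0 T) U) (hU0 : U 0 = ζ₀) :
    ∃ X, IsODESolution p.field Omega (initialState ζ₀) T X := by
  refine exists_isODESolution isOpen_Omega (fun X hX => p.contDiffAt_field hX)
    (initialState_mem ζ₀) hT fun τ hτ0 hτT X hX => ?_
  have hsub : Icc 0 τ ⊆ Ico 0 T := fun s hs => ⟨hs.1, hs.2.trans_lt hτT⟩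
  have hc : ContinuousOn (fun t => ‖toH1 1 (U t)‖) (Icc 0 τ) :=
    ((toH1 1).continuous.comp_continuousOn (hU.continuousOn.mono hsub)).norm
  -- Before T the Eulerian solution is continuous in H³ up to and including τ, which bounds the
  -- slope and lets the Lagrangian solution pass τ.
  obtain ⟨M, hM⟩ := (isCompact_Icc.image_of_continuousOn hc).bddAbove
  refine (lagrangianSolution_of_initialState hX).exists_tendsto (M := M) hτ0 fun t ht x => ?_
  rw [← (hU.mono (Ico_subset_Ico_right hτT.le)).rep_v hU0 hX ht]
  exact ((le_abs_self _).trans (abs_rep_le _ _)).trans (hM ⟨t, Ico_subset_Icc_self ht, rfl⟩)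

/-! ### Growth of the slope above the threshold -/

namespace LagrangianSolution

variable {τ : ℝ} {X : ℝ → LState} (h : p.LagrangianSolution τ X)
include h

/-- Above a threshold the slope along a characteristic grows at least linearly. -/
theorem exists_threshold : ∃ m, ∀ ξ, ∀ t₁ ∈ Ico 0 τ, ∀ t₂ ∈ Ico 0 τ, t₁ ≤ t₂ →
    m ≤ rep (X t₁).v ξ → rep (X t₁).v ξ + (t₂ - t₁) / 2 ≤ rep (X t₂).v ξ := by
  obtain ⟨C, hC, hb⟩ := h.exists_energy_bound
  have ha := p.a_pos
  have hpos : 0 < 2 * (C + 1) / p.a := by positivity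
  -- Above this value v ≥ 1, hence v² ≥ v ≥ 2(C + 1)/a and v_t ≥ (a/2)v² - C ≥ 1, which is strictly
  -- more than the rate 1/2 to be proved.
  refine ⟨2 * (C + 1) / p.a + 1, fun ξ t₁ ht₁ t₂ ht₂ hle hm => ?_⟩
  have hsub : Icc t₁ t₂ ⊆ Ico 0 τ := fun s hs => ⟨ht₁.1.trans hs.1, hs.2.trans_lt ht₂.2⟩
  -- The barrier is a line of slope 1/2 and the comparison is stated for negatives; the strict
  -- inequality of rates is needed only at times of contact.
  have key := image_le_of_deriv_right_lt_deriv_boundary' (a := t₁) (b := t₂)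
    (f := fun t => - rep (X t).v ξ)
    (f' := fun t => -(p.a / 2 * rep (X t).v ξ ^ 2
      + p.κ⁻¹ * (rep (p.g (X t).z) ξ - rep (p.R (X t)) ξ)))
    (B := fun t => -(rep (X t₁).v ξ + (t - t₁) / 2)) (B' := fun _ => -(1 / 2))
    (fun t ht => (h.hasDerivAt_rep_v (hsub ht) ξ).neg.continuousAt.continuousWithinAt)
    (fun t ht => (h.hasDerivAt_rep_v (hsub (Ico_subset_Icc_self ht)) ξ).neg.hasDerivWithinAt)
    (by simp) (by fun_prop)
    (fun t _ => ((((hasDerivAt_id t).sub_const t₁).div_const 2).const_add _).neg.hasDerivWithinAt)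
    (fun t ht heq => by
      have h1 := (abs_le.1 (hb t (hsub (Ico_subset_Icc_self ht)) ξ).2).1
      have h2 : 2 * (C + 1) / p.a + 1 ≤ rep (X t).v ξ := by
        have := ht.1
        linarith
      have h3 : 2 * (C + 1) / p.a ≤ rep (X t).v ξ ^ 2 := by nlinarith
      have h4 := mul_le_mul_of_nonneg_left h3 (half_pos ha).le
      have h5 : p.a / 2 * (2 * (C + 1) / p.a) = C + 1 := by field_simp
      linarith)
    (right_mem_Icc.2 hle)
  linarith

/-- A characteristic that once exceeds both m and the threshold stays above m, and so does the
supremum. -/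
theorem tendsto_iSup_slope (hub : ∀ m, ∃ t ∈ Ico 0 τ, ∃ ξ, m < rep (X t).v ξ) :
    Tendsto (fun t => ⨆ ξ, rep (X t).v ξ) (𝓝[<] τ) atTop := by
  obtain ⟨m₀, hm₀⟩ := h.exists_threshold
  refine tendsto_atTop.2 fun m => ?_
  obtain ⟨t₁, ht₁, ξ, hξ⟩ := hub (max m m₀)
  filter_upwards [Ioo_mem_nhdsLT ht₁.2] with t ht
  have := hm₀ ξ t₁ ht₁ t ⟨ht₁.1.trans ht.1.le, ht.2⟩ ht.1.le ((le_max_right _ _).trans hξ.le)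
  have h2 := le_ciSup (bddAbove_range_rep (X t).v) ξ
  linarith [le_max_left m m₀, ht.1]

theorem exists_strictMonoOn_iSup_slope (hub : ∀ m, ∃ t ∈ Ico 0 τ, ∃ ξ, m < rep (X t).v ξ) :
    ∃ t₀ ∈ Ico 0 τ, StrictMonoOn (fun t => ⨆ ξ, rep (X t).v ξ) (Ico t₀ τ) := by
  obtain ⟨m₀, hm₀⟩ := h.exists_threshold
  obtain ⟨t₀, ht₀, ξ₀, hξ₀⟩ := hub m₀
  refine ⟨t₀, ht₀, fun t₁ ht₁ t₂ ht₂ hlt => ?_⟩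
  have h₁ : t₁ ∈ Ico 0 τ := ⟨ht₀.1.trans ht₁.1, ht₁.2⟩
  have h₂ : t₂ ∈ Ico 0 τ := ⟨ht₀.1.trans ht₂.1, ht₂.2⟩
  have h3 := hm₀ ξ₀ t₀ ht₀ t₁ h₁ ht₁.1 hξ₀.le
  have h4 := le_ciSup (bddAbove_range_rep (X t₁).v) ξ₀
  -- The supremum need not be attained. A label within (t₂ - t₁)/4 of it and above the threshold
  -- gains (t₂ - t₁)/2, which leaves a strict increase.
  obtain ⟨ξ, hξ⟩ := exists_lt_of_lt_ciSup (f := fun ξ => rep (X t₁).v ξ)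
    (b := max m₀ ((⨆ ξ, rep (X t₁).v ξ) - (t₂ - t₁) / 4))
    (max_lt (by linarith [ht₁.1]) (by linarith))
  have h5 := hm₀ ξ t₁ h₁ t₂ h₂ hlt.le ((le_max_left _ _).trans hξ.le)
  have h6 := le_ciSup (bddAbove_range_rep (X t₂).v) ξ
  have h7 := (le_max_right _ _).trans_lt hξ
  change (⨆ ξ, rep (X t₁).v ξ) < ⨆ ξ, rep (X t₂).v ξ
  linarith

end LagrangianSolution

/-! ### The surface equation and the blow-up theorem -/

/-- The coefficients of the surface equation. -/
noncomputable def surface (ε μ : ℝ) (hε : 0 < ε) (hμ : 0 < μ) : TransportCoeff where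
  -- Matching with the expanded transport form at κ = l² = μ/12: aκ = 7εμ/24, 2b₂ - a = 3ε/2, 3b₃ =
  -- -3ε²/8 and 4b₄ = 3ε³/16.
  a := 7 / 2 * ε
  l := √(μ / 12)
  b₂ := 5 / 2 * ε
  b₃ := -(1 / 8) * ε ^ 2
  b₄ := 3 / 64 * ε ^ 3
  a_pos := by positivity
  l_pos := by positivity

variable {ε μ : ℝ} {hε : 0 < ε} {hμ : 0 < μ}

theorem eulerEq_surface_iff {U : SobolevH 3} {W : SobolevH 2} :
    (surface ε μ hε hμ).EulerEq U W ↔ SurfaceEq ε μ U W := by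
  have hκ : (surface ε μ hε hμ).κ = μ / 12 := by
    rw [κ_eq]; exact Real.sq_sqrt (by positivity)
  refine eventually_congr (ae_of_all _ fun x => ?_)
  rw [hκ]
  simp only [surface]
  constructor <;> intro h <;> linear_combination h

end TransportCoeff

open TransportCoeff H1R SobolevH in
theorem IsSurfaceSolution.exists_eulerSolution {ε μ : ℝ} (hε : 0 < ε) (hμ : 0 < μ)
    {ζ₀ : SobolevH 3} {T : ℝ} {ζ : ℝ → ℝ → ℝ} (h : IsSurfaceSolution ε μ ζ₀ T ζ) :
    ∃ U, (surface ε μ hε hμ).EulerSolution (Ico 0 T) U ∧ U 0 = ζ₀ ∧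
      ∀ t ∈ Ico 0 T, ζ t = rep (toH1 0 (U t)) := by
  obtain ⟨U, hrep, hc, hd, h0, heq⟩ := h
  refine ⟨U, ⟨hc, fun t ht => ⟨_, (hd.differentiableOn (by simp) t ht).hasDerivWithinAt,
    eulerEq_surface_iff.2 (heq t ht)⟩⟩, h0, fun t ht => ?_⟩
  refine (rep_eq_of_ae (hrep t ht).1 ?_).symm
  rw [J_toH1]
  exact (hrep t ht).2

open TransportCoeff H1R SobolevH LState in
theorem isSurfaceSolution_of_isODESolution {ε μ : ℝ} {hε : 0 < ε} {hμ : 0 < μ}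
    {ζ₀ : SobolevH 3} {T : ℝ} (hT : 0 < T) {X : ℝ → LState}
    (hX : IsODESolution (surface ε μ hε hμ).field Omega (initialState ζ₀) T X) :
    ∃ ζ, IsSurfaceSolution ε μ ζ₀ T ζ := by
  have h := lagrangianSolution_of_initialState hX
  obtain ⟨U, W, hU, hW, hUc, hWc, hd⟩ := h.exists_eulerian
  have hu := uniqueDiffOn_Ico (0:ℝ) T
  have hW' : ∀ t ∈ Ico 0 T, derivWithin (fun s => (U s).incl) (Ico 0 T) t = W t := fun t ht =>
    (hd t ht).derivWithin (hu t ht)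
  refine ⟨fun t => rep (toH1 0 (U t)), U, fun t ht => ⟨continuous_rep _, ?_⟩, hUc, ?_, ?_, ?_⟩
  · have := J_ae (toH1 0 (U t))
    rw [J_toH1] at this
    exact this
  · rw [contDiffOn_one_iff_derivWithin hu]
    exact ⟨fun t ht => (hd t ht).differentiableWithinAt, hWc.congr hW'⟩
  · refine ext_d fun i => ?_
    rw [hU 0 ⟨le_rfl, hT⟩, hX.1]
    exact pull_initialState ζ₀ i
  · intro t ht
    rw [hW' t ht]
    exact eulerEq_surface_iff.1 (h.eulerian_eq ht (hU t ht) (hW t ht))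

open TransportCoeff H1R SobolevH LState in
/-- At a finite maximal existence time the slope is unbounded above. -/
theorem IsMaximalSurfaceSolution.exists_lt_slope {ε μ : ℝ} {hε : 0 < ε} {hμ : 0 < μ}
    {ζ₀ : SobolevH 3} {T : ℝ} {ζ : ℝ → ℝ → ℝ} (hζ : IsMaximalSurfaceSolution ε μ ζ₀ T ζ)
    {X : ℝ → LState}
    (hX : IsODESolution (surface ε μ hε hμ).field Omega (initialState ζ₀) T X) (m : ℝ) :
    ∃ t ∈ Ico 0 T, ∃ ξ, m < rep (X t).v ξ := by
  by_contra! hM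
  obtain ⟨hT, hsol, hmax⟩ := hζ
  obtain ⟨X₁, hX₁, hlim⟩ := (lagrangianSolution_of_initialState hX).exists_tendsto hT hM
  obtain ⟨T', hT', Z, hZ⟩ := hX.extend isOpen_Omega (fun X hX => contDiffAt_field _ hX) hT hX₁ hlim
  obtain ⟨ζ', hζ'⟩ := isSurfaceSolution_of_isODESolution (hT.trans hT') hZ
  obtain ⟨U, hU, hU0, hUζ⟩ := hsol.exists_eulerSolution hε hμ
  obtain ⟨U', hU', hU'0, hUζ'⟩ := hζ'.exists_eulerSolution hε hμ
  -- Uniqueness shows that the solution built from the continued Lagrangian one really extends ζ,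
  -- contradicting maximality.
  refine hmax T' hT' ζ' hζ' fun t ht => ?_
  rw [hUζ t ht, hUζ' t ⟨ht.1, ht.2.trans hT'⟩,
    hU.eqOn (hU'.mono (Ico_subset_Ico_right hT'.le)) (hU0.trans hU'0.symm) ht]

theorem mainTheorem5 (ε μ : ℝ) (hε : 0 < ε) (hμ : 0 < μ) (ζ₀ : SobolevH 3) (T : ℝ)
    (ζ : ℝ → ℝ → ℝ) (hζ : IsMaximalSurfaceSolution ε μ ζ₀ T ζ) :
    (∃ C : ℝ, ∀ t ∈ Ico 0 T, ∀ x : ℝ, |ζ t x| ≤ C) ∧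
    (∀ t ∈ Ico 0 T, Differentiable ℝ (ζ t) ∧ BddAbove (range (deriv (ζ t)))) ∧
    Tendsto (fun t => ⨆ x : ℝ, deriv (ζ t) x) (𝓝[<] T) atTop ∧
    ∃ t₀ ∈ Ico 0 T, StrictMonoOn (fun t => ⨆ x : ℝ, deriv (ζ t) x) (Ico t₀ T) := by
  have hT := hζ.1
  obtain ⟨U, hU, hU0, hUζ⟩ := hζ.2.1.exists_eulerSolution hε hμ
  obtain ⟨X, hX⟩ := hU.exists_lagrangian hT hU0
  have hub := hζ.exists_lt_slope hX
  have h := TransportCoeff.lagrangianSolution_of_initialState hX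
  have hder : ∀ t ∈ Ico 0 T, ∀ x,
      HasDerivAt (ζ t) (H1R.rep (SobolevH.toH1 1 (U t)) x) x := fun t ht x => by
    rw [hUζ t ht]
    exact H1R.hasDerivAt_rep (by rw [SobolevH.D_toH1, SobolevH.J_toH1]; rfl) x
  have hderiv : ∀ t ∈ Ico 0 T, deriv (ζ t) = H1R.rep (SobolevH.toH1 1 (U t)) := fun t ht =>
    funext fun x => (hder t ht x).deriv
  have hsup : EqOn (fun t => ⨆ ξ, H1R.rep (X t).v ξ) (fun t => ⨆ x, deriv (ζ t) x) (Ico 0 T) :=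
    fun t ht => by
      simp only [hderiv t ht]
      exact (hU.iSup_slope hU0 hX ht).symm
  refine ⟨?_, fun t ht => ⟨fun x => (hder t ht x).differentiableAt, ?_⟩, ?_, ?_⟩
  · obtain ⟨C, hC⟩ := hU.exists_abs_z_le hU0 hX
    exact ⟨C, fun t ht x => by rw [hUζ t ht]; exact hC t ht x⟩
  · rw [hderiv t ht]
    exact H1R.bddAbove_range_rep _
  · refine (h.tendsto_iSup_slope hub).congr' ?_
    filter_upwards [Ioo_mem_nhdsLT hT] with t ht
    exact hsup (Ioo_subset_Ico_self ht)
  · obtain ⟨t₀, ht₀, hm⟩ := h.exists_strictMonoOn_iSup_slope hub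
    exact ⟨t₀, ht₀, hm.congr (hsup.mono (Ico_subset_Ico_left ht₀.1))⟩
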